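/- Let $n\ge 0$ and let $(N^{2n+1}, I,\xi,\eta,g)$ be a smooth quasi-Sasakian manifold: $I$ is a $(1,1)$-tensor field, $\xi$ a vector field, $\eta$ a $1$-form and $g$ a Riemannian metric with $I^2=-\mathrm{Id}+\eta\otimes\xi$, $\eta(\xi)=1$, $g(IU,IV)=g(U,V)-\eta(U)\eta(V)$; the structure is normal, i.e. $[I,I]+d\eta\otimes\xi=0$, where $[I,I](X,Y)=I^2[X,Y]+[IX,IY]-I[IX,Y]-I[X,IY]$ and $d\eta(X,Y)=X\eta(Y)-Y\eta(X)-\eta([X,Y])$; and the fundamental form $\omega=g(\cdot,I\cdot)$ is closed. Let $\Omega$ be a closed $2$-form on $N$ representing an integral cohomology class, and let $\pi:P\to N$ be a principal $S^1$-bundle ($S^1=\mathbb R/\mathbb Z$) with a connection $1$-form $\theta$ such that $d\theta=\pi^*\Omega$. Let $(J,h)$ be the almost Hermitian structure on $P$ given by $$\theta(JX)=-\eta(\pi_*X),\qquad \pi_*(JX)=I(\pi_*X)+\theta(X)\,\xi,\qquad h(X,Y)=g(\pi_*X,\pi_*Y)+\theta(X)\theta(Y).$$ Here $(J,h)$ is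 called Hermitian if the Nijenhuis tensor of $J$ vanishes, and SKT if it is Hermitian and $d(J\,dF)=0$, where $F=h(\cdot,J\cdot)$ and $(J\beta)(X_1,\dots,X_r)=\beta(JX_1,\dots,JX_r)$ (the Kähler case $dF=0$ is included). Wedge products are normalized by $(\alpha\wedge\beta)(X,Y)=\alpha(X)\beta(Y)-\alpha(Y)\beta(X)$ for $1$-forms. Then: 1. $(J,h)$ is SKT if and only if $\Omega(I\cdot,I\cdot)=\Omega$, $i_\xi\Omega=0$ and $d\eta\wedge d\eta=-\Omega\wedge\Omega$. 2. There is a unique connection $\nabla^c$ on $N$ that preserves $g$ and whose torsion, as the tensor $g(T(X,Y),Z)$, is the $3$-form $d\eta\wedge\eta$; with $\nabla^g$ the Levi-Civita connection of $g$, it is given by $$g(\nabla^c_XY,Z)=g(\nabla^g_XY,Z)+\tfrac12\,(d\eta\wedge\eta)(X,Y,Z).$$ If $(J,h)$ is Hermitian and $\nabla^B$ is its Bismut connection (the connection preserving $J$ and $h$ with totally skew-symmetric torsion), then $$h(\nabla^B_XY,Z)=g(\nabla^c_{\pi_*X}\pi_*Y,\pi_*Z)$$ for all $X,Y,Z\in\ker\theta$,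 where $Y$ is a projectable vector field, i.e. the horizontal lift of a vector field $\pi_*Y$ on $N$. -/

import Mathlib

open scoped Manifold ContDiff
open Bundle

noncomputable section

namespace SKTCircleBundle

section Forms

variable {E : Type*} [NormedAddCommGroup E] [NormedSpace ℝ E]
  {H : Type*} [TopologicalSpace H] (I : ModelWithCorners ℝ E H)
  {M : Type*} [TopologicalSpace M] [ChartedSpace H M]

/-- Vector fields on `M` (not necessarily smooth). -/
abbrev VField (M : Type*) [TopologicalSpace M] [ChartedSpace H M] : Type _ :=
  ∀ x : M, TangentSpace I x

/-- Fields of covectors on `M` (1-forms, not necessarily smooth). -/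
abbrev Covector (M : Type*) [TopologicalSpace M] [ChartedSpace H M] : Type _ :=
  ∀ x : M, TangentSpace I x →L[ℝ] ℝ

/-- Fields of endomorphisms of the tangent spaces (tensor fields of type `(1,1)`). -/
abbrev EndField (M : Type*) [TopologicalSpace M] [ChartedSpace H M] : Type _ :=
  ∀ x : M, TangentSpace I x →L[ℝ] TangentSpace I x

/-- Fields of bilinear forms on the tangent spaces (tensor fields of type `(0,2)`). -/
abbrev BilinField (M : Type*) [TopologicalSpace M] [ChartedSpace H M] : Type _ :=
  ∀ x : M, TangentSpace I x →L[ℝ] TangentSpace I x →L[ℝ] ℝ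

/-- Differential `k`-forms on `M` (not necessarily smooth). -/
abbrev DForm (M : Type*) [TopologicalSpace M] [ChartedSpace H M] (k : ℕ) : Type _ :=
  ∀ x : M, TangentSpace I x [⋀^Fin k]→L[ℝ] ℝ

variable {I}

/-- The expression of a `k`-form in the preferred chart at `x₀`, that is, its pullback to the
model space by the inverse of the chart. -/
def DForm.inChart {k : ℕ} (α : DForm I M k) (x₀ : M) (y : E) : E [⋀^Fin k]→L[ℝ] ℝ :=
  (α ((extChartAt I x₀).symm y)).compContinuousLinearMap
    (mfderivWithin 𝓘(ℝ, E) I (extChartAt I x₀).symm (Set.range I) y)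

/-- A `k`-form is smooth if its expressions in the charts are. -/
def DForm.IsSmooth {k : ℕ} (α : DForm I M k) : Prop :=
  ∀ x₀ : M, ContDiffOn ℝ ∞ (α.inChart x₀) (extChartAt I x₀).target

/-- The exterior derivative of a `k`-form on a manifold, computed in the preferred chart at each
point. The normalization is `dα(X, Y) = X(α(Y)) - Y(α(X)) - α([X, Y])` for a 1-form `α`. -/
def DForm.d {k : ℕ} (α : DForm I M k) : DForm I M (k + 1) := fun x ↦
  (extDerivWithin (α.inChart x) (Set.range I) (extChartAt I x x)).compContinuousLinearMap
    (mfderiv I 𝓘(ℝ, E) (extChartAt I x) x)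

/-- A field of covectors as a differential 1-form. -/
def Covector.toForm (α : Covector I M) : DForm I M 1 := fun x ↦
  ContinuousAlternatingMap.ofSubsingleton ℝ (TangentSpace I x) ℝ (0 : Fin 1) (α x)

end Forms

section Algebra

variable {V : Type*} [AddCommGroup V] [Module ℝ V] [TopologicalSpace V]

/-- The wedge product of alternating forms, evaluated on vectors, with the normalization
`(α ∧ β)(v) = 1 / (k! l!) ∑ σ, sign σ α(v_σ(1), …, v_σ(k)) β(v_σ(k+1), …, v_σ(k+l))`; in
particular `(α ∧ β)(u, v) = α(u) β(v) - α(v) β(u)` for 1-forms. -/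
def wedge {k l : ℕ} (α : V [⋀^Fin k]→L[ℝ] ℝ) (β : V [⋀^Fin l]→L[ℝ] ℝ)
    (v : Fin (k + l) → V) : ℝ :=
  ((k.factorial : ℝ) * (l.factorial : ℝ))⁻¹ *
    ∑ σ : Equiv.Perm (Fin (k + l)), ((Equiv.Perm.sign σ : ℤ) : ℝ) *
      (α (fun i ↦ v (σ (Fin.castAdd l i))) * β (fun j ↦ v (σ (Fin.natAdd k j))))

end Algebra

section AltForm

variable {V : Type*} [NormedAddCommGroup V] [NormedSpace ℝ V]

/-- The alternating form `(u, v) ↦ (B(u, v) - B(v, u)) / 2` of a bilinear form `B`. If `B` is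
skew-symmetric, this is `B` itself, see `altForm_apply_of_skew`. -/
def altForm (B : V →L[ℝ] V →L[ℝ] ℝ) : V [⋀^Fin 2]→L[ℝ] ℝ where
  toFun v := (1 / 2 : ℝ) * (B (v 0) (v 1) - B (v 1) (v 0))
  map_update_add' {inst} v i a b := by
    have := Subsingleton.elim inst (instDecidableEqFin 2)
    subst this
    fin_cases i <;> simp <;> ring
  map_update_smul' {inst} v i c a := by
    have := Subsingleton.elim inst (instDecidableEqFin 2)
    subst this
    fin_cases i <;> simp <;> ring
  map_eq_zero_of_eq' v i j hv hij := by
    fin_cases i <;> fin_cases j <;> simp_all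
  cont := by
    fun_prop

theorem altForm_apply_of_skew (B : V →L[ℝ] V →L[ℝ] ℝ) (hB : ∀ u v, B u v = -B v u) (u v : V) :
    altForm B ![u, v] = B u v := by
  change (1 / 2 : ℝ) * (B u v - B v u) = B u v
  rw [hB v u]; ring

end AltForm

section Structures

variable {E : Type*} [NormedAddCommGroup E] [NormedSpace ℝ E]
  {H : Type*} [TopologicalSpace H] {I : ModelWithCorners ℝ E H}
  {M : Type*} [TopologicalSpace M] [ChartedSpace H M]

/-- The fundamental 2-form `F(X, Y) = h(X, AY)` of a metric `h` and a field of endomorphisms `A`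
for which `h(·, A·)` is skew-symmetric. -/
def fundamentalForm (h : BilinField I M) (A : EndField I M) : DForm I M 2 := fun x ↦
  altForm (V := E) (ContinuousLinearMap.precomp ℝ (A x) ∘L h x)

/-- The action of a field of endomorphisms on forms, `(Aβ)(X₁, …, X_k) = β(AX₁, …, AX_k)`. -/
def EndField.act {k : ℕ} (A : EndField I M) (β : DForm I M k) : DForm I M k := fun x ↦
  (β x).compContinuousLinearMap (A x)

variable [IsManifold I 1 M]

/-- The vector field `X` is differentiable at `x`. -/
abbrev VField.DiffAt (X : VField I M) (x : M) : Prop := MDiffAt (T% X) x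

/-- The vector field `X` is smooth. -/
abbrev VField.IsSmooth (X : VField I M) : Prop := CMDiff ∞ (T% X)

/-- The Nijenhuis torsion `[A, A](X, Y) = A²[X, Y] + [AX, AY] - A[AX, Y] - A[X, AY]`. -/
def nijenhuis (A : EndField I M) (X Y : VField I M) : VField I M := fun x ↦
  A x (A x (VectorField.mlieBracket I X Y x))
    + VectorField.mlieBracket I (fun y ↦ A y (X y)) (fun y ↦ A y (Y y)) x
    - A x (VectorField.mlieBracket I (fun y ↦ A y (X y)) Y x)
    - A x (VectorField.mlieBracket I X (fun y ↦ A y (Y y)) x)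

/-- `(J, h)` is a Hermitian structure: `J² = -1`, `h(JX, JY) = h(X, Y)`, and `J` is integrable,
that is, its Nijenhuis torsion vanishes. -/
structure IsHermitian (J : EndField I M) (h : BilinField I M) : Prop where
  sq : ∀ (x : M) (u : TangentSpace I x), J x (J x u) = -u
  compat : ∀ (x : M) (u v : TangentSpace I x), h x (J x u) (J x v) = h x u v
  integrable : ∀ (X Y : VField I M) (x : M),
    VField.DiffAt X x →
    VField.DiffAt Y x →
    nijenhuis J X Y x = 0

/-- `(J, h)` is SKT (strong Kähler with torsion): it is Hermitian and, for its fundamental form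
`F(X, Y) = h(X, JY)`, the 3-form `J dF` is closed. -/
structure IsSKT (J : EndField I M) (h : BilinField I M) : Prop where
  hermitian : IsHermitian J h
  closed : ∀ x : M, (J.act (fundamentalForm h J).d).d x = 0

variable [IsManifold I 2 M] [FiniteDimensional ℝ E]

/-- The connection `nabla` preserves `h`: `X(h(Y, Z)) = h(∇_X Y, Z) + h(Y, ∇_X Z)`. -/
def PreservesMetric (h : BilinField I M)
    (nabla : CovariantDerivative I E (TangentSpace I : M → Type _)) : Prop :=
  ∀ (Y Z : VField I M) (x : M) (u : TangentSpace I x),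
    VField.DiffAt Y x →
    VField.DiffAt Z x →
    mvfderiv I (fun y ↦ h y (Y y) (Z y)) x u =
      h x (nabla Y x u) (Z x) + h x (Y x) (nabla Z x u)

/-- The connection `nabla` preserves `A`: `∇_X (AY) = A (∇_X Y)`. -/
def PreservesEnd (A : EndField I M)
    (nabla : CovariantDerivative I E (TangentSpace I : M → Type _)) : Prop :=
  ∀ (Y : VField I M) (x : M) (u : TangentSpace I x),
    VField.DiffAt Y x →
    nabla (fun y ↦ A y (Y y)) x u = A x (nabla Y x u)

/-- `nabla` is the Levi-Civita connection of `h`: metric and torsion-free. -/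
def IsLeviCivita (h : BilinField I M)
    (nabla : CovariantDerivative I E (TangentSpace I : M → Type _)) : Prop :=
  PreservesMetric h nabla ∧ nabla.torsion = 0

/-- `nabla` is the Bismut connection of the Hermitian structure `(J, h)`: it preserves `J` and `h`
and its torsion, as the tensor `h(T(X, Y), Z)`, is totally skew-symmetric. -/
structure IsBismut (J : EndField I M) (h : BilinField I M)
    (nabla : CovariantDerivative I E (TangentSpace I : M → Type _)) : Prop where
  metric : PreservesMetric h nabla
  complex : PreservesEnd J nabla
  skew : ∀ (x : M) (u v w : TangentSpace I x),
    h x (nabla.torsion x u v) w = -h x (nabla.torsion x u w) v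

end Structures

section AlmostContact

/-- An almost contact metric structure `(φ, ξ, η, g)` on a manifold of dimension `m`. -/
structure AlmostContactMetric (m : ℕ) (N : Type*) [TopologicalSpace N]
    [ChartedSpace (EuclideanSpace ℝ (Fin m)) N] [IsManifold (𝓡 m) ∞ N] where
  /-- The tensor field of type `(1,1)`. -/
  φ : EndField (𝓡 m) N
  /-- The vector field. -/
  ξ : VField (𝓡 m) N
  /-- The 1-form. -/
  η : Covector (𝓡 m) N
  /-- The Riemannian metric. -/
  g : ContMDiffRiemannianMetric (𝓡 m) ∞ (EuclideanSpace ℝ (Fin m))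
    (TangentSpace (𝓡 m) : N → Type _)
  smooth_φ : ContMDiff (𝓡 m)
    ((𝓡 m).prod 𝓘(ℝ, EuclideanSpace ℝ (Fin m) →L[ℝ] EuclideanSpace ℝ (Fin m))) ∞
    (fun x ↦ TotalSpace.mk' (EuclideanSpace ℝ (Fin m) →L[ℝ] EuclideanSpace ℝ (Fin m))
      (E := fun x : N ↦ TangentSpace (𝓡 m) x →L[ℝ] TangentSpace (𝓡 m) x) x (φ x))
  smooth_ξ : VField.IsSmooth ξ
  smooth_η : η.toForm.IsSmooth
  φ_sq : ∀ (x : N) (u : TangentSpace (𝓡 m) x), φ x (φ x u) = -u + η x u • ξ x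
  η_ξ : ∀ x : N, η x (ξ x) = 1
  compat : ∀ (x : N) (u v : TangentSpace (𝓡 m) x),
    g.inner x (φ x u) (φ x v) = g.inner x u v - η x u * η x v

namespace AlmostContactMetric

variable {m : ℕ} {N : Type*} [TopologicalSpace N]
  [ChartedSpace (EuclideanSpace ℝ (Fin m)) N] [IsManifold (𝓡 m) ∞ N]
  (S : AlmostContactMetric m N)

/-- The fundamental 2-form `ω(X, Y) = g(X, φY)`. -/
def fundForm : DForm (𝓡 m) N 2 := fundamentalForm S.g.inner S.φ

/-- The 2-form `dη`. -/
def dη : DForm (𝓡 m) N 2 := S.η.toForm.d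

/-- The structure is normal: `[φ, φ] + dη ⊗ ξ = 0`. With `dη(X, Y) = Xη(Y) - Yη(X) - η([X, Y])`
this says that the almost complex structure `J(X, f ∂ₜ) = (φX + fξ, -η(X) ∂ₜ)` on `N × ℝ` has
vanishing Nijenhuis torsion. (It is often written `[φ, φ] + 2 dη ⊗ ξ = 0`, in terms of
`dη(X, Y) = (Xη(Y) - Yη(X) - η([X, Y])) / 2`.) -/
def IsNormal : Prop :=
  ∀ (X Y : VField (𝓡 m) N) (x : N),
    VField.DiffAt X x →
    VField.DiffAt Y x →
    nijenhuis S.φ X Y x + S.dη x ![X x, Y x] • S.ξ x = 0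

/-- The structure is quasi-Sasakian: normal with closed fundamental form. -/
structure IsQuasiSasakian : Prop where
  normal : S.IsNormal
  closed : ∀ x : N, S.fundForm.d x = 0

/-- `nabla` is the connection `∇ᶜ` given by
`g(∇ᶜ_X Y, Z) = g(∇ᵍ_X Y, Z) + ½ (dη ∧ η)(X, Y, Z)`, with `∇ᵍ` the Levi-Civita connection. -/
def IsCanonicalConnection
    (nabla : CovariantDerivative (𝓡 m) (EuclideanSpace ℝ (Fin m))
      (TangentSpace (𝓡 m) : N → Type _)) : Prop :=
  ∃ nablag : CovariantDerivative (𝓡 m) (EuclideanSpace ℝ (Fin m))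
      (TangentSpace (𝓡 m) : N → Type _),
    IsLeviCivita S.g.inner nablag ∧
    ∀ (Y : VField (𝓡 m) N) (x : N) (u w : TangentSpace (𝓡 m) x),
      VField.DiffAt Y x →
      S.g.inner x (nabla Y x u) w = S.g.inner x (nablag Y x u) w
        + (1 / 2) * wedge (S.dη x) (S.η.toForm x) ![u, Y x, w]

/-- `nabla` is a metric connection whose torsion 3-form `g(T(X, Y), Z)` is `dη ∧ η`. -/
def IsMetricWithTorsion
    (nabla : CovariantDerivative (𝓡 m) (EuclideanSpace ℝ (Fin m))
      (TangentSpace (𝓡 m) : N → Type _)) : Prop :=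
  PreservesMetric S.g.inner nabla ∧
    ∀ (x : N) (u v w : TangentSpace (𝓡 m) x),
      S.g.inner x (nabla.torsion x u v) w = wedge (S.dη x) (S.η.toForm x) ![u, v, w]

end AlmostContactMetric

end AlmostContact

section CircleBundle

variable {k m : ℕ}
  {P : Type*} [TopologicalSpace P] [ChartedSpace (EuclideanSpace ℝ (Fin k)) P]
  {N : Type*} [TopologicalSpace N] [ChartedSpace (EuclideanSpace ℝ (Fin m)) N]

/-- `proj : P → N` is a smooth principal circle bundle (with structural group `S¹ = Circle`). -/
structure IsPrincipalCircleBundle [MulAction Circle P] (proj : P → N) : Prop where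
  smooth_smul : ContMDiff ((𝓡 1).prod (𝓡 k)) (𝓡 k) ∞ (fun q : Circle × P ↦ q.1 • q.2)
  smooth_proj : ContMDiff (𝓡 k) (𝓡 m) ∞ proj
  proj_smul : ∀ (c : Circle) (p : P), proj (c • p) = proj p
  locally_trivial : ∀ x : N, ∃ e : Trivialization Circle proj, x ∈ e.baseSet ∧
    ContMDiffOn (𝓡 k) ((𝓡 m).prod (𝓡 1)) ∞ e e.source ∧
    ContMDiffOn ((𝓡 m).prod (𝓡 1)) (𝓡 k) ∞ e.toOpenPartialHomeomorph.symm e.target ∧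
    ∀ p ∈ e.source, ∀ c : Circle, (e (c • p)).2 = c * (e p).2

/-- The fundamental vector field of the circle action, the velocity of `t ↦ exp(2πit) • p`; here
`S¹ = ℝ/ℤ`, so that curvature forms of connections represent integral cohomology classes. -/
def fundamentalField (k : ℕ) (P : Type*) [TopologicalSpace P]
    [ChartedSpace (EuclideanSpace ℝ (Fin k)) P] [MulAction Circle P] : VField (𝓡 k) P := fun p ↦
  mfderiv 𝓘(ℝ, ℝ) (𝓡 k) (fun t : ℝ ↦ Circle.exp (2 * Real.pi * t) • p) 0 (1 : ℝ)

/-- `θ` is a connection 1-form. -/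
structure IsConnectionForm [MulAction Circle P] (θ : Covector (𝓡 k) P) : Prop where
  smooth : θ.toForm.IsSmooth
  invariant : ∀ (c : Circle) (p : P) (u : TangentSpace (𝓡 k) p),
    θ (c • p) (mfderiv (𝓡 k) (𝓡 k) (fun q : P ↦ c • q) p u) = θ p u
  fundamental : ∀ p : P, θ p (fundamentalField k P p) = 1

/-- The linear map `X ↦ (π_* X, θ(X))` on the tangent space of `P` at `p`; it is invertible if `θ`
is a connection form on the principal circle bundle `proj`. -/
def splitting (proj : P → N) (θ : Covector (𝓡 k) P) (p : P) :
    TangentSpace (𝓡 k) p →L[ℝ] TangentSpace (𝓡 m) (proj p) × ℝ :=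
  (mfderiv (𝓡 k) (𝓡 m) proj p).prod (θ p)

variable [IsManifold (𝓡 m) ∞ N]

/-- The almost complex structure `J` on `P`, determined by `π_*(JX) = φ(π_*X) + θ(X)ξ` and
`θ(JX) = -η(π_*X)`, where `π_*` is the differential of the projection `proj`. -/
def totalJ (S : AlmostContactMetric m N) (proj : P → N) (θ : Covector (𝓡 k) P) :
    EndField (𝓡 k) P :=
  fun p ↦ (splitting proj θ p).inverse ∘L
    (((S.φ (proj p)).coprod (ContinuousLinearMap.toSpanSingleton ℝ (S.ξ (proj p)))).prod
      ((-S.η (proj p)) ∘L ContinuousLinearMap.fst ℝ (TangentSpace (𝓡 m) (proj p)) ℝ)) ∘L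
    splitting proj θ p

/-- The metric `h(X, Y) = g(π_*X, π_*Y) + θ(X)θ(Y)` on `P`. -/
def totalMetric (S : AlmostContactMetric m N) (proj : P → N) (θ : Covector (𝓡 k) P) :
    BilinField (𝓡 k) P :=
  fun p ↦ ContinuousLinearMap.precomp ℝ (mfderiv (𝓡 k) (𝓡 m) proj p) ∘L S.g.inner (proj p)
      ∘L mfderiv (𝓡 k) (𝓡 m) proj p
    + (θ p).smulRight (θ p)

end CircleBundle

end SKTCircleBundle

end

set_option linter.unusedSectionVars false

noncomputable section

open scoped Topology

namespace SKTCircleBundle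

/-! The map `(π_*, θ)` identifies each tangent space of `P` with a tangent space of `N` plus a line,
and it turns `J` into the model endomorphism `K(a, s) = (φ a + s ξ, -η a)`. Everything on `P`
follows from this intertwining.

Integrability. Seen as a vector-valued 1-form, `B = (π_*, θ)` has exterior derivative `(0, π^*Ω)`,
since second derivatives of `π` are symmetric and `dθ = π^*Ω`. Differentiating `B J = K B` splits
the Nijenhuis tensor of `J` into a part coming from `K` and a part coming from `dB`. Normality, with
its consequences `L_ξ φ = 0`, `i_ξ dη = 0` and `dη(φ·, φ·) = dη`, kills the first part. What remains
(`nijTensor_lift`) is `(Ω(π_*Ju, π_*v) + Ω(π_*u, π_*Jv)) ξ` in the base direction and `Ω(π_*u, π_*v)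
- Ω(π_*Ju, π_*Jv)` under `θ`. It vanishes exactly when `Ω` is `φ`-invariant and annihilated by `ξ`
(`isHermitian_iff`).

SKT. Since `F = π^*ω + π^*η ∧ θ` and `dω = 0`, one has `dF = π^*dη ∧ θ - π^*η ∧ π^*Ω`. The form
`π^*η` goes to `θ` under `J` and `θ` goes to `-π^*η`, while `π^*dη` and `π^*Ω` are `J`-invariant. So
`J dF = -π^*(dη ∧ η) - π^*Ω ∧ θ`, whose exterior derivative is `-π^*(dη ∧ dη + Ω ∧ Ω)`. As `π` is a
surjective submersion, `π^*` is injective on forms (`isSKT_iff`).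

Connections. A metric connection is determined by its torsion through the Koszul formula, and adding
half of a 3-form to the Levi-Civita connection realizes that 3-form as torsion. The Bismut torsion
is `-J dF`, which on `ker θ` is `π^*(dη ∧ η)`. Hence, on horizontal lifts, the Koszul formulas of
the Bismut connection and of `∇ᶜ` agree term by term (`bismut_horizontal`).

All local computations take place in the preferred chart at a point and are evaluated at its centre,
where the coordinate frame is the identity. -/

theorem two_le_infty : (2 : WithTop ℕ∞) ≤ ∞ := by
  exact WithTop.coe_le_coe.2 (le_top : (2 : ℕ∞) ≤ ⊤)

/-! ### Tensor fields in the preferred chart at a point -/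

section Charts

variable {E : Type*} [NormedAddCommGroup E] [NormedSpace ℝ E]
  {M : Type*} [TopologicalSpace M] [ChartedSpace E M]

/-- The coordinate frame of the preferred chart at `x₀`, as a function of the coordinates. -/
def frame (x₀ : M) (y : E) : E →L[ℝ] E :=
  mfderivWithin 𝓘(ℝ, E) 𝓘(ℝ, E) (extChartAt 𝓘(ℝ, E) x₀).symm (Set.range 𝓘(ℝ, E)) y

/-- The components of a vector field in the preferred chart at `x₀`. -/
def VField.coord (X : VField 𝓘(ℝ, E) M) (x₀ : M) (y : E) : E :=
  (frame x₀ y).inverse (X ((extChartAt 𝓘(ℝ, E) x₀).symm y))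

/-- The components of a field of endomorphisms in the preferred chart at `x₀`. -/
def EndField.coord (A : EndField 𝓘(ℝ, E) M) (x₀ : M) (y : E) : E →L[ℝ] E :=
  (frame x₀ y).inverse ∘L (show E →L[ℝ] E from A ((extChartAt 𝓘(ℝ, E) x₀).symm y)) ∘L frame x₀ y

/-- The components of a 1-form in the preferred chart at `x₀`. -/
def Covector.coord (α : Covector 𝓘(ℝ, E) M) (x₀ : M) (y : E) : E →L[ℝ] ℝ :=
  (show E →L[ℝ] ℝ from α ((extChartAt 𝓘(ℝ, E) x₀).symm y)) ∘L frame x₀ y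

/-- The components of a field of bilinear forms in the preferred chart at `x₀`. -/
def BilinField.coord (h : BilinField 𝓘(ℝ, E) M) (x₀ : M) (y : E) : E →L[ℝ] E →L[ℝ] ℝ :=
  (show E →L[ℝ] E →L[ℝ] ℝ from h ((extChartAt 𝓘(ℝ, E) x₀).symm y)).bilinearComp
    (frame x₀ y) (frame x₀ y)

/-- The vector field with given components in the preferred chart at `x₀`. -/
def fieldOfCoord (x₀ : M) (V : E → E) : VField 𝓘(ℝ, E) M := fun p ↦
  frame x₀ (extChartAt 𝓘(ℝ, E) x₀ p) (V (extChartAt 𝓘(ℝ, E) x₀ p))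

theorem target_mem_nhds (x₀ : M) :
    (extChartAt 𝓘(ℝ, E) x₀).target ∈ 𝓝 (extChartAt 𝓘(ℝ, E) x₀ x₀) :=
  extChartAt_target_mem_nhds x₀

theorem mdifferentiableAt_iff_comp_symm {F : Type*} [NormedAddCommGroup F] [NormedSpace ℝ F]
    (f : M → F) (x : M) : MDifferentiableAt 𝓘(ℝ, E) 𝓘(ℝ, F) f x ↔
      DifferentiableAt ℝ (fun y ↦ f ((extChartAt 𝓘(ℝ, E) x).symm y))
        (extChartAt 𝓘(ℝ, E) x x) := by
  rw [mdifferentiableAt_iff]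
  have h1 : DifferentiableWithinAt ℝ (writtenInExtChartAt 𝓘(ℝ, E) 𝓘(ℝ, F) x f)
      (Set.range 𝓘(ℝ, E)) (extChartAt 𝓘(ℝ, E) x x) ↔
      DifferentiableAt ℝ (fun y ↦ f ((extChartAt 𝓘(ℝ, E) x).symm y))
        (extChartAt 𝓘(ℝ, E) x x) := by
    simp only [modelWithCornersSelf_coe, Set.range_id, differentiableWithinAt_univ]
    rfl
  rw [h1]
  refine ⟨fun h ↦ h.2, fun h ↦ ⟨?_, h⟩⟩
  -- Continuity is part of differentiability on a manifold. It comes for free: near `x`, `f` is its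
  -- coordinate expression composed with the chart.
  have h2 := ContinuousAt.comp (f := extChartAt 𝓘(ℝ, E) x) (x := x) h.continuousAt
    (continuousAt_extChartAt x)
  refine h2.congr ?_
  filter_upwards [extChartAt_source_mem_nhds (I := 𝓘(ℝ, E)) x] with y hy
  exact congrArg f ((extChartAt 𝓘(ℝ, E) x).left_inv hy)

theorem mvfderiv_eq_fderiv {F : Type*} [NormedAddCommGroup F] [NormedSpace ℝ F]
    {f : M → F} {x : M} (hf : MDifferentiableAt 𝓘(ℝ, E) 𝓘(ℝ, F) f x) (u : E) :
    mvfderiv 𝓘(ℝ, E) f x u =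
      fderiv ℝ (fun y ↦ f ((extChartAt 𝓘(ℝ, E) x).symm y)) (extChartAt 𝓘(ℝ, E) x x) u := by
  unfold mvfderiv
  rw [hf.mfderiv]
  simp only [modelWithCornersSelf_coe, Set.range_id, fderivWithin_univ]
  rfl

theorem chart_source_eventually (x₀ : M) :
    ∀ᶠ p in 𝓝 x₀, p ∈ (extChartAt 𝓘(ℝ, E) x₀).source :=
  extChartAt_source_mem_nhds x₀

theorem chart_symm_self (x₀ : M) :
    (extChartAt 𝓘(ℝ, E) x₀).symm (extChartAt 𝓘(ℝ, E) x₀ x₀) = x₀ := by simp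

theorem DForm.inChart_apply {k : ℕ} (α : DForm 𝓘(ℝ, E) M k) (x₀ : M) (y : E) (v : Fin k → E) :
    α.inChart x₀ y v = (show E [⋀^Fin k]→L[ℝ] ℝ from α ((extChartAt 𝓘(ℝ, E) x₀).symm y))
      (fun i ↦ frame x₀ y (v i)) := rfl

section C1

variable [IsManifold 𝓘(ℝ, E) 1 M]

theorem frame_isInvertible {x₀ : M} {y : E} (hy : y ∈ (extChartAt 𝓘(ℝ, E) x₀).target) :
    (frame x₀ y).IsInvertible :=
  isInvertible_mfderivWithin_extChartAt_symm hy

/-- The tangent space at `x₀` is the model space, read through the preferred chart at `x₀`. Hence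
components at the centre of that chart are the values themselves. -/
theorem frame_self (x₀ : M) :
    frame x₀ (extChartAt 𝓘(ℝ, E) x₀ x₀) = ContinuousLinearMap.id ℝ E :=
  mfderivWithin_range_extChartAt_symm

theorem frame_inverse_self_apply {x₀ : M} {y : E} (hy : y ∈ (extChartAt 𝓘(ℝ, E) x₀).target)
    (u : E) : (frame x₀ y).inverse (frame x₀ y u) = u := by
  obtain ⟨e, he⟩ := frame_isInvertible hy
  rw [← he]; simp

theorem frame_self_inverse_apply {x₀ : M} {y : E} (hy : y ∈ (extChartAt 𝓘(ℝ, E) x₀).target)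
    (u : E) : frame x₀ y ((frame x₀ y).inverse u) = u := by
  obtain ⟨e, he⟩ := frame_isInvertible hy
  rw [← he]; simp

theorem frame_coord {x₀ : M} {y : E} (hy : y ∈ (extChartAt 𝓘(ℝ, E) x₀).target)
    (X : VField 𝓘(ℝ, E) M) :
    frame x₀ y (X.coord x₀ y) = X ((extChartAt 𝓘(ℝ, E) x₀).symm y) :=
  frame_self_inverse_apply hy _

theorem VField.coord_self (X : VField 𝓘(ℝ, E) M) (x₀ : M) :
    X.coord x₀ (extChartAt 𝓘(ℝ, E) x₀ x₀) = X x₀ := by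
  unfold VField.coord
  rw [frame_self, ContinuousLinearMap.inverse_id]
  -- The type of `X x` depends on `x`. Reading every fibre as `E` gives a non-dependent function, to
  -- which the equality of points applies.
  exact congrArg (fun x ↦ (show E from X x)) (chart_symm_self x₀)

theorem EndField.coord_self (A : EndField 𝓘(ℝ, E) M) (x₀ : M) :
    A.coord x₀ (extChartAt 𝓘(ℝ, E) x₀ x₀) = A x₀ := by
  unfold EndField.coord
  rw [frame_self, ContinuousLinearMap.inverse_id]
  exact congrArg (fun x ↦ (show E →L[ℝ] E from A x)) (chart_symm_self x₀)

theorem Covector.coord_self (α : Covector 𝓘(ℝ, E) M) (x₀ : M) :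
    α.coord x₀ (extChartAt 𝓘(ℝ, E) x₀ x₀) = α x₀ := by
  unfold Covector.coord
  rw [frame_self]
  exact congrArg (fun x ↦ (show E →L[ℝ] ℝ from α x)) (chart_symm_self x₀)

theorem BilinField.coord_self (h : BilinField 𝓘(ℝ, E) M) (x₀ : M) :
    h.coord x₀ (extChartAt 𝓘(ℝ, E) x₀ x₀) = h x₀ := by
  unfold BilinField.coord
  rw [frame_self]
  exact congrArg (fun x ↦ (show E →L[ℝ] E →L[ℝ] ℝ from h x)) (chart_symm_self x₀)

theorem DForm.inChart_self {k : ℕ} (α : DForm 𝓘(ℝ, E) M k) (x₀ : M) :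
    α.inChart x₀ (extChartAt 𝓘(ℝ, E) x₀ x₀) = α x₀ := by
  unfold DForm.inChart
  change ContinuousAlternatingMap.compContinuousLinearMap
    (show E [⋀^Fin k]→L[ℝ] ℝ from _) (frame x₀ _) = _
  rw [frame_self]
  exact congrArg (fun x ↦ (show E [⋀^Fin k]→L[ℝ] ℝ from α x)) (chart_symm_self x₀)

theorem coord_end_apply {x₀ : M} {y : E} (hy : y ∈ (extChartAt 𝓘(ℝ, E) x₀).target)
    (A : EndField 𝓘(ℝ, E) M) (X : VField 𝓘(ℝ, E) M) :
    VField.coord (fun p ↦ A p (X p)) x₀ y = A.coord x₀ y (X.coord x₀ y) := by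
  change _ = (frame x₀ y).inverse (A _ (frame x₀ y (X.coord x₀ y)))
  rw [frame_coord hy]
  rfl

theorem coord_fieldOfCoord {x₀ : M} {y : E} (hy : y ∈ (extChartAt 𝓘(ℝ, E) x₀).target)
    (V : E → E) : (fieldOfCoord x₀ V).coord x₀ y = V y := by
  unfold VField.coord fieldOfCoord
  rw [(extChartAt 𝓘(ℝ, E) x₀).right_inv hy, frame_inverse_self_apply hy]

theorem fieldOfCoord_self (x₀ : M) (V : E → E) :
    fieldOfCoord x₀ V x₀ = V (extChartAt 𝓘(ℝ, E) x₀ x₀) := by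
  unfold fieldOfCoord
  rw [frame_self]; rfl

/-- Differentiability of a section is defined by the trivialization of the tangent bundle. Over the
chart domain this trivialization is the differential of the chart, which is the inverse of `frame`.
-/
theorem diffAt_iff_coord (X : VField 𝓘(ℝ, E) M) (x : M) :
    VField.DiffAt X x ↔ DifferentiableAt ℝ (X.coord x) (extChartAt 𝓘(ℝ, E) x x) := by
  unfold VField.DiffAt
  rw [mdifferentiableAt_section, mdifferentiableAt_iff_comp_symm]
  have key : (fun y ↦ (trivializationAt E (TangentSpace 𝓘(ℝ, E)) x
      (T% X ((extChartAt 𝓘(ℝ, E) x).symm y))).2) =ᶠ[𝓝 (extChartAt 𝓘(ℝ, E) x x)] X.coord x := by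
    filter_upwards [target_mem_nhds x] with y hy
    have h1 : (extChartAt 𝓘(ℝ, E) x).symm y ∈ (chartAt E x).source := by
      simpa using (extChartAt 𝓘(ℝ, E) x).map_target hy
    have h2 := TangentBundle.continuousLinearMapAt_trivializationAt (I := 𝓘(ℝ, E)) (x₀ := x) h1
    have h3 : (trivializationAt E (TangentSpace 𝓘(ℝ, E)) x
      (T% X ((extChartAt 𝓘(ℝ, E) x).symm y))).2 =
      (trivializationAt E (TangentSpace 𝓘(ℝ, E)) x).continuousLinearMapAt ℝ
        ((extChartAt 𝓘(ℝ, E) x).symm y) (X ((extChartAt 𝓘(ℝ, E) x).symm y)) := by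
      rw [Trivialization.continuousLinearMapAt_apply, Trivialization.coe_linearMapAt_of_mem]
      simpa using h1
    rw [h3, h2]
    have h4 := mfderiv_extChartAt_comp_mfderivWithin_extChartAt_symm (I := 𝓘(ℝ, E)) hy
    have h5 := congrArg (fun f ↦ f (X.coord x y)) h4
    change mfderiv 𝓘(ℝ, E) 𝓘(ℝ, E) (extChartAt 𝓘(ℝ, E) x) ((extChartAt 𝓘(ℝ, E) x).symm y)
      (frame x y (X.coord x y)) = X.coord x y at h5
    rw [frame_coord hy] at h5
    exact h5
  exact Filter.EventuallyEq.differentiableAt_iff key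

theorem diffAt_fieldOfCoord {x₀ : M} {V : E → E}
    (hV : DifferentiableAt ℝ V (extChartAt 𝓘(ℝ, E) x₀ x₀)) :
    VField.DiffAt (fieldOfCoord x₀ V) x₀ := by
  rw [diffAt_iff_coord]
  refine hV.congr_of_eventuallyEq ?_
  filter_upwards [target_mem_nhds x₀] with y hy
  exact coord_fieldOfCoord hy V

/-- The bracket on a manifold is the bracket of the components, carried back by the inverse of the
differential of the chart, and this is the identity at the centre. -/
theorem mlieBracket_eq_coord (X Y : VField 𝓘(ℝ, E) M) (x : M) :
    VectorField.mlieBracket 𝓘(ℝ, E) X Y x =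
      fderiv ℝ (Y.coord x) (extChartAt 𝓘(ℝ, E) x x) (X x)
        - fderiv ℝ (X.coord x) (extChartAt 𝓘(ℝ, E) x x) (Y x) := by
  rw [← VectorField.mlieBracketWithin_univ, VectorField.mlieBracketWithin_apply,
    mfderiv_extChartAt_self]
  change (ContinuousLinearMap.id ℝ E).inverse (VectorField.lieBracketWithin ℝ (X.coord x)
    (Y.coord x) _ _) = _
  rw [ContinuousLinearMap.inverse_id]
  have h : (extChartAt 𝓘(ℝ, E) x).symm ⁻¹' Set.univ ∩ Set.range 𝓘(ℝ, E) = Set.univ := by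
    simp
  rw [h]
  change VectorField.lieBracketWithin ℝ (X.coord x) (Y.coord x) Set.univ _ = _
  rw [VectorField.lieBracketWithin_univ, VectorField.lieBracket, X.coord_self, Y.coord_self]

/-- The exterior derivative at the centre of the chart. -/
theorem DForm.d_eq_extDeriv {k : ℕ} (α : DForm 𝓘(ℝ, E) M k) (x : M) :
    α.d x = extDeriv (α.inChart x) (extChartAt 𝓘(ℝ, E) x x) := by
  unfold DForm.d
  rw [mfderiv_extChartAt_self]
  simp only [modelWithCornersSelf_coe, Set.range_id, extDerivWithin_univ]
  rfl

end C1

/-! ### Maps in charts and pullback of forms -/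

section Maps

variable {E' : Type*} [NormedAddCommGroup E'] [NormedSpace ℝ E']
  {M' : Type*} [TopologicalSpace M'] [ChartedSpace E' M']

/-- The differential of a map, as a map between the model spaces. -/
def tangentMapAt (f : M' → M) (p : M') : E' →L[ℝ] E := mfderiv 𝓘(ℝ, E') 𝓘(ℝ, E) f p

/-- The expression of a map in the preferred charts at `p₀` and `x₀`. -/
def mapCoord (f : M' → M) (p₀ : M') (x₀ : M) (y : E') : E :=
  extChartAt 𝓘(ℝ, E) x₀ (f ((extChartAt 𝓘(ℝ, E') p₀).symm y))

theorem mapCoord_self (f : M' → M) (p₀ : M') :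
    mapCoord f p₀ (f p₀) (extChartAt 𝓘(ℝ, E') p₀ p₀) = extChartAt 𝓘(ℝ, E) (f p₀) (f p₀) := by
  unfold mapCoord
  rw [chart_symm_self]

theorem eventually_mapCoord_of_mem {f : M' → M} {p₀ : M'} {x₀ : M} {y : E'}
    (hy : y ∈ (extChartAt 𝓘(ℝ, E') p₀).target)
    (hf : ContinuousAt f ((extChartAt 𝓘(ℝ, E') p₀).symm y))
    (hx : f ((extChartAt 𝓘(ℝ, E') p₀).symm y) ∈ (extChartAt 𝓘(ℝ, E) x₀).source) :
    ∀ᶠ z in 𝓝 y, z ∈ (extChartAt 𝓘(ℝ, E') p₀).target ∧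
      f ((extChartAt 𝓘(ℝ, E') p₀).symm z) ∈ (extChartAt 𝓘(ℝ, E) x₀).source := by
  have h0 : ∀ᶠ z in 𝓝 y, z ∈ (extChartAt 𝓘(ℝ, E') p₀).target :=
    (isOpen_extChartAt_target p₀).mem_nhds hy
  refine h0.and ?_
  have h2 : ContinuousAt (fun y ↦ f ((extChartAt 𝓘(ℝ, E') p₀).symm y)) y :=
    ContinuousAt.comp hf (continuousAt_extChartAt_symm'' hy)
  exact h2 ((isOpen_extChartAt_source x₀).mem_nhds hx)

theorem center_mem (f : M' → M) (p₀ : M') :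
    extChartAt 𝓘(ℝ, E') p₀ p₀ ∈ (extChartAt 𝓘(ℝ, E') p₀).target ∧
      f ((extChartAt 𝓘(ℝ, E') p₀).symm (extChartAt 𝓘(ℝ, E') p₀ p₀)) ∈
        (extChartAt 𝓘(ℝ, E) (f p₀)).source := by
  rw [chart_symm_self]
  exact ⟨mem_extChartAt_target p₀, mem_extChartAt_source (f p₀)⟩

/-- Points near the centre of the chart have coordinates that can be used to express `f`. -/
theorem eventually_mapCoord {f : M' → M} {p₀ : M'} (hf : ContinuousAt f p₀) :
    ∀ᶠ y in 𝓝 (extChartAt 𝓘(ℝ, E') p₀ p₀), y ∈ (extChartAt 𝓘(ℝ, E') p₀).target ∧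
      f ((extChartAt 𝓘(ℝ, E') p₀).symm y) ∈ (extChartAt 𝓘(ℝ, E) (f p₀)).source :=
  eventually_mapCoord_of_mem (center_mem (E := E) (E' := E') f p₀).1 (by rwa [chart_symm_self]) (center_mem (E := E) (E' := E') f p₀).2

/-- The pullback of a form. -/
def DForm.pullback {k : ℕ} (f : M' → M) (α : DForm 𝓘(ℝ, E) M k) : DForm 𝓘(ℝ, E') M' k :=
  fun p ↦ (α (f p)).compContinuousLinearMap (mfderiv 𝓘(ℝ, E') 𝓘(ℝ, E) f p)

theorem symm_mapCoord {f : M' → M} {p₀ : M'} {x₀ : M} {y : E'}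
    (hx : f ((extChartAt 𝓘(ℝ, E') p₀).symm y) ∈ (extChartAt 𝓘(ℝ, E) x₀).source) :
    (extChartAt 𝓘(ℝ, E) x₀).symm (mapCoord f p₀ x₀ y) = f ((extChartAt 𝓘(ℝ, E') p₀).symm y) :=
  (extChartAt 𝓘(ℝ, E) x₀).left_inv hx

variable [IsManifold 𝓘(ℝ, E) ∞ M] [IsManifold 𝓘(ℝ, E') ∞ M']

theorem contDiffAt_mapCoord {f : M' → M} {p₀ : M'} {x₀ : M} {y : E'}
    (hy : y ∈ (extChartAt 𝓘(ℝ, E') p₀).target)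
    (hf : ContMDiffAt 𝓘(ℝ, E') 𝓘(ℝ, E) ∞ f ((extChartAt 𝓘(ℝ, E') p₀).symm y))
    (hx : f ((extChartAt 𝓘(ℝ, E') p₀).symm y) ∈ (extChartAt 𝓘(ℝ, E) x₀).source) :
    ContDiffAt ℝ ∞ (mapCoord (E := E) f p₀ x₀) y := by
  rw [← contMDiffAt_iff_contDiffAt]
  have h1 : ContMDiffAt 𝓘(ℝ, E') 𝓘(ℝ, E') ∞ (extChartAt 𝓘(ℝ, E') p₀).symm y :=
    (contMDiffOn_extChartAt_symm p₀).contMDiffAt ((isOpen_extChartAt_target p₀).mem_nhds hy)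
  have h2 : ContMDiffAt 𝓘(ℝ, E) 𝓘(ℝ, E) ∞ (extChartAt 𝓘(ℝ, E) x₀)
      (f ((extChartAt 𝓘(ℝ, E') p₀).symm y)) :=
    contMDiffAt_extChartAt' (by simpa using hx)
  exact h2.comp y (hf.comp y h1)

/-- The chain rule. It is needed on a whole neighbourhood and not only at the centre, because the
identities it yields are differentiated later. -/
theorem frame_mapCoord {f : M' → M} {p₀ : M'} {x₀ : M} {y : E'}
    (hy : y ∈ (extChartAt 𝓘(ℝ, E') p₀).target)
    (hf : MDifferentiableAt 𝓘(ℝ, E') 𝓘(ℝ, E) f ((extChartAt 𝓘(ℝ, E') p₀).symm y))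
    (hx : f ((extChartAt 𝓘(ℝ, E') p₀).symm y) ∈ (extChartAt 𝓘(ℝ, E) x₀).source) (v : E') :
    frame x₀ (mapCoord (E := E) f p₀ x₀ y) (fderiv ℝ (mapCoord (E := E) f p₀ x₀) y v) =
      tangentMapAt f ((extChartAt 𝓘(ℝ, E') p₀).symm y) (frame p₀ y v) := by
  have h1 : MDifferentiableAt 𝓘(ℝ, E') 𝓘(ℝ, E') (extChartAt 𝓘(ℝ, E') p₀).symm y := by
    have := (contMDiffOn_extChartAt_symm (I := 𝓘(ℝ, E')) (n := ∞) p₀).contMDiffAt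
      ((isOpen_extChartAt_target p₀).mem_nhds hy)
    exact this.mdifferentiableAt (by simp)
  have h2 : MDifferentiableAt 𝓘(ℝ, E) 𝓘(ℝ, E) (extChartAt 𝓘(ℝ, E) x₀)
      (f ((extChartAt 𝓘(ℝ, E') p₀).symm y)) :=
    mdifferentiableAt_extChartAt (by simpa using hx)
  have h3 : fderiv ℝ (mapCoord (E := E) f p₀ x₀) y =
      (show E →L[ℝ] E from mfderiv 𝓘(ℝ, E) 𝓘(ℝ, E) (extChartAt 𝓘(ℝ, E) x₀)
        (f ((extChartAt 𝓘(ℝ, E') p₀).symm y))) ∘L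
        tangentMapAt f ((extChartAt 𝓘(ℝ, E') p₀).symm y) ∘L frame p₀ y := by
    rw [← mfderiv_eq_fderiv]
    have h4 : mapCoord f p₀ x₀ =
      extChartAt 𝓘(ℝ, E) x₀ ∘ (f ∘ (extChartAt 𝓘(ℝ, E') p₀).symm) := rfl
    rw [h4, mfderiv_comp y h2 (hf.comp y h1), mfderiv_comp y hf h1]
    unfold frame
    simp only [modelWithCornersSelf_coe, Set.range_id, mfderivWithin_univ]
    rfl
  rw [h3]
  have h5 := mfderivWithin_extChartAt_symm_comp_mfderiv_extChartAt' (I := 𝓘(ℝ, E)) hx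
  exact congrArg (fun g ↦ g (mfderiv 𝓘(ℝ, E') 𝓘(ℝ, E) f
    ((extChartAt 𝓘(ℝ, E') p₀).symm y) (frame p₀ y v))) h5

theorem fderiv_mapCoord_self {f : M' → M} {p₀ : M'}
    (hf : MDifferentiableAt 𝓘(ℝ, E') 𝓘(ℝ, E) f p₀) :
    fderiv ℝ (mapCoord (E := E) f p₀ (f p₀)) (extChartAt 𝓘(ℝ, E') p₀ p₀) = tangentMapAt f p₀ := by
  ext v
  have h := frame_mapCoord (center_mem (E := E) (E' := E') f p₀).1 (by rwa [chart_symm_self]) (center_mem (E := E) (E' := E') f p₀).2 v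
  rw [mapCoord_self, frame_self, frame_self, chart_symm_self] at h
  exact h

theorem DForm.inChart_pullback {k : ℕ} {f : M' → M} (α : DForm 𝓘(ℝ, E) M k) {p₀ : M'} {x₀ : M}
    {y : E'} (hy : y ∈ (extChartAt 𝓘(ℝ, E') p₀).target)
    (hf : MDifferentiableAt 𝓘(ℝ, E') 𝓘(ℝ, E) f ((extChartAt 𝓘(ℝ, E') p₀).symm y))
    (hx : f ((extChartAt 𝓘(ℝ, E') p₀).symm y) ∈ (extChartAt 𝓘(ℝ, E) x₀).source) :
    (α.pullback f).inChart p₀ y = (α.inChart x₀ (mapCoord (E := E) f p₀ x₀ y)).compContinuousLinearMap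
      (fderiv ℝ (mapCoord (E := E) f p₀ x₀) y) := by
  ext v
  rw [ContinuousAlternatingMap.compContinuousLinearMap_apply, DForm.inChart_apply,
    DForm.inChart_apply]
  simp only [Function.comp_apply]
  simp_rw [frame_mapCoord hy hf hx]
  exact congrArg (fun x ↦ (show E [⋀^Fin k]→L[ℝ] ℝ from α x)
    (fun i ↦ tangentMapAt f ((extChartAt 𝓘(ℝ, E') p₀).symm y) (frame p₀ y (v i))))
    (symm_mapCoord hx).symm

theorem DForm.eventually_inChart_pullback {k : ℕ} {f : M' → M}
    (hf : ContMDiff 𝓘(ℝ, E') 𝓘(ℝ, E) ∞ f) (α : DForm 𝓘(ℝ, E) M k) (p₀ : M') :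
    (α.pullback f).inChart p₀ =ᶠ[𝓝 (extChartAt 𝓘(ℝ, E') p₀ p₀)]
      fun y ↦ (α.inChart (f p₀) (mapCoord (E := E) f p₀ (f p₀) y)).compContinuousLinearMap
        (fderiv ℝ (mapCoord (E := E) f p₀ (f p₀)) y) := by
  filter_upwards [eventually_mapCoord (E := E) hf.continuous.continuousAt] with y hy
  exact α.inChart_pullback hy.1 (hf.mdifferentiableAt (by simp)) hy.2

/-- In charts this is naturality of `extDeriv`, which needs `f` of class `C²`. Differentiability of
`α` at the single point `f p₀` is enough. -/
theorem DForm.d_pullback {k : ℕ} {f : M' → M}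
    (hf : ContMDiff 𝓘(ℝ, E') 𝓘(ℝ, E) ∞ f) (α : DForm 𝓘(ℝ, E) M k) (p₀ : M')
    (hα : DifferentiableAt ℝ (α.inChart (f p₀)) (extChartAt 𝓘(ℝ, E) (f p₀) (f p₀))) :
    (DForm.pullback (E' := E') f α).d p₀ = DForm.pullback f α.d p₀ := by
  rw [DForm.d_eq_extDeriv, (α.eventually_inChart_pullback hf p₀).extDeriv_eq,
    extDeriv_pullback (r := ∞) (by rwa [mapCoord_self])
      (contDiffAt_mapCoord (center_mem (E := E) (E' := E') f p₀).1 hf.contMDiffAt (center_mem (E := E) (E' := E') f p₀).2)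
      (by simpa using two_le_infty),
    mapCoord_self, ← DForm.d_eq_extDeriv, fderiv_mapCoord_self (hf.mdifferentiableAt (by simp))]
  rfl

theorem DForm.differentiableAt_inChart_pullback {k : ℕ} {f : M' → M}
    (hf : ContMDiff 𝓘(ℝ, E') 𝓘(ℝ, E) ∞ f) (α : DForm 𝓘(ℝ, E) M k) (p₀ : M')
    (hα : DifferentiableAt ℝ (α.inChart (f p₀)) (extChartAt 𝓘(ℝ, E) (f p₀) (f p₀))) :
    DifferentiableAt ℝ ((α.pullback f).inChart p₀) (extChartAt 𝓘(ℝ, E') p₀ p₀) := by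
  refine DifferentiableAt.congr_of_eventuallyEq ?_ (α.eventually_inChart_pullback hf p₀)
  have h1 : ContDiffAt ℝ ∞ (mapCoord (E := E) f p₀ (f p₀)) (extChartAt 𝓘(ℝ, E') p₀ p₀) :=
    contDiffAt_mapCoord (center_mem (E := E) (E' := E') f p₀).1 hf.contMDiffAt (center_mem (E := E) (E' := E') f p₀).2
  have h2 : DifferentiableAt ℝ (fderiv ℝ (mapCoord (E := E) f p₀ (f p₀)))
      (extChartAt 𝓘(ℝ, E') p₀ p₀) :=
    (h1.fderiv_right (m := 1) (by norm_cast)).differentiableAt (by simp)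
  have h3 : DifferentiableAt ℝ (fun y ↦ α.inChart (f p₀) (mapCoord (E := E) f p₀ (f p₀) y))
      (extChartAt 𝓘(ℝ, E') p₀ p₀) :=
    DifferentiableAt.comp (g := α.inChart (f p₀)) _ (by rwa [mapCoord_self]) (h1.differentiableAt (by simp))
  exact h3.continuousAlternatingMapCompContinuousLinearMap h2

end Maps

/-! ### The exterior derivative away from the centre of the chart -/

section Exterior

variable [IsManifold 𝓘(ℝ, E) ∞ M]

theorem DForm.IsSmooth.contDiffAt {k : ℕ} {α : DForm 𝓘(ℝ, E) M k} (hα : α.IsSmooth) {x₀ : M}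
    {y : E} (hy : y ∈ (extChartAt 𝓘(ℝ, E) x₀).target) : ContDiffAt ℝ ∞ (α.inChart x₀) y :=
  (hα x₀).contDiffAt ((isOpen_extChartAt_target x₀).mem_nhds hy)

theorem DForm.IsSmooth.differentiableAt {k : ℕ} {α : DForm 𝓘(ℝ, E) M k} (hα : α.IsSmooth)
    (x : M) : DifferentiableAt ℝ (α.inChart x) (extChartAt 𝓘(ℝ, E) x x) :=
  (hα.contDiffAt (mem_extChartAt_target x)).differentiableAt (by simp)

theorem DForm.pullback_id {k : ℕ} (α : DForm 𝓘(ℝ, E) M k) :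
    DForm.pullback (fun x : M ↦ x) α = α := by
  funext x
  unfold DForm.pullback
  rw [show (fun x : M ↦ x) = id from rfl, mfderiv_id]
  rfl

/-- At each point `α.d` uses the preferred chart of that very point, so independence of the chart
has to be proved before `d` can be iterated. The change of chart is treated as the coordinate
expression of the identity map, along which `α` is its own pullback. -/
theorem DForm.inChart_d {k : ℕ} {α : DForm 𝓘(ℝ, E) M k} (hα : α.IsSmooth) {x₀ : M} {y : E}
    (hy : y ∈ (extChartAt 𝓘(ℝ, E) x₀).target) :
    α.d.inChart x₀ y = extDeriv (α.inChart x₀) y := by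
  set p := (extChartAt 𝓘(ℝ, E) x₀).symm y with hp
  have hmem : (fun x : M ↦ x) ((extChartAt 𝓘(ℝ, E) x₀).symm y) ∈
    (extChartAt 𝓘(ℝ, E) p).source := mem_extChartAt_source p
  have hsm : ContMDiff 𝓘(ℝ, E) 𝓘(ℝ, E) ∞ (fun x : M ↦ x) := contMDiff_id
  have hmd (q : M) : MDifferentiableAt 𝓘(ℝ, E) 𝓘(ℝ, E) (fun x : M ↦ x) q :=
    hsm.mdifferentiableAt (by simp)
  have hev : α.inChart x₀ =ᶠ[𝓝 y] fun z ↦ (α.inChart p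
      (mapCoord (fun x : M ↦ x) x₀ p z)).compContinuousLinearMap
        (fderiv ℝ (mapCoord (fun x : M ↦ x) x₀ p) z) := by
    filter_upwards [eventually_mapCoord_of_mem hy continuousAt_id hmem] with z hz
    have := α.inChart_pullback hz.1 (hmd _) hz.2
    rwa [DForm.pullback_id] at this
  have hcenter : mapCoord (fun x : M ↦ x) x₀ p y = extChartAt 𝓘(ℝ, E) p p := rfl
  have hD : fderiv ℝ (mapCoord (fun x : M ↦ x) x₀ p) y = frame x₀ y := by
    ext v
    have h := frame_mapCoord hy (hmd _) hmem v
    rw [hcenter, frame_self] at h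
    refine h.trans ?_
    unfold tangentMapAt
    rw [show (fun x : M ↦ x) = id from rfl, mfderiv_id]
    rfl
  rw [hev.extDeriv_eq, extDeriv_pullback (r := ∞) (by rw [hcenter]; exact hα.differentiableAt p)
    (contDiffAt_mapCoord hy hsm.contMDiffAt hmem) (by simpa using two_le_infty), hcenter, hD,
    ← DForm.d_eq_extDeriv]
  rfl

theorem DForm.eventually_inChart_d {k : ℕ} {α : DForm 𝓘(ℝ, E) M k} (hα : α.IsSmooth) (x : M) :
    α.d.inChart x =ᶠ[𝓝 (extChartAt 𝓘(ℝ, E) x x)] extDeriv (α.inChart x) := by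
  filter_upwards [target_mem_nhds x] with y hy
  exact DForm.inChart_d hα hy

theorem DForm.d_d {k : ℕ} {α : DForm 𝓘(ℝ, E) M k} (hα : α.IsSmooth) (x : M) : α.d.d x = 0 := by
  rw [DForm.d_eq_extDeriv, (DForm.eventually_inChart_d hα x).extDeriv_eq]
  exact extDeriv_extDeriv_apply (hα.contDiffAt (mem_extChartAt_target x)) (by simpa using two_le_infty)

theorem DForm.IsSmooth.differentiableAt_d {k : ℕ} {α : DForm 𝓘(ℝ, E) M k} (hα : α.IsSmooth)
    (x : M) : DifferentiableAt ℝ (α.d.inChart x) (extChartAt 𝓘(ℝ, E) x x) := by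
  refine DifferentiableAt.congr_of_eventuallyEq ?_ (DForm.eventually_inChart_d hα x)
  have h := (hα.contDiffAt (mem_extChartAt_target x)).fderiv_right (m := 1) (by norm_cast)
  exact (ContinuousAlternatingMap.alternatizeUncurryFinCLM ℝ E ℝ).differentiableAt.comp _
    (h.differentiableAt (by simp))

end Exterior

end Charts

/-! ### Wedge products in degrees 2 + 1 and 2 + 2 -/

section Wedge


theorem alt_two_swap {V : Type*} [AddCommGroup V] [Module ℝ V] [TopologicalSpace V]
    (A : V [⋀^Fin 2]→L[ℝ] ℝ) (a b : V) : A ![a, b] = -A ![b, a] := by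
  have h := A.map_swap ![b, a] (i := 0) (j := 1) (by decide)
  have h2 : (![b, a] ∘ ⇑(Equiv.swap (0 : Fin 2) 1)) = ![a, b] := by
    ext i; fin_cases i <;> rfl
  rw [h2] at h
  exact h

-- A permutation is determined by the image of `0` and a permutation of the remaining indices.
-- Iterating this lists the group explicitly, so that signs and values can be evaluated by
-- computation.
open Equiv Equiv.Perm in
theorem sum_perm_three (f : Perm (Fin 3) → ℝ) : ∑ σ, f σ =
    ∑ i : Fin 3, ∑ j : Fin 2, f (decomposeFin.symm (i, decomposeFin.symm (j, 1))) := by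
  rw [Finset.univ_perm_fin_succ, Finset.sum_map, ← Finset.univ_product_univ, Finset.sum_product]
  refine Finset.sum_congr rfl fun i _ ↦ ?_
  rw [Finset.univ_perm_fin_succ, Finset.sum_map, ← Finset.univ_product_univ, Finset.sum_product]
  simp

open Equiv Equiv.Perm in
theorem sum_perm_four (f : Perm (Fin 4) → ℝ) : ∑ σ, f σ =
    ∑ i : Fin 4, ∑ j : Fin 3, ∑ k : Fin 2,
      f (decomposeFin.symm (i, decomposeFin.symm (j, decomposeFin.symm (k, 1)))) := by
  rw [Finset.univ_perm_fin_succ, Finset.sum_map, ← Finset.univ_product_univ, Finset.sum_product]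
  refine Finset.sum_congr rfl fun i _ ↦ ?_
  exact sum_perm_three (fun σ ↦ f (decomposeFin.symm (i, σ)))

open Equiv Equiv.Perm in
theorem sum_sign_perm_three (F : ℤ → Fin 3 → Fin 3 → Fin 3 → ℝ) :
    ∑ σ : Perm (Fin 3), F (sign σ) (σ 0) (σ 1) (σ 2) =
      (F 1 0 1 2 + F (-1) 0 2 1) + (F (-1) 1 0 2 + F 1 1 2 0) + (F (-1) 2 1 0 + F 1 2 0 1) := by
  rw [sum_perm_three]
  simp only [Fin.sum_univ_three, Fin.sum_univ_two]
  rfl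

open Equiv Equiv.Perm in
theorem sum_sign_perm_four (F : ℤ → Fin 4 → Fin 4 → Fin 4 → Fin 4 → ℝ) :
    ∑ σ : Perm (Fin 4), F (sign σ) (σ 0) (σ 1) (σ 2) (σ 3) =
      ((F 1 0 1 2 3 + F (-1) 0 1 3 2) + (F (-1) 0 2 1 3 + F 1 0 2 3 1) + (F (-1) 0 3 2 1 + F 1 0 3 1 2)) +
      ((F (-1) 1 0 2 3 + F 1 1 0 3 2) + (F 1 1 2 0 3 + F (-1) 1 2 3 0) + (F 1 1 3 2 0 + F (-1) 1 3 0 2)) +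
      ((F (-1) 2 1 0 3 + F 1 2 1 3 0) + (F 1 2 0 1 3 + F (-1) 2 0 3 1) + (F 1 2 3 0 1 + F (-1) 2 3 1 0)) +
      ((F (-1) 3 1 2 0 + F 1 3 1 0 2) + (F 1 3 2 1 0 + F (-1) 3 2 0 1) + (F 1 3 0 2 1 + F (-1) 3 0 1 2)) := by
  rw [sum_perm_four]
  simp only [Fin.sum_univ_four, Fin.sum_univ_three, Fin.sum_univ_two]
  rfl

/-- The factor `1/2` cancels the two orderings inside the pair fed to `A`, and the three shuffles
remain. In degree 2 + 2 the factor `1/4` leaves six shuffles out of 24 permutations. -/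
theorem wedge_two_one {V : Type*} [AddCommGroup V] [Module ℝ V] [TopologicalSpace V]
    (A : V [⋀^Fin 2]→L[ℝ] ℝ) (b : V [⋀^Fin 1]→L[ℝ] ℝ) (v : Fin (2 + 1) → V) :
    wedge A b v = A ![v 0, v 1] * b ![v 2] - A ![v 0, v 2] * b ![v 1]
      + A ![v 1, v 2] * b ![v 0] := by
  unfold wedge
  have hA (s : Fin 3 → Fin 3) : (A fun i ↦ v (s (Fin.castAdd 1 i))) = A ![v (s 0), v (s 1)] := by
    congr 1; ext i; fin_cases i <;> rfl
  have hB (s : Fin 3 → Fin 3) : (b fun i ↦ v (s (Fin.natAdd 2 i))) = b ![v (s 2)] := by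
    congr 1; ext i; fin_cases i; rfl
  simp only [hA, hB]
  rw [sum_sign_perm_three (fun s i j k ↦ (s : ℝ) * (A ![v i, v j] * b ![v k]))]
  simp
  rw [alt_two_swap A (v 1) (v 0), alt_two_swap A (v 2) (v 1), alt_two_swap A (v 2) (v 0)]
  ring

theorem wedge_two_two {V : Type*} [AddCommGroup V] [Module ℝ V] [TopologicalSpace V]
    (A B : V [⋀^Fin 2]→L[ℝ] ℝ) (v : Fin (2 + 2) → V) :
    wedge A B v = A ![v 0, v 1] * B ![v 2, v 3] - A ![v 0, v 2] * B ![v 1, v 3]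
      + A ![v 0, v 3] * B ![v 1, v 2] + A ![v 1, v 2] * B ![v 0, v 3]
      - A ![v 1, v 3] * B ![v 0, v 2] + A ![v 2, v 3] * B ![v 0, v 1] := by
  unfold wedge
  have hA (s : Fin 4 → Fin 4) : (A fun i ↦ v (s (Fin.castAdd 2 i))) = A ![v (s 0), v (s 1)] := by
    congr 1; ext i; fin_cases i <;> rfl
  have hB (s : Fin 4 → Fin 4) : (B fun i ↦ v (s (Fin.natAdd 2 i))) = B ![v (s 2), v (s 3)] := by
    congr 1; ext i; fin_cases i <;> rfl
  simp only [hA, hB]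
  rw [sum_sign_perm_four (fun s a b c d ↦ (s : ℝ) * (A ![v a, v b] * B ![v c, v d]))]
  simp
  rw [alt_two_swap A (v 1) (v 0), alt_two_swap A (v 2) (v 1), alt_two_swap A (v 2) (v 0),
    alt_two_swap A (v 3) (v 0), alt_two_swap A (v 3) (v 1), alt_two_swap A (v 3) (v 2),
    alt_two_swap B (v 1) (v 0), alt_two_swap B (v 2) (v 1), alt_two_swap B (v 2) (v 0),
    alt_two_swap B (v 3) (v 0), alt_two_swap B (v 3) (v 1), alt_two_swap B (v 3) (v 2)]
  ring

end Wedge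

/-! ### Exterior derivatives and Nijenhuis tensors on a vector space -/

section Calculus

variable {E : Type*} [NormedAddCommGroup E] [NormedSpace ℝ E]
  {D : Type*} [NormedAddCommGroup D] [NormedSpace ℝ D]

theorem differentiableAt_clm_of_apply [FiniteDimensional ℝ E] {F : Type*} [NormedAddCommGroup F]
    [NormedSpace ℝ F] {f : D → E →L[ℝ] F} {x : D}
    (h : ∀ v, DifferentiableAt ℝ (fun y ↦ f y v) x) : DifferentiableAt ℝ f x := by
  let b := Module.finBasis ℝ E
  have hf : f = fun y ↦ ∑ i, ContinuousLinearMap.smulRightL ℝ E F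
      (LinearMap.toContinuousLinearMap (b.coord i)) (f y (b i)) := by
    ext y v
    have h1 : f y v = ∑ i, b.repr v i • f y (b i) := by
      simp_rw [← map_smul, ← map_sum, b.sum_repr]
    rw [h1]
    simp
  rw [hf]
  refine DifferentiableAt.fun_sum fun i _ ↦ ?_
  exact (ContinuousLinearMap.differentiableAt _).comp x (h (b i))

theorem differentiableAt_alternating_of_apply [FiniteDimensional ℝ E] {k : ℕ}
    {f : D → E [⋀^Fin k]→L[ℝ] ℝ} {x : D}
    (h : ∀ v, DifferentiableAt ℝ (fun y ↦ f y v) x) : DifferentiableAt ℝ f x := by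
  let b := Module.finBasis ℝ E
  let L : E [⋀^Fin k]→L[ℝ] ℝ →ₗ[ℝ] ((Fin k → Fin (Module.finrank ℝ E)) → ℝ) :=
    { toFun := fun α s ↦ α (fun i ↦ b (s i))
      map_add' := fun _ _ ↦ rfl
      map_smul' := fun _ _ ↦ rfl }
  -- An alternating form is determined by its values on tuples of basis vectors. A linear left
  -- inverse of this evaluation then transfers differentiability from the values to the form.
  have hL : LinearMap.ker L = ⊥ := by
    rw [LinearMap.ker_eq_bot]
    intro α β hαβ
    apply ContinuousAlternatingMap.toAlternatingMap_injective
    exact b.ext_alternating fun s _ ↦ congrFun hαβ s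
  obtain ⟨R, hR⟩ := L.exists_leftInverse_of_injective hL
  have hf : f = fun y ↦ LinearMap.toContinuousLinearMap R (L (f y)) := by
    funext y
    exact (LinearMap.congr_fun hR (f y)).symm
  rw [hf]
  refine (ContinuousLinearMap.differentiableAt _).comp x ?_
  exact differentiableAt_pi.2 fun s ↦ h _

theorem extDeriv_one_apply {α : E → E [⋀^Fin 1]→L[ℝ] ℝ} {x : E} (h : DifferentiableAt ℝ α x)
    (u v : E) : extDeriv α x ![u, v] =
      fderiv ℝ (fun y ↦ α y ![v]) x u - fderiv ℝ (fun y ↦ α y ![u]) x v := by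
  rw [extDeriv_apply h]
  have h0 : Fin.removeNth 0 ![u, v] = ![v] := by ext i; fin_cases i; rfl
  have h1 : Fin.removeNth 1 ![u, v] = ![u] := by ext i; fin_cases i; rfl
  refine (Fin.sum_univ_two _).trans ?_
  rw [h0, h1]
  simp [sub_eq_add_neg]

theorem extDeriv_two_apply {α : E → E [⋀^Fin 2]→L[ℝ] ℝ} {x : E} (h : DifferentiableAt ℝ α x)
    (u v w : E) : extDeriv α x ![u, v, w] =
      fderiv ℝ (fun y ↦ α y ![v, w]) x u - fderiv ℝ (fun y ↦ α y ![u, w]) x v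
        + fderiv ℝ (fun y ↦ α y ![u, v]) x w := by
  rw [extDeriv_apply h]
  have h0 : Fin.removeNth 0 ![u, v, w] = ![v, w] := by ext i; fin_cases i <;> rfl
  have h1 : Fin.removeNth 1 ![u, v, w] = ![u, w] := by ext i; fin_cases i <;> rfl
  have h2 : Fin.removeNth 2 ![u, v, w] = ![u, v] := by ext i; fin_cases i <;> rfl
  refine (Fin.sum_univ_three _).trans ?_
  rw [h0, h1, h2]
  simp [sub_eq_add_neg]

theorem extDeriv_three_apply {α : E → E [⋀^Fin 3]→L[ℝ] ℝ} {x : E} (h : DifferentiableAt ℝ α x)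
    (v : Fin 4 → E) : extDeriv α x v =
      fderiv ℝ (fun y ↦ α y ![v 1, v 2, v 3]) x (v 0)
        - fderiv ℝ (fun y ↦ α y ![v 0, v 2, v 3]) x (v 1)
        + fderiv ℝ (fun y ↦ α y ![v 0, v 1, v 3]) x (v 2)
        - fderiv ℝ (fun y ↦ α y ![v 0, v 1, v 2]) x (v 3) := by
  rw [extDeriv_apply h]
  have h0 : Fin.removeNth 0 v = ![v 1, v 2, v 3] := by ext i; fin_cases i <;> rfl
  have h1 : Fin.removeNth 1 v = ![v 0, v 2, v 3] := by ext i; fin_cases i <;> rfl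
  have h2 : Fin.removeNth 2 v = ![v 0, v 1, v 3] := by ext i; fin_cases i <;> rfl
  have h3 : Fin.removeNth 3 v = ![v 0, v 1, v 2] := by ext i; fin_cases i <;> rfl
  refine (Fin.sum_univ_four _).trans ?_
  rw [h0, h1, h2, h3]
  simp [sub_eq_add_neg, pow_succ]

/-- The exterior derivative of a 1-form on a vector space, as a function of two vectors. -/
def curl {F : Type*} [NormedAddCommGroup F] [NormedSpace ℝ F] (a : E → E →L[ℝ] F) (x u v : E) :
    F := fderiv ℝ a x u v - fderiv ℝ a x v u

theorem hasFDerivAt_clm_apply_const {F : Type*} [NormedAddCommGroup F] [NormedSpace ℝ F]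
    {G : Type*} [NormedAddCommGroup G] [NormedSpace ℝ G] {a : D → F →L[ℝ] G} {x : D}
    (ha : DifferentiableAt ℝ a x) (s : F) :
    HasFDerivAt (fun y ↦ a y s) ((fderiv ℝ a x).flip s) x :=
  (ContinuousLinearMap.apply ℝ G s).hasFDerivAt.comp x ha.hasFDerivAt

theorem differentiableAt_alternating_apply {k : ℕ} {A : E → E [⋀^Fin k]→L[ℝ] ℝ} {x : E}
    (h : DifferentiableAt ℝ A x) (v : Fin k → E) :
    DifferentiableAt ℝ (fun y ↦ A y v) x := by
  fun_prop

theorem differentiableAt_add_wedge [FiniteDimensional ℝ E] {F β : E → E [⋀^Fin 2]→L[ℝ] ℝ}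
    {a b : E → E →L[ℝ] ℝ} {x : E} (hβ : DifferentiableAt ℝ β x) (ha : DifferentiableAt ℝ a x)
    (hb : DifferentiableAt ℝ b x)
    (hF : ∀ᶠ y in 𝓝 x, ∀ u v, F y ![u, v] = β y ![u, v] + (a y u * b y v - a y v * b y u)) :
    DifferentiableAt ℝ F x := by
  refine differentiableAt_alternating_of_apply fun v ↦ ?_
  have hv : v = ![v 0, v 1] := by ext i; fin_cases i <;> rfl
  have : (fun y ↦ F y v) =ᶠ[𝓝 x]
      fun y ↦ β y v + (a y (v 0) * b y (v 1) - a y (v 1) * b y (v 0)) := by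
    filter_upwards [hF] with y hy
    have := hy (v 0) (v 1)
    rwa [← hv] at this
  refine DifferentiableAt.congr_of_eventuallyEq ?_ this
  fun_prop

/-- The Leibniz rule `d(β + a ∧ b) = dβ + da ∧ b - a ∧ db`, with `a ∧ db` written as `db ∧ a`. It is
applied to `F = π^*ω + π^*η ∧ θ`. -/
theorem extDeriv_add_wedge [FiniteDimensional ℝ E] {F β : E → E [⋀^Fin 2]→L[ℝ] ℝ}
    {a b : E → E →L[ℝ] ℝ} {x : E} (hβ : DifferentiableAt ℝ β x) (ha : DifferentiableAt ℝ a x)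
    (hb : DifferentiableAt ℝ b x)
    (hF : ∀ᶠ y in 𝓝 x, ∀ u v, F y ![u, v] = β y ![u, v] + (a y u * b y v - a y v * b y u))
    (u v w : E) :
    extDeriv F x ![u, v, w] = extDeriv β x ![u, v, w]
      + (curl a x u v * b x w - curl a x u w * b x v + curl a x v w * b x u)
      - (curl b x u v * a x w - curl b x u w * a x v + curl b x v w * a x u) := by
  have hd (p q r : E) : fderiv ℝ (fun y ↦ F y ![p, q]) x r = fderiv ℝ (fun y ↦ β y ![p, q]) x r
      + (fderiv ℝ a x r p * b x q + a x p * fderiv ℝ b x r q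
        - fderiv ℝ a x r q * b x p - a x q * fderiv ℝ b x r p) := by
    have h1 : (fun y ↦ F y ![p, q]) =ᶠ[𝓝 x]
        fun y ↦ β y ![p, q] + (a y p * b y q - a y q * b y p) := by
      filter_upwards [hF] with y hy using hy p q
    rw [h1.fderiv_eq]
    have hβ' : DifferentiableAt ℝ (fun y ↦ β y ![p, q]) x := by fun_prop
    have ha' (s : E) : HasFDerivAt (fun y ↦ a y s) ((fderiv ℝ a x).flip s) x :=
      hasFDerivAt_clm_apply_const ha s
    have hb' (s : E) : HasFDerivAt (fun y ↦ b y s) ((fderiv ℝ b x).flip s) x :=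
      hasFDerivAt_clm_apply_const hb s
    rw [(hβ'.hasFDerivAt.fun_add (((ha' p).fun_mul (hb' q)).fun_sub
      ((ha' q).fun_mul (hb' p)))).fderiv]
    simp
    ring
  rw [extDeriv_two_apply (differentiableAt_add_wedge hβ ha hb hF), extDeriv_two_apply hβ,
    hd, hd, hd]
  unfold curl
  ring

/-- The Leibniz rule for `γ = -A ∧ a - B ∧ b`, where `da = A`, `db = B` and both 2-forms are closed.
This is the shape of `J dF`. -/
theorem extDeriv_wedge_add_wedge [FiniteDimensional ℝ E] {γ : E → E [⋀^Fin 3]→L[ℝ] ℝ}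
    {A B : E → E [⋀^Fin 2]→L[ℝ] ℝ}
    {a b : E → E →L[ℝ] ℝ} {x : E} (hA : DifferentiableAt ℝ A x) (hB : DifferentiableAt ℝ B x)
    (ha : DifferentiableAt ℝ a x) (hb : DifferentiableAt ℝ b x)
    (hγ : ∀ᶠ y in 𝓝 x, ∀ u v w, γ y ![u, v, w] =
      -(A y ![u, v] * a y w - A y ![u, w] * a y v + A y ![v, w] * a y u)
      - (B y ![u, v] * b y w - B y ![u, w] * b y v + B y ![v, w] * b y u))
    (dA : extDeriv A x = 0) (dB : extDeriv B x = 0)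
    (da : ∀ u v, curl a x u v = A x ![u, v]) (db : ∀ u v, curl b x u v = B x ![u, v])
    (v : Fin (2 + 2) → E) :
    extDeriv γ x v = -wedge (A x) (A x) v - wedge (B x) (B x) v := by
  have ha' (s : E) : HasFDerivAt (fun y ↦ a y s) ((fderiv ℝ a x).flip s) x :=
    hasFDerivAt_clm_apply_const ha s
  have hb' (s : E) : HasFDerivAt (fun y ↦ b y s) ((fderiv ℝ b x).flip s) x :=
    hasFDerivAt_clm_apply_const hb s
  have hA' (p q : E) : HasFDerivAt (fun y ↦ A y ![p, q]) (fderiv ℝ (fun y ↦ A y ![p, q]) x) x :=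
    (differentiableAt_alternating_apply hA _).hasFDerivAt
  have hB' (p q : E) : HasFDerivAt (fun y ↦ B y ![p, q]) (fderiv ℝ (fun y ↦ B y ![p, q]) x) x :=
    (differentiableAt_alternating_apply hB _).hasFDerivAt
  have hev (p q r : E) : HasFDerivAt (fun y ↦ γ y ![p, q, r]) _ x :=
    HasFDerivAt.congr_of_eventuallyEq
      (((((hA' p q).fun_mul (ha' r)).fun_sub ((hA' p r).fun_mul (ha' q))).fun_add
        ((hA' q r).fun_mul (ha' p))).fun_neg.fun_sub
      ((((hB' p q).fun_mul (hb' r)).fun_sub ((hB' p r).fun_mul (hb' q))).fun_add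
        ((hB' q r).fun_mul (hb' p))))
      (by filter_upwards [hγ] with y hy using hy p q r)
  have hγd : DifferentiableAt ℝ γ x := by
    refine differentiableAt_alternating_of_apply fun v ↦ ?_
    have hv : v = ![v 0, v 1, v 2] := by ext i; fin_cases i <;> rfl
    rw [hv]
    exact (hev _ _ _).differentiableAt
  have zA (p q r : E) : extDeriv A x ![p, q, r] = 0 := by rw [dA]; rfl
  have zB (p q r : E) : extDeriv B x ![p, q, r] = 0 := by rw [dB]; rfl
  simp only [extDeriv_two_apply hA, extDeriv_two_apply hB] at zA zB
  simp only [curl] at da db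
  rw [extDeriv_three_apply hγd, (hev _ _ _).fderiv, (hev _ _ _).fderiv, (hev _ _ _).fderiv,
    (hev _ _ _).fderiv, wedge_two_two, wedge_two_two]
  simp only [← da, ← db]
  simp
  -- The multiples of `zA` and `zB` are the terms `dA ∧ a` and `dB ∧ b` of the Leibniz rule.
  linear_combination
    -(a x (v 3) * zA (v 0) (v 1) (v 2) - a x (v 2) * zA (v 0) (v 1) (v 3)
      + a x (v 1) * zA (v 0) (v 2) (v 3) - a x (v 0) * zA (v 1) (v 2) (v 3))
    - (b x (v 3) * zB (v 0) (v 1) (v 2) - b x (v 2) * zB (v 0) (v 1) (v 3)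
      + b x (v 1) * zB (v 0) (v 2) (v 3) - b x (v 0) * zB (v 1) (v 2) (v 3))

/-- The Nijenhuis torsion of a field of endomorphisms of a vector space, as a tensor. -/
def nijTensor (A : E → E →L[ℝ] E) (x u v : E) : E :=
  fderiv ℝ A x (A x u) v - fderiv ℝ A x (A x v) u - A x (fderiv ℝ A x u v)
    + A x (fderiv ℝ A x v u)

/-- The Nijenhuis torsion of a field of endomorphisms `J` which is intertwined with a family of
endomorphisms `K` by a vector-valued 1-form `B`. -/
theorem nijTensor_of_intertwined {F : Type*} [NormedAddCommGroup F] [NormedSpace ℝ F]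
    {J : E → E →L[ℝ] E} {B : E → E →L[ℝ] F} {K : E → F →L[ℝ] F} {x : E}
    (hJ : DifferentiableAt ℝ J x) (hB : DifferentiableAt ℝ B x) (hK : DifferentiableAt ℝ K x)
    (h : ∀ᶠ y in 𝓝 x, ∀ v, B y (J y v) = K y (B y v)) (u v : E) :
    B x (nijTensor J x u v) =
      fderiv ℝ K x (J x u) (B x v) - fderiv ℝ K x (J x v) (B x u)
        - K x (fderiv ℝ K x u (B x v)) + K x (fderiv ℝ K x v (B x u))
        - curl B x (J x u) (J x v) + K x (curl B x (J x u) v) + K x (curl B x u (J x v))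
        - K x (K x (curl B x u v)) := by
  have h0 : ∀ w, B x (J x w) = K x (B x w) := h.self_of_nhds
  have hBs (s : E) : HasFDerivAt (fun y ↦ B y s) ((fderiv ℝ B x).flip s) x :=
    hasFDerivAt_clm_apply_const hB s
  -- The derivative of `B J = K B` in the direction `w`, on a fixed vector `s`. Solving for `B (D_w
  -- J) s` removes the derivative of `J`; in the Nijenhuis tensor the derivatives of `B` then
  -- combine into values of `curl B`.
  have key (w s : E) : fderiv ℝ B x w (J x s) + B x (fderiv ℝ J x w s) =
      fderiv ℝ K x w (B x s) + K x (fderiv ℝ B x w s) := by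
    have h1 : (fun y ↦ B y (J y s)) =ᶠ[𝓝 x] fun y ↦ K y (B y s) := by
      filter_upwards [h] with y hy using hy s
    have h2 := HasFDerivAt.clm_apply hB.hasFDerivAt
      (hasFDerivAt_clm_apply_const (D := E) (a := J) hJ s)
    have h3 := HasFDerivAt.clm_apply hK.hasFDerivAt (hBs s)
    have h4 := h1.fderiv_eq (𝕜 := ℝ)
    rw [h2.fderiv, h3.fderiv] at h4
    have h5 := congrArg (fun g : E →L[ℝ] F ↦ g w) h4
    simp at h5
    rw [add_comm, h5, add_comm]
  have key' (w s : E) : B x (fderiv ℝ J x w s) =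
      fderiv ℝ K x w (B x s) + K x (fderiv ℝ B x w s) - fderiv ℝ B x w (J x s) := by
    rw [← key]; abel
  unfold nijTensor curl
  simp only [map_sub, map_add, h0, key']
  abel

/-- The Lie bracket formula for the Nijenhuis torsion on a vector space. -/
theorem nijTensor_eq_bracket {A : E → E →L[ℝ] E} {X Y : E → E} {x : E}
    (hA : DifferentiableAt ℝ A x) (hX : DifferentiableAt ℝ X x) (hY : DifferentiableAt ℝ Y x) :
    nijTensor A x (X x) (Y x) =
      A x (A x (fderiv ℝ Y x (X x) - fderiv ℝ X x (Y x)))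
        + (fderiv ℝ (fun y ↦ A y (Y y)) x (A x (X x))
          - fderiv ℝ (fun y ↦ A y (X y)) x (A x (Y x)))
        - A x (fderiv ℝ Y x (A x (X x)) - fderiv ℝ (fun y ↦ A y (X y)) x (Y x))
        - A x (fderiv ℝ (fun y ↦ A y (Y y)) x (X x) - fderiv ℝ X x (A x (Y x))) := by
  rw [(hA.hasFDerivAt.clm_apply hX.hasFDerivAt).fderiv,
    (hA.hasFDerivAt.clm_apply hY.hasFDerivAt).fderiv]
  simp [nijTensor]
  abel

end Calculus

/-! ### Vector fields, metrics and the Koszul formula -/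

section Fields

variable {E : Type*} [NormedAddCommGroup E] [NormedSpace ℝ E]
  {M : Type*} [TopologicalSpace M] [ChartedSpace E M] [IsManifold 𝓘(ℝ, E) ∞ M]

/-- The vector field with constant components in the preferred chart at `x`. -/
def coordField (x : M) (u : E) : VField 𝓘(ℝ, E) M := fieldOfCoord x fun _ ↦ u

theorem coordField_self (x : M) (u : E) : coordField x u x = u := fieldOfCoord_self x _

theorem diffAt_coordField (x : M) (u : E) : VField.DiffAt (coordField x u) x :=
  diffAt_fieldOfCoord (differentiableAt_const _)

theorem coord_coordField {x : M} (u : E) {y : E} (hy : y ∈ (extChartAt 𝓘(ℝ, E) x).target) :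
    (coordField x u).coord x y = u := coord_fieldOfCoord hy _

theorem coordField_symm {x : M} (u : E) {y : E} (hy : y ∈ (extChartAt 𝓘(ℝ, E) x).target) :
    coordField x u ((extChartAt 𝓘(ℝ, E) x).symm y) = frame x y u := by
  unfold coordField fieldOfCoord
  rw [(extChartAt 𝓘(ℝ, E) x).right_inv hy]

theorem eventually_coord_end (A : EndField 𝓘(ℝ, E) M) (X : VField 𝓘(ℝ, E) M) (x : M) :
    VField.coord (fun p ↦ A p (X p)) x =ᶠ[𝓝 (extChartAt 𝓘(ℝ, E) x x)]
      fun y ↦ A.coord x y (X.coord x y) := by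
  filter_upwards [target_mem_nhds x] with y hy
  exact coord_end_apply hy A X

theorem diffAt_end_apply {A : EndField 𝓘(ℝ, E) M} {X : VField 𝓘(ℝ, E) M} {x : M}
    (hA : DifferentiableAt ℝ (A.coord x) (extChartAt 𝓘(ℝ, E) x x)) (hX : VField.DiffAt X x) :
    VField.DiffAt (fun p ↦ A p (X p)) x := by
  rw [diffAt_iff_coord] at hX ⊢
  exact (hA.clm_apply hX).congr_of_eventuallyEq (eventually_coord_end A X x)

theorem nijenhuis_eq_nijTensor {A : EndField 𝓘(ℝ, E) M} {X Y : VField 𝓘(ℝ, E) M} {x : M}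
    (hA : DifferentiableAt ℝ (A.coord x) (extChartAt 𝓘(ℝ, E) x x)) (hX : VField.DiffAt X x)
    (hY : VField.DiffAt Y x) :
    nijenhuis A X Y x = nijTensor (A.coord x) (extChartAt 𝓘(ℝ, E) x x) (X x) (Y x) := by
  rw [diffAt_iff_coord] at hX hY
  have h := nijTensor_eq_bracket hA hX hY
  rw [X.coord_self, Y.coord_self] at h
  rw [h]
  unfold nijenhuis
  rw [mlieBracket_eq_coord, mlieBracket_eq_coord, mlieBracket_eq_coord, mlieBracket_eq_coord,
    (eventually_coord_end A X x).fderiv_eq, (eventually_coord_end A Y x).fderiv_eq,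
    A.coord_self]
  rfl

/-- Testing on the coordinate fields gives the columns of the matrix of `A` in the chart. -/
theorem differentiableAt_coord_end [FiniteDimensional ℝ E] {A : EndField 𝓘(ℝ, E) M} {x : M}
    (h : ∀ X : VField 𝓘(ℝ, E) M, VField.DiffAt X x → VField.DiffAt (fun p ↦ A p (X p)) x) :
    DifferentiableAt ℝ (A.coord x) (extChartAt 𝓘(ℝ, E) x x) := by
  refine differentiableAt_clm_of_apply fun v ↦ ?_
  have h1 := (diffAt_iff_coord _ _).1 (h _ (diffAt_coordField x v))
  refine h1.congr_of_eventuallyEq ?_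
  filter_upwards [target_mem_nhds x] with y hy
  rw [coord_end_apply hy, coord_coordField v hy]

theorem diffAt_end_apply_of_contMDiff {A : EndField 𝓘(ℝ, E) M}
    (hA : ContMDiff 𝓘(ℝ, E) (𝓘(ℝ, E).prod 𝓘(ℝ, E →L[ℝ] E)) ∞
      (fun x ↦ TotalSpace.mk' (E →L[ℝ] E)
        (E := fun x : M ↦ TangentSpace 𝓘(ℝ, E) x →L[ℝ] TangentSpace 𝓘(ℝ, E) x) x (A x)))
    {X : VField 𝓘(ℝ, E) M} {x : M} (hX : VField.DiffAt X x) :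
    VField.DiffAt (fun p ↦ A p (X p)) x :=
  (hA.mdifferentiableAt (by simp)).clm_bundle_apply hX

/-- A field of bilinear forms is differentiable at `x` if it takes differentiable vector fields to
differentiable functions. -/
def BilinField.DiffAt (h : BilinField 𝓘(ℝ, E) M) (x : M) : Prop :=
  ∀ X Y : VField 𝓘(ℝ, E) M, VField.DiffAt X x → VField.DiffAt Y x →
    MDifferentiableAt 𝓘(ℝ, E) 𝓘(ℝ, ℝ) (fun p ↦ h p (X p) (Y p)) x

theorem metric_diffAt [FiniteDimensional ℝ E]
    (g : ContMDiffRiemannianMetric 𝓘(ℝ, E) ∞ E (TangentSpace 𝓘(ℝ, E) : M → Type _)) (x : M) :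
    BilinField.DiffAt g.inner x := by
  intro X Y hX hY
  have : MDifferentiableAt 𝓘(ℝ, E) (𝓘(ℝ, E).prod 𝓘(ℝ)) 
      (fun m ↦ TotalSpace.mk' ℝ (E := Bundle.Trivial M ℝ) m (g.inner m (X m) (Y m))) x := by
    apply MDifferentiableAt.clm_bundle_apply₂ (F₁ := E) (F₂ := E)
    · exact g.contMDiff.mdifferentiableAt (by simp)
    · exact hX
    · exact hY
  simp only [mdifferentiableAt_totalSpace] at this
  exact this.2

theorem bilin_coord_apply (h : BilinField 𝓘(ℝ, E) M) (X Y : VField 𝓘(ℝ, E) M) {x : M} {y : E}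
    (hy : y ∈ (extChartAt 𝓘(ℝ, E) x).target) :
    h.coord x y (X.coord x y) (Y.coord x y) = h ((extChartAt 𝓘(ℝ, E) x).symm y)
      (X ((extChartAt 𝓘(ℝ, E) x).symm y)) (Y ((extChartAt 𝓘(ℝ, E) x).symm y)) := by
  rw [← frame_coord hy X, ← frame_coord hy Y]
  rfl

theorem BilinField.DiffAt.differentiableAt_coord [FiniteDimensional ℝ E]
    {h : BilinField 𝓘(ℝ, E) M} {x : M} (hh : h.DiffAt x) :
    DifferentiableAt ℝ (h.coord x) (extChartAt 𝓘(ℝ, E) x x) := by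
  refine differentiableAt_clm_of_apply fun u ↦ differentiableAt_clm_of_apply fun v ↦ ?_
  have h1 := (mdifferentiableAt_iff_comp_symm _ _).1
    (hh _ _ (diffAt_coordField x u) (diffAt_coordField x v))
  refine h1.congr_of_eventuallyEq ?_
  filter_upwards [target_mem_nhds x] with y hy
  rw [coordField_symm u hy, coordField_symm v hy]
  rfl

/-- The value of a field of bilinear forms, as a bilinear form on the model space. -/
def BilinField.val (h : BilinField 𝓘(ℝ, E) M) (x : M) : E →L[ℝ] E →L[ℝ] ℝ := h x

theorem BilinField.coord_self' (h : BilinField 𝓘(ℝ, E) M) (x : M) :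
    h.coord x (extChartAt 𝓘(ℝ, E) x x) = h.val x := h.coord_self x

/-- The derivative of `h(X, Y)` in terms of the components. -/
theorem mvfderiv_bilin_apply [FiniteDimensional ℝ E]
    {h : BilinField 𝓘(ℝ, E) M} {x : M} (hh : h.DiffAt x) {X Y : VField 𝓘(ℝ, E) M}
    (hX : VField.DiffAt X x) (hY : VField.DiffAt Y x) (u : E) :
    mvfderiv 𝓘(ℝ, E) (fun p ↦ h p (X p) (Y p)) x u =
      (fderiv ℝ (h.coord x) (extChartAt 𝓘(ℝ, E) x x) u (X x) (Y x) : ℝ)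
      + h.val x (fderiv ℝ (X.coord x) (extChartAt 𝓘(ℝ, E) x x) u) (Y x)
      + h.val x (X x) (fderiv ℝ (Y.coord x) (extChartAt 𝓘(ℝ, E) x x) u) := by
  rw [mvfderiv_eq_fderiv (hh X Y hX hY)]
  have h1 : (fun y ↦ h ((extChartAt 𝓘(ℝ, E) x).symm y) (X ((extChartAt 𝓘(ℝ, E) x).symm y))
      (Y ((extChartAt 𝓘(ℝ, E) x).symm y))) =ᶠ[𝓝 (extChartAt 𝓘(ℝ, E) x x)]
      fun y ↦ h.coord x y (X.coord x y) (Y.coord x y) := by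
    filter_upwards [target_mem_nhds x] with y hy
    exact (bilin_coord_apply h X Y hy).symm
  rw [diffAt_iff_coord] at hX hY
  rw [h1.fderiv_eq, ((hh.differentiableAt_coord.hasFDerivAt.clm_apply
    hX.hasFDerivAt).clm_apply hY.hasFDerivAt).fderiv]
  simp only [add_apply, ContinuousLinearMap.comp_apply,
    ContinuousLinearMap.flip_apply]
  rw [X.coord_self, Y.coord_self, h.coord_self']
  ring

/-- The torsion terms are kept. The formula thus gives uniqueness for a prescribed torsion, and it
allows the comparison of two connections on different manifolds. -/
theorem koszul [FiniteDimensional ℝ E] {h : BilinField 𝓘(ℝ, E) M}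
    {nabla : CovariantDerivative 𝓘(ℝ, E) E (TangentSpace 𝓘(ℝ, E) : M → Type _)}
    (hm : PreservesMetric h nabla)
    (hs : ∀ (p : M) (u v : TangentSpace 𝓘(ℝ, E) p), h p u v = h p v u)
    {X Y Z : VField 𝓘(ℝ, E) M} {x : M} (hX : VField.DiffAt X x) (hY : VField.DiffAt Y x)
    (hZ : VField.DiffAt Z x) :
    2 * h x (nabla Y x (X x)) (Z x) =
      mvfderiv 𝓘(ℝ, E) (fun p ↦ h p (Y p) (Z p)) x (X x)
      + mvfderiv 𝓘(ℝ, E) (fun p ↦ h p (X p) (Z p)) x (Y x)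
      - mvfderiv 𝓘(ℝ, E) (fun p ↦ h p (X p) (Y p)) x (Z x)
      + h x (VectorField.mlieBracket 𝓘(ℝ, E) X Y x) (Z x)
      - h x (VectorField.mlieBracket 𝓘(ℝ, E) X Z x) (Y x)
      - h x (VectorField.mlieBracket 𝓘(ℝ, E) Y Z x) (X x)
      + h x (nabla.torsion x (X x) (Y x)) (Z x) - h x (nabla.torsion x (X x) (Z x)) (Y x)
      - h x (nabla.torsion x (Y x) (Z x)) (X x) := by
  rw [hm Y Z x _ hY hZ, hm X Z x _ hX hZ, hm X Y x _ hX hY, nabla.torsion_apply hX hY,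
    nabla.torsion_apply hX hZ, nabla.torsion_apply hY hZ]
  simp only [map_sub, sub_apply]
  rw [hs x (X x) (nabla Z x (Y x)), hs x (X x) (nabla Y x (Z x)), hs x (Y x) (nabla Z x (X x))]
  ring

/-- A positive definite `B` identifies `V` with its dual, so the last slot of `K` can be raised.
This produces Christoffel symbols and contorsion tensors from their lowered versions. -/
theorem exists_bilinear_of_trilinear {V : Type*} [NormedAddCommGroup V] [NormedSpace ℝ V]
    [FiniteDimensional ℝ V] {B : V →L[ℝ] V →L[ℝ] ℝ} (hpos : ∀ v, v ≠ 0 → 0 < B v v)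
    {K : V → V → V → ℝ} (h1 : ∀ v w, IsLinearMap ℝ fun u ↦ K u v w)
    (h2 : ∀ u w, IsLinearMap ℝ fun v ↦ K u v w) (h3 : ∀ u v, IsLinearMap ℝ fun w ↦ K u v w) :
    ∃ Γ : V →L[ℝ] V →L[ℝ] V, ∀ u v w, B (Γ u v) w = K u v w := by
  let b : V →ₗ[ℝ] Module.Dual ℝ V :=
    { toFun := fun v ↦ (B v : V →ₗ[ℝ] ℝ)
      map_add' := fun u v ↦ by ext; simp
      map_smul' := fun c v ↦ by ext; simp }
  have hinj : Function.Injective b := by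
    rw [← LinearMap.ker_eq_bot, LinearMap.ker_eq_bot']
    intro v hv
    by_contra hne
    have h0 : B v v = 0 := LinearMap.congr_fun hv v
    exact (hpos v hne).ne' h0
  let e : V ≃ₗ[ℝ] Module.Dual ℝ V :=
    LinearEquiv.ofInjectiveOfFinrankEq b hinj Subspace.dual_finrank_eq.symm
  have he (v w : V) : e v w = B v w := rfl
  let k (u v : V) : Module.Dual ℝ V := (h3 u v).mk'
  let G : V →ₗ[ℝ] V →ₗ[ℝ] V := LinearMap.mk₂ ℝ (fun u v ↦ e.symm (k u v))
    (fun u u' v ↦ by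
      rw [← map_add]; congr 1; ext w; exact (h1 v w).map_add u u')
    (fun c u v ↦ by
      rw [← map_smul]; congr 1; ext w; exact (h1 v w).map_smul c u)
    (fun u v v' ↦ by
      rw [← map_add]; congr 1; ext w; exact (h2 u w).map_add v v')
    (fun c u v ↦ by
      rw [← map_smul]; congr 1; ext w; exact (h2 u w).map_smul c v)
  refine ⟨LinearMap.toContinuousLinearMap
    ((LinearMap.toContinuousLinearMap : (V →ₗ[ℝ] V) ≃ₗ[ℝ] V →L[ℝ] V).toLinearMap ∘ₗ G),
    fun u v w ↦ ?_⟩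
  change B (e.symm (k u v)) w = _
  rw [← he, LinearEquiv.apply_symm_apply]
  rfl

/-- The covariant derivative which, in the preferred chart at each point `x`, has the Christoffel
symbols `Γ x` at that point. -/
def connectionOfChristoffel [FiniteDimensional ℝ E] (Γ : M → E →L[ℝ] E →L[ℝ] E) :
    CovariantDerivative 𝓘(ℝ, E) E (TangentSpace 𝓘(ℝ, E) : M → Type _) where
  -- Each point uses only its own preferred chart, so `Γ` need not obey any transformation law.
  -- Additivity and the Leibniz rule are pointwise conditions.
  toFun Y x := fderiv ℝ (VField.coord Y x) (extChartAt 𝓘(ℝ, E) x x) + (Γ x).flip (Y x)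
  isCovariantDerivativeOnUniv :=
    { add := by
        intro Y Y' x hY hY' _
        replace hY : VField.DiffAt Y x := hY
        replace hY' : VField.DiffAt Y' x := hY'
        rw [diffAt_iff_coord] at hY hY'
        have h1 : VField.coord (Y + Y') x = fun y ↦ VField.coord Y x y + VField.coord Y' x y := by
          funext y
          exact map_add (frame x y).inverse _ _
        rw [h1, (hY.hasFDerivAt.fun_add hY'.hasFDerivAt).fderiv]
        have h2 : (Γ x).flip ((Y + Y') x) = (Γ x).flip (Y x) + (Γ x).flip (Y' x) :=
          map_add (Γ x).flip _ _
        rw [h2]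
        exact add_add_add_comm (G := E →L[ℝ] E) _ _ _ _
      leibniz := by
        intro Y f x hY hf _
        replace hY : VField.DiffAt Y x := hY
        rw [diffAt_iff_coord] at hY
        have hf' := (mdifferentiableAt_iff_comp_symm f x).1 hf
        have h1 : VField.coord (f • Y) x =
            fun y ↦ f ((extChartAt 𝓘(ℝ, E) x).symm y) • VField.coord Y x y := by
          funext y
          exact map_smul (frame x y).inverse _ _
        rw [h1, (hf'.hasFDerivAt.fun_smul hY.hasFDerivAt).fderiv]
        have h2 : (Γ x).flip ((f • Y) x) = f x • (Γ x).flip (Y x) :=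
          map_smul (Γ x).flip _ _
        have h3 : mvfderiv 𝓘(ℝ, E) f x = fderiv ℝ (fun y ↦ f ((extChartAt 𝓘(ℝ, E) x).symm y))
            (extChartAt 𝓘(ℝ, E) x x) := by
          ext u
          exact mvfderiv_eq_fderiv hf u
        rw [h2, h3, VField.coord_self, chart_symm_self]
        have h4 (a b c : E →L[ℝ] E) (r : ℝ) : r • a + b + r • c = r • (a + c) + b := by module
        exact h4 _ _ _ _ }

set_option synthInstance.maxHeartbeats 200000 in
/-- The derivative of the components of a field of bilinear forms in the preferred chart. -/
def BilinField.coordDeriv (h : BilinField 𝓘(ℝ, E) M) (x : M) : E →L[ℝ] E →L[ℝ] E →L[ℝ] ℝ :=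
  fderiv ℝ (h.coord x) (extChartAt 𝓘(ℝ, E) x x)

theorem fderiv_bilin_symm [FiniteDimensional ℝ E] {h : BilinField 𝓘(ℝ, E) M} {x : M}
    (hh : h.DiffAt x) (hs : ∀ (p : M) (u v : TangentSpace 𝓘(ℝ, E) p), h p u v = h p v u)
    (u v w : E) : fderiv ℝ (h.coord x) (extChartAt 𝓘(ℝ, E) x x) u v w =
      fderiv ℝ (h.coord x) (extChartAt 𝓘(ℝ, E) x x) u w v := by
  have h1 (v w : E) : fderiv ℝ (h.coord x) (extChartAt 𝓘(ℝ, E) x x) u v w =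
      fderiv ℝ (fun y ↦ h.coord x y v w) (extChartAt 𝓘(ℝ, E) x x) u := by
    have h2 := hh.differentiableAt_coord.hasFDerivAt
    have h3 := (h2.clm_apply (hasFDerivAt_const v _)).clm_apply
      (hasFDerivAt_const w (extChartAt 𝓘(ℝ, E) x x))
    rw [h3.fderiv]
    simp
  rw [h1, h1]
  congr 2
  funext y
  exact hs _ _ _

/-- A metric connection is determined by its torsion. -/
theorem eq_of_torsion_eq [FiniteDimensional ℝ E]
    {g : ContMDiffRiemannianMetric 𝓘(ℝ, E) ∞ E (TangentSpace 𝓘(ℝ, E) : M → Type _)}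
    {nabla nabla' : CovariantDerivative 𝓘(ℝ, E) E (TangentSpace 𝓘(ℝ, E) : M → Type _)}
    (h : PreservesMetric g.inner nabla) (h' : PreservesMetric g.inner nabla')
    (ht : ∀ (x : M) (u v w : TangentSpace 𝓘(ℝ, E) x),
      g.inner x (nabla.torsion x u v) w = g.inner x (nabla'.torsion x u v) w)
    {Y : VField 𝓘(ℝ, E) M} {x : M} (hY : VField.DiffAt Y x) : nabla Y x = nabla' Y x := by
  refine ContinuousLinearMap.ext fun u ↦ ?_
  have key (w : E) : BilinField.val g.inner x (nabla Y x u) w =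
      BilinField.val g.inner x (nabla' Y x u) w := by
    have hu := diffAt_coordField (E := E) x u
    have hw := diffAt_coordField x w
    have e1 : (coordField (E := E) x u : VField 𝓘(ℝ, E) M) x = u := coordField_self (E := E) x u
    have e2 : (coordField x w : VField 𝓘(ℝ, E) M) x = w := coordField_self x w
    have k1 := koszul h g.symm hu hY hw
    have k2 := koszul h' g.symm hu hY hw
    rw [ht, ht, ht, ← k2, e1, e2] at k1
    exact mul_left_cancel₀ two_ne_zero k1
  by_contra hne
  have h2 (a b : E) (h3 : ∀ w, BilinField.val g.inner x a w = BilinField.val g.inner x b w) :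
      a = b := by
    by_contra hab
    have h1 : 0 < BilinField.val g.inner x (a - b) (a - b) := g.pos x _ (sub_ne_zero.2 hab)
    rw [map_sub (BilinField.val g.inner x), sub_apply, h3, sub_self] at h1
    exact lt_irrefl _ h1
  exact hne (h2 _ _ key)

end Fields

/-! ### Existence of the Levi-Civita connection and of metric connections with given torsion -/

section Fields

variable {E : Type*} [NormedAddCommGroup E] [NormedSpace ℝ E]
  {M : Type*} [TopologicalSpace M] [ChartedSpace E M] [IsManifold 𝓘(ℝ, E) ∞ M]

set_option synthInstance.maxHeartbeats 400000 in
theorem exists_leviCivita_of_bilin [FiniteDimensional ℝ E] {h : BilinField 𝓘(ℝ, E) M}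
    (hd : ∀ x, h.DiffAt x) (hsymm : ∀ (p : M) (u v : TangentSpace 𝓘(ℝ, E) p), h p u v = h p v u)
    (hpos : ∀ (x : M) (v : E), v ≠ 0 → 0 < h.val x v v) :
    ∃ nabla : CovariantDerivative 𝓘(ℝ, E) E (TangentSpace 𝓘(ℝ, E) : M → Type _),
      IsLeviCivita h nabla := by
  have hvs (x : M) (u v : E) : h.val x u v = h.val x v u := hsymm x u v
  have hD (x : M) (u v w : E) : h.coordDeriv x u v w = h.coordDeriv x u w v :=
    fderiv_bilin_symm (hd x) hsymm u v w
  have a1 (x : M) (u u' v w : E) :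
    h.coordDeriv x (u + u') v w = h.coordDeriv x u v w + h.coordDeriv x u' v w := by
    rw [map_add]; rfl
  have s1 (x : M) (c : ℝ) (u v w : E) :
    h.coordDeriv x (c • u) v w = c * h.coordDeriv x u v w := by
    rw [map_smul]; rfl
  have a2 (x : M) (u v v' w : E) :
    h.coordDeriv x u (v + v') w = h.coordDeriv x u v w + h.coordDeriv x u v' w := by
    rw [map_add]; rfl
  have s2 (x : M) (c : ℝ) (u v w : E) :
    h.coordDeriv x u (c • v) w = c * h.coordDeriv x u v w := by
    rw [map_smul]; rfl
  have a3 (x : M) (u v w w' : E) :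
    h.coordDeriv x u v (w + w') = h.coordDeriv x u v w + h.coordDeriv x u v w' := map_add _ _ _
  have s3 (x : M) (c : ℝ) (u v w : E) :
    h.coordDeriv x u v (c • w) = c * h.coordDeriv x u v w := map_smul _ _ _
  -- The classical Christoffel symbols of the first kind, with the index raised by the metric. Their
  -- symmetry in `u` and `v` gives vanishing torsion.
  have hex (x : M) : ∃ Γ : E →L[ℝ] E →L[ℝ] E, ∀ u v w, h.val x (Γ u v) w =
      (1 / 2 : ℝ) * (h.coordDeriv x u v w + h.coordDeriv x v u w - h.coordDeriv x w u v) := by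
    refine exists_bilinear_of_trilinear (V := E) (B := h.val x) (hpos x)
      (fun v w ↦ ⟨?_, ?_⟩) (fun u w ↦ ⟨?_, ?_⟩) (fun u v ↦ ⟨?_, ?_⟩) <;>
      intros <;> simp only [a1, a2, a3, s1, s2, s3, smul_eq_mul] <;> ring
  choose Γ hΓ using hex
  have hΓs (x : M) (u v : E) : Γ x u v = Γ x v u := by
    by_contra hne
    have h1 : Γ x u v - Γ x v u ≠ 0 := sub_ne_zero.2 hne
    have h2 : 0 < h.val x (Γ x u v - Γ x v u) (Γ x u v - Γ x v u) := hpos x _ h1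
    have h3 (w : E) : h.val x (Γ x u v - Γ x v u) w = 0 := by
      rw [map_sub, sub_apply, hΓ, hΓ, hD x w u v]
      ring
    exact h2.ne' (h3 _)
  have key (x : M) (u y z a b : E) : h.coordDeriv x u y z + h.val x a z + h.val x y b =
      h.val x (a + Γ x u y) z + h.val x y (b + Γ x u z) := by
    rw [map_add, map_add, add_apply, hvs x y (Γ x u z), hΓ, hΓ, hD x y, hD x z, hD x u z]
    ring
  refine ⟨connectionOfChristoffel Γ, ?_, ?_⟩
  · intro Y Z x u hY hZ
    refine (mvfderiv_bilin_apply (hd x) hY hZ u).trans ?_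
    exact key x _ _ _ _ _
  · rw [CovariantDerivative.torsion_eq_zero_iff]
    intro X Y x hX hY
    rw [mlieBracket_eq_coord]
    change fderiv ℝ (VField.coord Y x) (extChartAt 𝓘(ℝ, E) x x) (X x) + Γ x (X x) (Y x) -
      (fderiv ℝ (VField.coord X x) (extChartAt 𝓘(ℝ, E) x x) (Y x) + Γ x (Y x) (X x)) = _
    rw [hΓs x (X x) (Y x)]
    exact add_sub_add_right_eq_sub (G := E) _ _ _

theorem exists_leviCivita [FiniteDimensional ℝ E]
    (g : ContMDiffRiemannianMetric 𝓘(ℝ, E) ∞ E (TangentSpace 𝓘(ℝ, E) : M → Type _)) :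
    ∃ nabla : CovariantDerivative 𝓘(ℝ, E) E (TangentSpace 𝓘(ℝ, E) : M → Type _),
      IsLeviCivita g.inner nabla :=
  exists_leviCivita_of_bilin (fun x ↦ metric_diffAt g x) g.symm fun x v hv ↦ g.pos x v hv

/-- The connection is `∇ᵍ + ½ c`. Skewness of `c` in the last two slots keeps the metric parallel.
Skewness in the first two makes the antisymmetrization of `½ c` equal to `c`, which becomes the
torsion. -/
theorem exists_connection_with_torsion [FiniteDimensional ℝ E]
    (g : ContMDiffRiemannianMetric 𝓘(ℝ, E) ∞ E (TangentSpace 𝓘(ℝ, E) : M → Type _))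
    {c : M → E → E → E → ℝ} (h1 : ∀ x v w, IsLinearMap ℝ fun u ↦ c x u v w)
    (h2 : ∀ x u w, IsLinearMap ℝ fun v ↦ c x u v w)
    (h3 : ∀ x u v, IsLinearMap ℝ fun w ↦ c x u v w)
    (h12 : ∀ x u v w, c x u v w = -c x v u w) (h23 : ∀ x u v w, c x u v w = -c x u w v) :
    ∃ nablag nabla : CovariantDerivative 𝓘(ℝ, E) E (TangentSpace 𝓘(ℝ, E) : M → Type _),
      IsLeviCivita g.inner nablag ∧
      (∀ (Y : VField 𝓘(ℝ, E) M) (x : M) (u w : TangentSpace 𝓘(ℝ, E) x),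
        g.inner x (nabla Y x u) w = g.inner x (nablag Y x u) w + (1 / 2) * c x u (Y x) w) ∧
      PreservesMetric g.inner nabla ∧
      ∀ (x : M) (u v w : TangentSpace 𝓘(ℝ, E) x),
        g.inner x (nabla.torsion x u v) w = c x u v w := by
  obtain ⟨nablag, hg⟩ := exists_leviCivita g
  -- The slots of `A` are swapped with respect to `c`, because `addOneForm` takes the value of the
  -- section first and the direction of differentiation second.
  have hex (x : M) : ∃ A : E →L[ℝ] E →L[ℝ] E, ∀ v u w,
      BilinField.val g.inner x (A v u) w = (1 / 2 : ℝ) * c x u v w := by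
    refine exists_bilinear_of_trilinear (V := E) (B := BilinField.val g.inner x)
      (fun v hv ↦ g.pos x v hv) (fun v w ↦ ⟨?_, ?_⟩) (fun u w ↦ ⟨?_, ?_⟩)
      (fun u v ↦ ⟨?_, ?_⟩) <;> intros <;>
      simp [(h1 _ _ _).map_add, (h2 _ _ _).map_add, (h3 _ _ _).map_add, (h1 _ _ _).map_smul,
        (h2 _ _ _).map_smul, (h3 _ _ _).map_smul] <;> ring
  choose A hA using hex
  let A' : ∀ x : M, TangentSpace 𝓘(ℝ, E) x →L[ℝ] TangentSpace 𝓘(ℝ, E) x →L[ℝ]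
    TangentSpace 𝓘(ℝ, E) x := A
  have hA' (x : M) (v u w : TangentSpace 𝓘(ℝ, E) x) :
    g.inner x (A' x v u) w = (1 / 2 : ℝ) * c x u v w := hA x v u w
  have hap (Y : VField 𝓘(ℝ, E) M) (x : M) (u : TangentSpace 𝓘(ℝ, E) x) :
    nablag.addOneForm A' Y x u = nablag Y x u + A' x (Y x) u := rfl
  refine ⟨nablag, nablag.addOneForm A', hg, fun Y x u w ↦ ?_, fun Y Z x u hY hZ ↦ ?_,
    fun x u v w ↦ ?_⟩
  · rw [hap, map_add, add_apply, hA']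
  · rw [hg.1 Y Z x u hY hZ, hap, hap, map_add, map_add, add_apply, hA', g.symm x (Y x) (A' _ _ _),
      hA']
    have h5 : c x u (Y x) (Z x) = -c x u (Z x) (Y x) := h23 _ _ _ _
    linear_combination -(1 / 2 : ℝ) * h5
  · have hu := diffAt_coordField (E := E) x u
    have hv := diffAt_coordField (E := E) x v
    have ht := (nablag.addOneForm A').torsion_apply hu hv
    have ht0 := nablag.torsion_apply hu hv
    rw [hg.2] at ht0
    have e1 : (coordField (E := E) x u : VField 𝓘(ℝ, E) M) x = u := coordField_self (E := E) x u
    have e2 : (coordField (E := E) x v : VField 𝓘(ℝ, E) M) x = v := coordField_self (E := E) x v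
    have hap' (Y : VField 𝓘(ℝ, E) M) (u : TangentSpace 𝓘(ℝ, E) x) :
      (nablag.addOneForm A').toFun Y x u = nablag.toFun Y x u + A' x (Y x) u := rfl
    rw [hap', hap', e1, e2] at ht
    rw [e1, e2] at ht0
    have ht1 : (nablag.addOneForm A').torsion x u v = A' x v u - A' x u v := by
      rw [ht]
      have h4 (a b c d e : TangentSpace 𝓘(ℝ, E) x) (h : 0 = a - b - e) :
          a + c - (b + d) - e = c - d := by
        rw [show a + c - (b + d) - e = a - b - e + (c - d) by abel, ← h, zero_add]
      exact h4 _ _ _ _ _ ht0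
    have h5 : c x v u w = -c x u v w := h12 _ _ _ _
    rw [ht1, map_sub]
    refine (congrArg₂ (fun a b : ℝ ↦ a - b) (hA' x v u w) (hA' x u v w)).trans ?_
    linear_combination -(1 / 2 : ℝ) * h5

end Fields

/-! ### Normal almost contact structures at a point of a vector space -/

section NormalStructures

variable {E : Type*} [NormedAddCommGroup E] [NormedSpace ℝ E]
  {D : Type*} [NormedAddCommGroup D] [NormedSpace ℝ D]

/-- A normal almost contact structure on a normed space near a point, where normality is only
required at the point. -/
structure IsNormalAt (φ : E → E →L[ℝ] E) (ξ : E → E) (η : E → E →L[ℝ] ℝ) (x : E) : Prop where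
  diff_φ : DifferentiableAt ℝ φ x
  diff_ξ : DifferentiableAt ℝ ξ x
  diff_η : DifferentiableAt ℝ η x
  sq : ∀ u, φ x (φ x u) = -u + η x u • ξ x
  φ_ξ : ∀ᶠ y in 𝓝 x, φ y (ξ y) = 0
  η_ξ : ∀ᶠ y in 𝓝 x, η y (ξ y) = 1
  η_φ : ∀ᶠ y in 𝓝 x, ∀ u, η y (φ y u) = 0
  normal : ∀ u v, nijTensor φ x u v + curl η x u v • ξ x = 0

namespace IsNormalAt

variable {φ : E → E →L[ℝ] E} {ξ : E → E} {η : E → E →L[ℝ] ℝ} {x : E}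

theorem fderiv_φ_ξ (h : IsNormalAt φ ξ η x) (u : E) :
    fderiv ℝ φ x u (ξ x) = -φ x (fderiv ℝ ξ x u) := by
  have h1 := h.diff_φ.hasFDerivAt.clm_apply h.diff_ξ.hasFDerivAt
  have h2 : (fun y ↦ φ y (ξ y)) =ᶠ[𝓝 x] fun _ ↦ 0 := h.φ_ξ
  have h3 := congrArg (· u) (h1.fderiv.symm.trans h2.fderiv_eq)
  simp only [fderiv_fun_const] at h3
  exact eq_neg_of_add_eq_zero_right h3

theorem η_fderiv_ξ (h : IsNormalAt φ ξ η x) (u : E) :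
    η x (fderiv ℝ ξ x u) = -fderiv ℝ η x u (ξ x) := by
  have h1 := h.diff_η.hasFDerivAt.clm_apply h.diff_ξ.hasFDerivAt
  have h2 : (fun y ↦ η y (ξ y)) =ᶠ[𝓝 x] fun _ ↦ 1 := h.η_ξ
  have h3 := congrArg (· u) (h1.fderiv.symm.trans h2.fderiv_eq)
  simp only [fderiv_fun_const] at h3
  exact eq_neg_of_add_eq_zero_left h3

theorem η_fderiv_φ (h : IsNormalAt φ ξ η x) (u v : E) :
    η x (fderiv ℝ φ x u v) = -fderiv ℝ η x u (φ x v) := by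
  have h1 := h.diff_η.hasFDerivAt.clm_apply (hasFDerivAt_clm_apply_const h.diff_φ v)
  have h2 : (fun y ↦ η y (φ y v)) =ᶠ[𝓝 x] fun _ ↦ 0 := h.η_φ.mono fun y hy ↦ hy v
  have h3 := congrArg (· u) (h1.fderiv.symm.trans h2.fderiv_eq)
  simp only [fderiv_fun_const] at h3
  exact eq_neg_of_add_eq_zero_left h3

/-- The vector inside `φ` is `(L_ξ φ) u`. The terms containing `φ ξ` drop out, and the derivative of
`φ ξ = 0` rewrites the others. -/
theorem nijTensor_ξ (h : IsNormalAt φ ξ η x) (u : E) :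
    nijTensor φ x u (ξ x) =
      φ x (fderiv ℝ φ x (ξ x) u - fderiv ℝ ξ x (φ x u) + φ x (fderiv ℝ ξ x u)) := by
  unfold nijTensor
  rw [h.fderiv_φ_ξ, h.fderiv_φ_ξ, h.φ_ξ.self_of_nhds]
  simp only [map_zero, zero_apply, map_neg, map_add, map_sub]
  abel

/-- Applying `η` to normality at `(u, ξ)` removes the Nijenhuis term, which lies in the image of
`φ`, and leaves `dη(u, ξ)`. -/
theorem curl_ξ_right (h : IsNormalAt φ ξ η x) (u : E) : curl η x u (ξ x) = 0 := by
  have h1 := congrArg (η x) (h.normal u (ξ x))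
  rw [h.nijTensor_ξ, map_add, h.η_φ.self_of_nhds, map_smul, h.η_ξ.self_of_nhds] at h1
  simpa using h1

theorem curl_ξ_left (h : IsNormalAt φ ξ η x) (u : E) : curl η x (ξ x) u = 0 := by
  have h1 := h.curl_ξ_right u
  unfold curl at h1 ⊢
  linarith

/-- The Lie derivative of `φ` along `ξ` vanishes. -/
theorem lie_ξ_φ (h : IsNormalAt φ ξ η x) (u : E) :
    fderiv ℝ φ x (ξ x) u - fderiv ℝ ξ x (φ x u) + φ x (fderiv ℝ ξ x u) = 0 := by
  have h1 := h.normal u (ξ x)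
  rw [h.nijTensor_ξ, h.curl_ξ_right, zero_smul, add_zero] at h1
  -- A vector killed by both `φ` and `η` is zero, because `φ² = -1 + η ⊗ ξ`. Normality at `(u, ξ)`
  -- shows that `φ` kills `(L_ξ φ) u`, and `i_ξ dη = 0` shows that `η` does.
  have h2 := h.sq (fderiv ℝ φ x (ξ x) u - fderiv ℝ ξ x (φ x u) + φ x (fderiv ℝ ξ x u))
  have h3 : η x (fderiv ℝ φ x (ξ x) u - fderiv ℝ ξ x (φ x u) + φ x (fderiv ℝ ξ x u)) = 0 := by
    have h4 := h.curl_ξ_right (φ x u)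
    unfold curl at h4
    rw [map_add, map_sub, h.η_fderiv_φ, h.η_fderiv_ξ, h.η_φ.self_of_nhds]
    linarith
  rw [h1, h3, map_zero, zero_smul, add_zero] at h2
  exact neg_eq_zero.1 h2.symm

/-- Because `η φ = 0`, applying `η` to the Nijenhuis tensor of `φ` gives `-dη(φu, φv)`. Normality
then equates this with `-dη(u, v)`. -/
theorem curl_φ_φ (h : IsNormalAt φ ξ η x) (u v : E) :
    curl η x (φ x u) (φ x v) = curl η x u v := by
  have h1 := congrArg (η x) (h.normal u v)
  unfold nijTensor at h1
  simp only [map_add, map_sub, map_smul, h.η_φ.self_of_nhds, h.η_ξ.self_of_nhds,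
    h.η_fderiv_φ, smul_eq_mul, map_zero] at h1
  unfold curl at h1 ⊢
  linarith

theorem curl_φ_left (h : IsNormalAt φ ξ η x) (u v : E) :
    curl η x (φ x u) v = -curl η x u (φ x v) := by
  have h1 := h.curl_φ_φ (φ x u) v
  have h2 := h.curl_ξ_left (φ x v)
  unfold curl at h1 h2 ⊢
  simp only [h.sq, map_add, map_neg, map_smul, add_apply, neg_apply, smul_apply,
    smul_eq_mul] at h1 h2
  linear_combination -h1 + η x u * h2

end IsNormalAt

/-- The endomorphism `(a, s) ↦ (φ a + s ξ, -η a)`. -/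
def liftEnd (φ : E →L[ℝ] E) (ξ : E) (η : E →L[ℝ] ℝ) : E × ℝ →L[ℝ] E × ℝ :=
  (φ.coprod (ContinuousLinearMap.toSpanSingleton ℝ ξ)).prod
    ((-η) ∘L ContinuousLinearMap.fst ℝ E ℝ)

theorem liftEnd_apply (φ : E →L[ℝ] E) (ξ : E) (η : E →L[ℝ] ℝ) (a : E × ℝ) :
    liftEnd φ ξ η a = (φ a.1 + a.2 • ξ, -η a.1) := rfl

theorem differentiableAt_prod_clm [FiniteDimensional ℝ D] {F : Type*} [NormedAddCommGroup F]
    [NormedSpace ℝ F] {F' : Type*} [NormedAddCommGroup F'] [NormedSpace ℝ F']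
    {a : D → D →L[ℝ] F} {b : D → D →L[ℝ] F'} {x : D} (ha : DifferentiableAt ℝ a x)
    (hb : DifferentiableAt ℝ b x) : DifferentiableAt ℝ (fun y ↦ (a y).prod (b y)) x ∧
      ∀ u v, fderiv ℝ (fun y ↦ (a y).prod (b y)) x u v =
        (fderiv ℝ a x u v, fderiv ℝ b x u v) := by
  have h1 (v : D) : HasFDerivAt (fun y ↦ ((a y).prod (b y)) v) _ x :=
    (hasFDerivAt_clm_apply_const ha v).prodMk (hasFDerivAt_clm_apply_const hb v)
  have h2 : DifferentiableAt ℝ (fun y ↦ (a y).prod (b y)) x :=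
    differentiableAt_clm_of_apply fun v ↦ (h1 v).differentiableAt
  refine ⟨h2, fun u v ↦ ?_⟩
  have h3 := (hasFDerivAt_clm_apply_const h2 v).fderiv
  rw [(h1 v).fderiv] at h3
  exact (congrArg (· u) h3).symm

/-! ### The Nijenhuis tensor of a lifted endomorphism field -/

section Lift

variable [FiniteDimensional ℝ E] {φ : E → E →L[ℝ] E} {ξ : E → E} {η : E → E →L[ℝ] ℝ}
  {f : D → E} {x : D}

theorem hasFDerivAt_liftEnd_apply (h : IsNormalAt φ ξ η (f x)) (hf : DifferentiableAt ℝ f x)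
    (a : E × ℝ) :
    HasFDerivAt (fun y ↦ liftEnd (φ (f y)) (ξ (f y)) (η (f y)) a)
      ((((fderiv ℝ φ (f x)).flip a.1 + a.2 • fderiv ℝ ξ (f x)).prod
        (-(fderiv ℝ η (f x)).flip a.1)) ∘L fderiv ℝ f x) x := by
  have h1 := (hasFDerivAt_clm_apply_const h.diff_φ a.1).comp x hf.hasFDerivAt
  have h2 := ((h.diff_ξ.hasFDerivAt.const_smul a.2).comp x hf.hasFDerivAt)
  have h3 := ((hasFDerivAt_clm_apply_const h.diff_η a.1).comp x hf.hasFDerivAt).neg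
  exact (h1.add h2).prodMk h3

theorem differentiableAt_liftEnd (h : IsNormalAt φ ξ η (f x)) (hf : DifferentiableAt ℝ f x) :
    DifferentiableAt ℝ (fun y ↦ liftEnd (φ (f y)) (ξ (f y)) (η (f y))) x :=
  differentiableAt_clm_of_apply fun a ↦ (hasFDerivAt_liftEnd_apply h hf a).differentiableAt

theorem fderiv_liftEnd_apply (h : IsNormalAt φ ξ η (f x)) (hf : DifferentiableAt ℝ f x)
    (u : D) (a : E × ℝ) :
    fderiv ℝ (fun y ↦ liftEnd (φ (f y)) (ξ (f y)) (η (f y))) x u a =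
      (fderiv ℝ φ (f x) (fderiv ℝ f x u) a.1 + a.2 • fderiv ℝ ξ (f x) (fderiv ℝ f x u),
        -fderiv ℝ η (f x) (fderiv ℝ f x u) a.1) := by
  have h1 := (hasFDerivAt_clm_apply_const (differentiableAt_liftEnd h hf) a).fderiv
  rw [(hasFDerivAt_liftEnd_apply h hf a).fderiv] at h1
  exact (congrArg (· u) h1).symm

/-- The Nijenhuis torsion of an endomorphism field `J` which is related, by a map `f` and a 1-form
`τ` whose exterior derivative is the pullback of `W`, to a normal almost contact structure. -/
theorem nijTensor_lift [FiniteDimensional ℝ D] (h : IsNormalAt φ ξ η (f x))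
    (hf : ContDiffAt ℝ 2 f x) {τ : D → D →L[ℝ] ℝ} (hτ : DifferentiableAt ℝ τ x)
    {J : D → D →L[ℝ] D} (hJ : DifferentiableAt ℝ J x)
    (hJB : ∀ᶠ y in 𝓝 x, ∀ v,
      fderiv ℝ f y (J y v) = φ (f y) (fderiv ℝ f y v) + τ y v • ξ (f y) ∧
      τ y (J y v) = -η (f y) (fderiv ℝ f y v))
    {W : E → E → ℝ} (hW : ∀ u v, curl τ x u v = W (fderiv ℝ f x u) (fderiv ℝ f x v)) (u v : D) :
    fderiv ℝ f x (nijTensor J x u v) =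
        (W (fderiv ℝ f x (J x u)) (fderiv ℝ f x v)
          + W (fderiv ℝ f x u) (fderiv ℝ f x (J x v))) • ξ (f x) ∧
      τ x (nijTensor J x u v) = W (fderiv ℝ f x u) (fderiv ℝ f x v)
        - W (fderiv ℝ f x (J x u)) (fderiv ℝ f x (J x v)) := by
  have hf1 : DifferentiableAt ℝ f x := hf.differentiableAt (by simp)
  have hf2 : DifferentiableAt ℝ (fderiv ℝ f) x :=
    (hf.fderiv_right (m := 1) (by norm_num)).differentiableAt (by simp)
  obtain ⟨hB, hBd⟩ := differentiableAt_prod_clm hf2 hτ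
  have hsymm (a b : D) : fderiv ℝ (fderiv ℝ f) x a b = fderiv ℝ (fderiv ℝ f) x b a :=
    (hf.isSymmSndFDerivAt (by simp)).eq a b
  -- The first component is the antisymmetrized second derivative of `f`, hence zero. Only the
  -- curvature survives.
  have hcurl (a b : D) : curl (fun y ↦ (fderiv ℝ f y).prod (τ y)) x a b =
      (0, W (fderiv ℝ f x a) (fderiv ℝ f x b)) := by
    rw [← hW]
    unfold curl
    rw [hBd, hBd, hsymm a b]
    simp
  have hint : ∀ᶠ y in 𝓝 x, ∀ v, ((fderiv ℝ f y).prod (τ y)) (J y v) =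
      liftEnd (φ (f y)) (ξ (f y)) (η (f y)) (((fderiv ℝ f y).prod (τ y)) v) := by
    filter_upwards [hJB] with y hy v
    exact Prod.ext (hy v).1 (hy v).2
  have key := nijTensor_of_intertwined hJ hB (differentiableAt_liftEnd h hf1) hint u v
  simp only [hcurl, fderiv_liftEnd_apply h hf1] at key
  have hJf (w : D) := (hJB.self_of_nhds w).1
  simp only [ContinuousLinearMap.prod_apply, liftEnd_apply, hJf] at key
  rw [hJf u, hJf v]
  -- From here on only the vectors `(a, s)` and `(b, t)`, the images of `u` and `v`, matter, and the
  -- claim is algebra in `φ`, `ξ`, `η` and their first derivatives.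
  generalize fderiv ℝ f x u = a at key ⊢
  generalize fderiv ℝ f x v = b at key ⊢
  generalize τ x u = s at key ⊢
  generalize τ x v = t at key ⊢
  generalize fderiv ℝ f x (nijTensor J x u v) = p at key ⊢
  generalize τ x (nijTensor J x u v) = q at key ⊢
  have k1 := congrArg Prod.fst key
  have k2 := congrArg Prod.snd key
  have hT := h.normal a b
  have hLa := h.lie_ξ_φ a
  have hLb := h.lie_ξ_φ b
  have hca := h.curl_ξ_left a
  have hcb := h.curl_ξ_left b
  have hcφ := h.curl_φ_left a b
  have hφξ := h.φ_ξ.self_of_nhds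
  have hηξ := h.η_ξ.self_of_nhds
  have e1 := h.η_fderiv_φ
  have e2 := h.η_fderiv_ξ
  simp only [Prod.fst_add, Prod.fst_sub, Prod.snd_add, Prod.snd_sub, map_add, map_smul, map_zero, add_apply, smul_apply, zero_add, add_zero, sub_zero, neg_zero, hηξ,
    hφξ, smul_zero, smul_eq_mul, mul_one, e1, e2] at k1 k2
  unfold nijTensor curl at hT
  unfold curl at hca hcb hcφ
  constructor
  · rw [k1]
    -- The part independent of `s` and `t` is normality at `(a, b)`; the rest is `L_ξ φ = 0`. In the
    -- other component the same roles are played by the `φ`-skewness of `dη` and by `i_ξ dη = 0`.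
    linear_combination (norm := module) hT + s • hLb - t • hLa
  · rw [k2]
    linear_combination -hcφ - s * hcb + t * hca

end Lift

end NormalStructures

/-! ### Fields of covectors in the chart -/

section CovectorFields

variable {E : Type*} [NormedAddCommGroup E] [NormedSpace ℝ E]
  {M : Type*} [TopologicalSpace M] [ChartedSpace E M] [IsManifold 𝓘(ℝ, E) ∞ M]

theorem Covector.differentiableAt_coord [FiniteDimensional ℝ E] {α : Covector 𝓘(ℝ, E) M} {x : M}
    (h : DifferentiableAt ℝ (α.toForm.inChart x) (extChartAt 𝓘(ℝ, E) x x)) :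
    DifferentiableAt ℝ (α.coord x) (extChartAt 𝓘(ℝ, E) x x) :=
  differentiableAt_clm_of_apply fun v ↦ differentiableAt_alternating_apply h ![v]

theorem Covector.curl_coord [FiniteDimensional ℝ E] {α : Covector 𝓘(ℝ, E) M} {x : M}
    (h : DifferentiableAt ℝ (α.toForm.inChart x) (extChartAt 𝓘(ℝ, E) x x)) (u v : E) :
    curl (α.coord x) (extChartAt 𝓘(ℝ, E) x x) u v = α.toForm.d x ![u, v] := by
  rw [α.toForm.d_eq_extDeriv x]
  refine Eq.trans ?_ (extDeriv_one_apply h u v).symm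
  have h1 (v : E) := (hasFDerivAt_clm_apply_const (Covector.differentiableAt_coord h) v).fderiv
  unfold curl
  have h2 (u v : E) : fderiv ℝ (α.coord x) (extChartAt 𝓘(ℝ, E) x x) u v =
      fderiv ℝ (fun y ↦ α.toForm.inChart x y ![v]) (extChartAt 𝓘(ℝ, E) x x) u :=
    (congrArg (· u) (h1 v)).symm
  rw [h2, h2]

end CovectorFields

/-! ### Almost contact metric structures in charts -/

namespace AlmostContactMetric

variable {m : ℕ} {N : Type*} [TopologicalSpace N]
  [ChartedSpace (EuclideanSpace ℝ (Fin m)) N] [IsManifold (𝓡 m) ∞ N]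
  (S : AlmostContactMetric m N)

theorem φ_ξ_and_η_φ (x : N) : S.φ x (S.ξ x) = 0 ∧ ∀ u, S.η x (S.φ x u) = 0 := by
  have hξ : S.ξ x ≠ 0 := fun h ↦ by
    have := S.η_ξ x
    rw [h, map_zero] at this
    exact zero_ne_one this
  -- The two ways of computing `φ³ u` are compared. At `u = ξ` this makes `φ ξ` a multiple `r ξ`,
  -- and `φ² ξ = 0` forces `r² = 0`.
  have h1 (u) : S.η x u • S.φ x (S.ξ x) = S.η x (S.φ x u) • S.ξ x := by
    have h2 := S.φ_sq x (S.φ x u)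
    rw [S.φ_sq x u, map_add, map_neg, map_smul] at h2
    exact add_left_cancel h2
  have h3 := h1 (S.ξ x)
  rw [S.η_ξ, one_smul] at h3
  obtain ⟨r, hr⟩ : ∃ r : ℝ, S.φ x (S.ξ x) = r • S.ξ x := ⟨_, h3⟩
  have h4 := congrArg (S.φ x) hr
  rw [S.φ_sq, S.η_ξ, one_smul, neg_add_cancel, map_smul, hr, smul_smul, eq_comm,
    smul_eq_zero_iff_left hξ, mul_self_eq_zero] at h4
  replace h3 : S.φ x (S.ξ x) = 0 := by rw [hr, h4, zero_smul]
  refine ⟨h3, fun u ↦ ?_⟩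
  have h5 := h1 u
  rwa [h3, smul_zero, eq_comm, smul_eq_zero_iff_left hξ] at h5

theorem φ_ξ (x : N) : S.φ x (S.ξ x) = 0 := (S.φ_ξ_and_η_φ x).1

theorem η_φ (x : N) (u : TangentSpace (𝓡 m) x) : S.η x (S.φ x u) = 0 := (S.φ_ξ_and_η_φ x).2 u

theorem differentiableAt_coord_φ (x : N) :
    DifferentiableAt ℝ (S.φ.coord x) (extChartAt (𝓡 m) x x) :=
  differentiableAt_coord_end fun _ hX ↦ diffAt_end_apply_of_contMDiff S.smooth_φ hX

theorem differentiableAt_coord_ξ (x : N) :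
    DifferentiableAt ℝ (S.ξ.coord x) (extChartAt (𝓡 m) x x) :=
  (diffAt_iff_coord S.ξ x).1 (S.smooth_ξ.mdifferentiableAt (by simp))

theorem differentiableAt_coord_η (x : N) :
    DifferentiableAt ℝ (S.η.coord x) (extChartAt (𝓡 m) x x) :=
  Covector.differentiableAt_coord (S.smooth_η.differentiableAt x)

theorem curl_coord_η (x : N) (u v : EuclideanSpace ℝ (Fin m)) :
    curl (S.η.coord x) (extChartAt (𝓡 m) x x) u v = S.dη x ![u, v] :=
  Covector.curl_coord (S.smooth_η.differentiableAt x) u v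

variable {S}

theorem IsNormal.isNormalAt (h : S.IsNormal) (x : N) :
    IsNormalAt (S.φ.coord x) (S.ξ.coord x) (S.η.coord x) (extChartAt (𝓡 m) x x) where
  diff_φ := S.differentiableAt_coord_φ x
  diff_ξ := S.differentiableAt_coord_ξ x
  diff_η := S.differentiableAt_coord_η x
  sq u := by
    rw [S.φ.coord_self, S.ξ.coord_self, S.η.coord_self]
    exact S.φ_sq x u
  φ_ξ := by
    filter_upwards [target_mem_nhds x] with y hy
    rw [← coord_end_apply hy]
    refine (congrArg (frame x y).inverse ?_).trans (map_zero _)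
    exact S.φ_ξ _
  η_ξ := by
    filter_upwards [target_mem_nhds x] with y hy
    refine Eq.trans ?_ (S.η_ξ ((extChartAt (𝓡 m) x).symm y))
    rw [← frame_coord hy S.ξ]
    rfl
  η_φ := by
    filter_upwards [target_mem_nhds x] with y hy u
    have h1 := S.η_φ ((extChartAt (𝓡 m) x).symm y) (frame x y u)
    refine Eq.trans ?_ h1
    exact congrArg (S.η ((extChartAt (𝓡 m) x).symm y)) (frame_self_inverse_apply hy _)
  normal u v := by
    have h1 := h (coordField x u) (coordField x v) x (diffAt_coordField x u)
      (diffAt_coordField x v)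
    rw [nijenhuis_eq_nijTensor (S.differentiableAt_coord_φ x) (diffAt_coordField x u)
      (diffAt_coordField x v), coordField_self, coordField_self] at h1
    rw [S.curl_coord_η, S.ξ.coord_self]
    exact h1

theorem IsNormal.dη_ξ_left (h : S.IsNormal) (x : N) (u : TangentSpace (𝓡 m) x) :
    S.dη x ![S.ξ x, u] = 0 := by
  have h1 := (h.isNormalAt x).curl_ξ_left u
  rw [S.ξ.coord_self] at h1
  exact (S.curl_coord_η x _ _).symm.trans h1

theorem IsNormal.dη_φ_φ (h : S.IsNormal) (x : N) (u v : TangentSpace (𝓡 m) x) :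
    S.dη x ![S.φ x u, S.φ x v] = S.dη x ![u, v] := by
  have h1 := (h.isNormalAt x).curl_φ_φ u v
  rw [S.φ.coord_self] at h1
  exact (S.curl_coord_η x _ _).symm.trans (h1.trans (S.curl_coord_η x _ _))

end AlmostContactMetric

/-! ### Bilinearity of alternating 2-forms -/

section WedgeAlgebra

variable {V : Type*} [AddCommGroup V] [Module ℝ V] [TopologicalSpace V]

theorem alt_two_add_left (A : V [⋀^Fin 2]→L[ℝ] ℝ) (u u' v : V) :
    A ![u + u', v] = A ![u, v] + A ![u', v] :=
  A.toContinuousMultilinearMap.cons_add ![v] u u'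

theorem alt_two_smul_left (A : V [⋀^Fin 2]→L[ℝ] ℝ) (c : ℝ) (u v : V) :
    A ![c • u, v] = c * A ![u, v] :=
  A.toContinuousMultilinearMap.cons_smul ![v] c u

theorem alt_two_add_right (A : V [⋀^Fin 2]→L[ℝ] ℝ) (u v v' : V) :
    A ![u, v + v'] = A ![u, v] + A ![u, v'] := by
  rw [alt_two_swap A u, alt_two_swap A u v, alt_two_swap A u v', alt_two_add_left]
  ring

theorem alt_two_smul_right (A : V [⋀^Fin 2]→L[ℝ] ℝ) (c : ℝ) (u v : V) :
    A ![u, c • v] = c * A ![u, v] := by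
  rw [alt_two_swap A u, alt_two_swap A u v, alt_two_smul_left]
  ring

theorem wedge_two_one_apply (A : V [⋀^Fin 2]→L[ℝ] ℝ) (b : V →L[ℝ] ℝ) (u v w : V) :
    wedge A (ContinuousAlternatingMap.ofSubsingleton ℝ V ℝ (0 : Fin 1) b) ![u, v, w] =
      A ![u, v] * b w - A ![u, w] * b v + A ![v, w] * b u := by
  rw [wedge_two_one]
  rfl

end WedgeAlgebra

/-! ### The splitting of the tangent spaces of the circle bundle -/

section CircleBundle

variable {k m : ℕ}
  {P : Type*} [TopologicalSpace P] [ChartedSpace (EuclideanSpace ℝ (Fin k)) P]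
  {N : Type*} [TopologicalSpace N] [ChartedSpace (EuclideanSpace ℝ (Fin m)) N]

/-- The differential of the projection, as a map between the model spaces. -/
abbrev dproj (k m : ℕ)
    {P : Type*} [TopologicalSpace P] [ChartedSpace (EuclideanSpace ℝ (Fin k)) P]
    {N : Type*} [TopologicalSpace N] [ChartedSpace (EuclideanSpace ℝ (Fin m)) N]
    (proj : P → N) (p : P) : EuclideanSpace ℝ (Fin k) →L[ℝ] EuclideanSpace ℝ (Fin m) :=
  tangentMapAt proj p

/-- The value of a 1-form, as a linear form on the model space. -/
def Covector.val (θ : Covector (𝓡 k) P) (p : P) : EuclideanSpace ℝ (Fin k) →L[ℝ] ℝ := θ p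

/-- The value of a field of endomorphisms, as an endomorphism of the model space. -/
def EndField.val (A : EndField (𝓡 k) P) (p : P) :
    EuclideanSpace ℝ (Fin k) →L[ℝ] EuclideanSpace ℝ (Fin k) := A p

/-- The value of a vector field, as a vector of the model space. -/
def VField.val (X : VField (𝓡 k) P) (p : P) : EuclideanSpace ℝ (Fin k) := X p

variable [MulAction Circle P]

theorem exists_local_section {proj : P → N}
    (hproj : IsPrincipalCircleBundle (k := k) (m := m) proj) (p : P) :
    ∃ s : N → P, MDifferentiableAt (𝓡 m) (𝓡 k) s (proj p) ∧ s (proj p) = p ∧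
      ∀ᶠ x in 𝓝 (proj p), proj (s x) = x := by
  obtain ⟨e, hx, -, he, -⟩ := hproj.locally_trivial (proj p)
  have hmem : p ∈ e.source := e.mem_source.2 hx
  have htgt : (proj p, (e p).2) ∈ e.target := by
    rw [e.target_eq]
    exact ⟨hx, trivial⟩
  -- The section with constant fibre coordinate, equal to that of `p`, so that it passes through
  -- `p`.
  refine ⟨fun x ↦ e.toOpenPartialHomeomorph.symm (x, (e p).2), ?_, ?_, ?_⟩
  · have h1 := he.contMDiffAt (e.open_target.mem_nhds htgt)
    have h2 : ContMDiffAt (𝓡 m) ((𝓡 m).prod (𝓡 1)) ∞ (fun x : N ↦ (x, (e p).2)) (proj p) :=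
      contMDiffAt_id.prodMk contMDiffAt_const
    exact (h1.comp (proj p) h2).mdifferentiableAt (by simp)
  · exact e.symm_apply_mk_proj hmem
  · filter_upwards [e.open_baseSet.mem_nhds hx] with x hx
    exact e.proj_symm_apply' hx

theorem IsPrincipalCircleBundle.surjective {proj : P → N}
    (hproj : IsPrincipalCircleBundle (k := k) (m := m) proj) : Function.Surjective proj := by
  intro x
  obtain ⟨e, hx, -⟩ := hproj.locally_trivial x
  exact ⟨_, e.proj_symm_apply' (b := x) (x := 1) hx⟩

theorem IsPrincipalCircleBundle.mdifferentiableAt {proj : P → N}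
    (hproj : IsPrincipalCircleBundle (k := k) (m := m) proj) (p : P) :
    MDifferentiableAt (𝓡 k) (𝓡 m) proj p :=
  hproj.smooth_proj.mdifferentiableAt (by simp)

/-- The differential of a local section through `p` is a right inverse. -/
theorem IsPrincipalCircleBundle.dproj_surjective {proj : P → N}
    (hproj : IsPrincipalCircleBundle (k := k) (m := m) proj) (p : P) :
    Function.Surjective (dproj k m proj p) := by
  obtain ⟨s, hs, hsp, hps⟩ := exists_local_section hproj p
  intro a
  have h1 : HasMFDerivAt (𝓡 m) (𝓡 m) (fun x ↦ proj (s x)) (proj p) _ :=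
    (hproj.mdifferentiableAt (s (proj p))).hasMFDerivAt.comp (proj p) hs.hasMFDerivAt
  have h2 : HasMFDerivAt (𝓡 m) (𝓡 m) (fun x ↦ proj (s x)) (proj p)
      (ContinuousLinearMap.id ℝ (TangentSpace (𝓡 m) (proj p))) :=
    (hasMFDerivAt_id (proj p)).congr_of_eventuallyEq hps
  have h3 := hasMFDerivAt_unique h1 h2
  have h4 : dproj k m proj (s (proj p)) (tangentMapAt s (proj p) a) = a :=
    congrArg (fun L : EuclideanSpace ℝ (Fin m) →L[ℝ] EuclideanSpace ℝ (Fin m) ↦ L a) h3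
  rw [hsp] at h4
  exact ⟨_, h4⟩

/-- The projection is constant along the orbit whose velocity is the fundamental field. -/
theorem IsPrincipalCircleBundle.dproj_fundamentalField {proj : P → N}
    (hproj : IsPrincipalCircleBundle (k := k) (m := m) proj) (p : P) :
    dproj k m proj p (fundamentalField k P p) = 0 := by
  let γ : ℝ → P := fun t ↦ Circle.exp (2 * Real.pi * t) • p
  have hγ0 : γ 0 = p := by simp [γ]
  have h1 : ContMDiff 𝓘(ℝ, ℝ) (𝓡 1) ∞ (fun t : ℝ ↦ Circle.exp (2 * Real.pi * t)) :=
    contMDiff_circleExp.comp (contDiff_const.mul contDiff_id).contMDiff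
  have hγ : ContMDiff 𝓘(ℝ, ℝ) (𝓡 k) ∞ γ :=
    hproj.smooth_smul.comp (h1.prodMk contMDiff_const)
  have h2 : HasMFDerivAt 𝓘(ℝ, ℝ) (𝓡 m) (fun t ↦ proj (γ t)) 0 _ :=
    (hproj.mdifferentiableAt (γ 0)).hasMFDerivAt.comp 0
      (hγ.mdifferentiableAt (by simp)).hasMFDerivAt
  have h3 : (fun t ↦ proj (γ t)) = fun _ ↦ proj p := funext fun t ↦ hproj.proj_smul _ _
  rw [h3] at h2
  have h4 := hasMFDerivAt_unique h2 (hasMFDerivAt_const _ _)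
  have h5 : dproj k m proj (γ 0) (fundamentalField k P p) = 0 :=
    congrArg (fun L : ℝ →L[ℝ] EuclideanSpace ℝ (Fin m) ↦ L 1) h4
  rwa [hγ0] at h5

/-- A principal circle bundle over a manifold of codimension one with a connection form. -/
structure IsCircleBundleWithConnection (proj : P → N) (θ : Covector (𝓡 k) P) : Prop where
  bundle : IsPrincipalCircleBundle (k := k) (m := m) proj
  connection : IsConnectionForm θ
  dim_eq : k = m + 1

namespace IsCircleBundleWithConnection

variable {proj : P → N} {θ : Covector (𝓡 k) P}

/-- Any lift of `a` can be corrected by a multiple of the fundamental field, which is vertical and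
has `θ`-value 1. -/
theorem exists_lift (h : IsCircleBundleWithConnection (m := m) proj θ) (p : P)
    (a : EuclideanSpace ℝ (Fin m)) (s : ℝ) : ∃ u, dproj k m proj p u = a ∧ θ.val p u = s := by
  obtain ⟨u, hu⟩ := h.bundle.dproj_surjective p a
  have h1 : θ.val p (fundamentalField k P p) = 1 := h.connection.fundamental p
  let V : EuclideanSpace ℝ (Fin k) := fundamentalField k P p
  have h2 : dproj k m proj p V = 0 := h.bundle.dproj_fundamentalField p
  refine ⟨u + (s - θ.val p u) • V, ?_, ?_⟩
  · rw [map_add, map_smul, h2, hu, smul_zero, add_zero]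
  · rw [map_add, map_smul, h1, smul_eq_mul, mul_one, add_sub_cancel]

/-- Surjectivity is enough, as the dimensions agree. This makes the `inverse` in `totalJ` a genuine
inverse instead of its default value zero, so `J` satisfies its two defining equations. -/
theorem splitting_isInvertible (h : IsCircleBundleWithConnection (m := m) proj θ) (p : P) :
    ((dproj k m proj p).prod (θ.val p)).IsInvertible := by
  have hsurj : Function.Surjective ((dproj k m proj p).prod (θ.val p)) := fun a ↦ by
    obtain ⟨u, h1, h2⟩ := h.exists_lift p a.1 a.2
    exact ⟨u, Prod.ext h1 h2⟩
  have hdim : Module.finrank ℝ (EuclideanSpace ℝ (Fin k)) =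
      Module.finrank ℝ (EuclideanSpace ℝ (Fin m) × ℝ) := by
    simp [h.dim_eq]
  have hinj := (LinearMap.injective_iff_surjective_of_finrank_eq_finrank hdim
    (f := (((dproj k m proj p).prod (θ.val p) : _ →L[ℝ] _) : _ →ₗ[ℝ] _))).2 hsurj
  exact ⟨(LinearEquiv.ofBijective _ ⟨hinj, hsurj⟩).toContinuousLinearEquiv, rfl⟩

theorem eq_of_dproj_eq (h : IsCircleBundleWithConnection (m := m) proj θ) {p : P}
    {u v : EuclideanSpace ℝ (Fin k)}
    (h1 : dproj k m proj p u = dproj k m proj p v) (h2 : θ.val p u = θ.val p v) : u = v :=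
  (h.splitting_isInvertible p).injective (Prod.ext h1 h2)

variable [IsManifold (𝓡 m) ∞ N]

theorem splitting_totalJ (h : IsCircleBundleWithConnection (m := m) proj θ)
    (S : AlmostContactMetric m N) (p : P) (u : EuclideanSpace ℝ (Fin k)) :
    ((dproj k m proj p).prod (θ.val p)) ((totalJ S proj θ).val p u) =
      liftEnd (S.φ.val (proj p)) (S.ξ.val (proj p)) (S.η.val (proj p))
        (((dproj k m proj p).prod (θ.val p)) u) :=
  (h.splitting_isInvertible p).self_apply_inverse _

theorem dproj_totalJ (h : IsCircleBundleWithConnection (m := m) proj θ)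
    (S : AlmostContactMetric m N) (p : P) (u : EuclideanSpace ℝ (Fin k)) :
    dproj k m proj p ((totalJ S proj θ).val p u) =
      S.φ.val (proj p) (dproj k m proj p u) + θ.val p u • S.ξ.val (proj p) :=
  congrArg Prod.fst (h.splitting_totalJ S p u)

theorem θ_totalJ (h : IsCircleBundleWithConnection (m := m) proj θ)
    (S : AlmostContactMetric m N) (p : P) (u : EuclideanSpace ℝ (Fin k)) :
    θ.val p ((totalJ S proj θ).val p u) = -S.η.val (proj p) (dproj k m proj p u) :=
  congrArg Prod.snd (h.splitting_totalJ S p u)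

end IsCircleBundleWithConnection

theorem totalMetric_apply [IsManifold (𝓡 m) ∞ N] (S : AlmostContactMetric m N) (proj : P → N) (θ : Covector (𝓡 k) P)
    (p : P) (u v : EuclideanSpace ℝ (Fin k)) :
    (totalMetric S proj θ).val p u v =
      BilinField.val S.g.inner (proj p) (dproj k m proj p u) (dproj k m proj p v)
        + θ.val p u * θ.val p v := rfl

end CircleBundle

/-! ### The projection and `J` in coordinates -/

section TotalSpace

variable {k m : ℕ}
  {P : Type*} [TopologicalSpace P] [ChartedSpace (EuclideanSpace ℝ (Fin k)) P]
  {N : Type*} [TopologicalSpace N] [ChartedSpace (EuclideanSpace ℝ (Fin m)) N]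
  [MulAction Circle P] [IsManifold (𝓡 m) ∞ N] [IsManifold (𝓡 k) ∞ P]

/-- The expression of the projection in the preferred charts at `p` and `proj p`. -/
abbrev projCoord (k m : ℕ)
    {P : Type*} [TopologicalSpace P] [ChartedSpace (EuclideanSpace ℝ (Fin k)) P]
    {N : Type*} [TopologicalSpace N] [ChartedSpace (EuclideanSpace ℝ (Fin m)) N]
    (proj : P → N) (p : P) : EuclideanSpace ℝ (Fin k) → EuclideanSpace ℝ (Fin m) :=
  mapCoord proj p (proj p)

/-- The coordinates of a point in the preferred chart at that point. -/
abbrev center (k : ℕ) {P : Type*} [TopologicalSpace P]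
    [ChartedSpace (EuclideanSpace ℝ (Fin k)) P] (p : P) : EuclideanSpace ℝ (Fin k) :=
  extChartAt (𝓡 k) p p

theorem projCoord_self (proj : P → N) (p : P) :
    projCoord k m proj p (center k p) = center m (proj p) := mapCoord_self proj p

theorem IsPrincipalCircleBundle.contDiffAt_projCoord {proj : P → N}
    (hproj : IsPrincipalCircleBundle (k := k) (m := m) proj) (p : P) :
    ContDiffAt ℝ ∞ (projCoord k m proj p) (center k p) :=
  contDiffAt_mapCoord (center_mem (E := EuclideanSpace ℝ (Fin m)) proj p).1
    hproj.smooth_proj.contMDiffAt (center_mem proj p).2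

theorem IsPrincipalCircleBundle.fderiv_projCoord {proj : P → N}
    (hproj : IsPrincipalCircleBundle (k := k) (m := m) proj) (p : P) :
    fderiv ℝ (projCoord k m proj p) (center k p) = dproj k m proj p :=
  fderiv_mapCoord_self (hproj.mdifferentiableAt p)

/-- Near the centre of the chart at `p`, the differential of the projection in coordinates. -/
theorem IsPrincipalCircleBundle.eventually_fderiv_projCoord {proj : P → N}
    (hproj : IsPrincipalCircleBundle (k := k) (m := m) proj) (p : P) :
    ∀ᶠ y in 𝓝 (center k p), y ∈ (extChartAt (𝓡 k) p).target ∧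
      projCoord k m proj p y ∈ (extChartAt (𝓡 m) (proj p)).target ∧
      (extChartAt (𝓡 m) (proj p)).symm (projCoord k m proj p y) =
        proj ((extChartAt (𝓡 k) p).symm y) ∧
      ∀ v, frame (proj p) (projCoord k m proj p y) (fderiv ℝ (projCoord k m proj p) y v) =
        dproj k m proj ((extChartAt (𝓡 k) p).symm y) (frame p y v) := by
  filter_upwards [eventually_mapCoord (E := EuclideanSpace ℝ (Fin m))
    (E' := EuclideanSpace ℝ (Fin k)) (hproj.mdifferentiableAt p).continuousAt] with y hy
  exact ⟨hy.1, (extChartAt (𝓡 m) (proj p)).map_source hy.2, symm_mapCoord hy.2,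
    fun v ↦ frame_mapCoord hy.1 (hproj.mdifferentiableAt _) hy.2 v⟩

theorem frame_end_coord (A : EndField (𝓡 m) N) {x q : N} {y : EuclideanSpace ℝ (Fin m)}
    (hy : y ∈ (extChartAt (𝓡 m) x).target) (hq : (extChartAt (𝓡 m) x).symm y = q)
    (v : EuclideanSpace ℝ (Fin m)) :
    frame x y (A.coord x y v) = A.val q (frame x y v) := by
  subst hq
  exact frame_self_inverse_apply hy _

theorem frame_vfield_coord (X : VField (𝓡 m) N) {x q : N} {y : EuclideanSpace ℝ (Fin m)}
    (hy : y ∈ (extChartAt (𝓡 m) x).target) (hq : (extChartAt (𝓡 m) x).symm y = q) :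
    frame x y (X.coord x y) = X.val q := by
  subst hq
  exact frame_self_inverse_apply hy _

theorem covector_coord_apply (α : Covector (𝓡 m) N) {x q : N} {y : EuclideanSpace ℝ (Fin m)}
    (hq : (extChartAt (𝓡 m) x).symm y = q) (v : EuclideanSpace ℝ (Fin m)) :
    α.coord x y v = α.val q (frame x y v) := by
  subst hq
  rfl

theorem frame_injective {x : N} {y : EuclideanSpace ℝ (Fin m)}
    (hy : y ∈ (extChartAt (𝓡 m) x).target) : Function.Injective (frame x y) :=
  (frame_isInvertible hy).injective

namespace IsCircleBundleWithConnection

variable {proj : P → N} {θ : Covector (𝓡 k) P}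

theorem differentiableAt_coord_θ (h : IsCircleBundleWithConnection (m := m) proj θ) (p : P) :
    DifferentiableAt ℝ (θ.coord p) (center k p) :=
  Covector.differentiableAt_coord (h.connection.smooth.differentiableAt p)

theorem eventually_totalJ_coord (h : IsCircleBundleWithConnection (m := m) proj θ)
    (S : AlmostContactMetric m N) (p : P) : ∀ᶠ y in 𝓝 (center k p), ∀ v,
      fderiv ℝ (projCoord k m proj p) y ((totalJ S proj θ).coord p y v) =
        S.φ.coord (proj p) (projCoord k m proj p y) (fderiv ℝ (projCoord k m proj p) y v)
          + θ.coord p y v • S.ξ.coord (proj p) (projCoord k m proj p y) ∧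
      θ.coord p y ((totalJ S proj θ).coord p y v) =
        -S.η.coord (proj p) (projCoord k m proj p y) (fderiv ℝ (projCoord k m proj p) y v) := by
  filter_upwards [h.bundle.eventually_fderiv_projCoord p] with y ⟨hy, hy', hq, hf⟩ v
  constructor
  · apply frame_injective hy'
    rw [hf, frame_end_coord _ hy rfl, h.dproj_totalJ S, map_add, map_smul,
      frame_end_coord _ hy' hq, frame_vfield_coord _ hy' hq, hf, covector_coord_apply θ rfl]
  · rw [covector_coord_apply θ rfl, covector_coord_apply S.η hq, hf, frame_end_coord _ hy rfl,
      h.θ_totalJ S]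

/-- The expression of the splitting `(π_*, θ)` in the preferred charts. -/
def splitCoord (proj : P → N) (θ : Covector (𝓡 k) P) (p : P) (y : EuclideanSpace ℝ (Fin k)) :
    EuclideanSpace ℝ (Fin k) →L[ℝ] EuclideanSpace ℝ (Fin m) × ℝ :=
  (fderiv ℝ (projCoord k m proj p) y).prod (θ.coord p y)

theorem differentiableAt_splitCoord (h : IsCircleBundleWithConnection (m := m) proj θ) (p : P) :
    DifferentiableAt ℝ (splitCoord (m := m) proj θ p) (center k p) :=
  (differentiableAt_prod_clm (((h.bundle.contDiffAt_projCoord p).fderiv_right (m := 1)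
    (by norm_cast)).differentiableAt (by simp)) (h.differentiableAt_coord_θ p)).1

theorem splitCoord_isInvertible (h : IsCircleBundleWithConnection (m := m) proj θ) (p : P) :
    (splitCoord (m := m) proj θ p (center k p)).IsInvertible := by
  unfold splitCoord
  rw [h.bundle.fderiv_projCoord, θ.coord_self]
  exact h.splitting_isInvertible p

theorem eventually_splitCoord_isInvertible (h : IsCircleBundleWithConnection (m := m) proj θ)
    (p : P) : ∀ᶠ y in 𝓝 (center k p), (splitCoord (m := m) proj θ p y).IsInvertible :=
  (h.differentiableAt_splitCoord p).continuousAt.eventually (by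
    obtain ⟨e, he⟩ := h.splitCoord_isInvertible p
    rw [← he]
    exact ContinuousLinearEquiv.nhds e)

theorem differentiableAt_inverse_splitCoord (h : IsCircleBundleWithConnection (m := m) proj θ)
    (p : P) :
    DifferentiableAt ℝ (fun y ↦ (splitCoord (m := m) proj θ p y).inverse) (center k p) :=
  DifferentiableAt.comp (g := ContinuousLinearMap.inverse) (center k p)
    (((h.splitCoord_isInvertible p).contDiffAt_map_inverse (n := 1)).differentiableAt (by simp))
    (h.differentiableAt_splitCoord p)

/-- Near the centre `J = B⁻¹ K B`, where `B` is the splitting and `K` the model endomorphism along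
the projection. Inversion of linear maps is differentiable at an invertible map. -/
theorem differentiableAt_coord_totalJ (h : IsCircleBundleWithConnection (m := m) proj θ)
    {S : AlmostContactMetric m N} (hS : S.IsNormal) (p : P) :
    DifferentiableAt ℝ ((totalJ S proj θ).coord p) (center k p) := by
  have hN : IsNormalAt (S.φ.coord (proj p)) (S.ξ.coord (proj p)) (S.η.coord (proj p))
      (projCoord k m proj p (center k p)) := by
    rw [projCoord_self]; exact hS.isNormalAt (proj p)
  have hK := differentiableAt_liftEnd hN
    ((h.bundle.contDiffAt_projCoord p).differentiableAt (by simp))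
  refine (((h.differentiableAt_inverse_splitCoord p).clm_comp hK).clm_comp
    (h.differentiableAt_splitCoord p)).congr_of_eventuallyEq ?_
  filter_upwards [h.eventually_splitCoord_isInvertible p, h.eventually_totalJ_coord S p]
    with y hy hJ
  ext1 v
  rw [← hy.inverse_apply_self ((totalJ S proj θ).coord p y v)]
  exact congrArg _ (Prod.ext (hJ v).1 (hJ v).2)

end IsCircleBundleWithConnection

end TotalSpace

theorem compContinuousLinearMap_two {V W : Type*} [AddCommGroup V] [Module ℝ V]
    [TopologicalSpace V] [AddCommGroup W] [Module ℝ W] [TopologicalSpace W]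
    (A : W [⋀^Fin 2]→L[ℝ] ℝ) (L : V →L[ℝ] W) (u v : V) :
    A.compContinuousLinearMap L ![u, v] = A ![L u, L v] :=
  congrArg A (funext fun i ↦ by fin_cases i <;> rfl)

theorem compContinuousLinearMap_three {V W : Type*} [AddCommGroup V] [Module ℝ V]
    [TopologicalSpace V] [AddCommGroup W] [Module ℝ W] [TopologicalSpace W]
    (A : W [⋀^Fin 3]→L[ℝ] ℝ) (L : V →L[ℝ] W) (u v w : V) :
    A.compContinuousLinearMap L ![u, v, w] = A ![L u, L v, L w] :=
  congrArg A (funext fun i ↦ by fin_cases i <;> rfl)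

/-! ### Values of 2-forms on model vectors -/

section Values

variable {m : ℕ} {N : Type*} [TopologicalSpace N] [ChartedSpace (EuclideanSpace ℝ (Fin m)) N]

/-- The value of a 2-form on two vectors of the model space. -/
def DForm.val₂ (α : DForm (𝓡 m) N 2) (x : N) (u v : EuclideanSpace ℝ (Fin m)) : ℝ := α x ![u, v]

variable (α : DForm (𝓡 m) N 2) (x : N) (c : ℝ) (u u' v v' : EuclideanSpace ℝ (Fin m))

theorem DForm.val₂_swap : α.val₂ x u v = -α.val₂ x v u :=
  alt_two_swap (V := EuclideanSpace ℝ (Fin m)) (α x) u v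

theorem DForm.val₂_add_left : α.val₂ x (u + u') v = α.val₂ x u v + α.val₂ x u' v :=
  alt_two_add_left (V := EuclideanSpace ℝ (Fin m)) (α x) u u' v

theorem DForm.val₂_add_right : α.val₂ x u (v + v') = α.val₂ x u v + α.val₂ x u v' :=
  alt_two_add_right (V := EuclideanSpace ℝ (Fin m)) (α x) u v v'

theorem DForm.val₂_smul_left : α.val₂ x (c • u) v = c * α.val₂ x u v :=
  alt_two_smul_left (V := EuclideanSpace ℝ (Fin m)) (α x) c u v

theorem DForm.val₂_smul_right : α.val₂ x u (c • v) = c * α.val₂ x u v :=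
  alt_two_smul_right (V := EuclideanSpace ℝ (Fin m)) (α x) c u v

theorem DForm.val₂_neg_left : α.val₂ x (-u) v = -α.val₂ x u v := by
  rw [← neg_one_smul ℝ u, DForm.val₂_smul_left, neg_one_mul]

end Values

/-! ### Pointwise identities of an almost contact metric structure -/

namespace AlmostContactMetric

variable {m : ℕ} {N : Type*} [TopologicalSpace N]
  [ChartedSpace (EuclideanSpace ℝ (Fin m)) N] [IsManifold (𝓡 m) ∞ N]
  (S : AlmostContactMetric m N) (x : N) (u v : EuclideanSpace ℝ (Fin m))

theorem val_φ_φ : S.φ.val x (S.φ.val x u) = -u + S.η.val x u • S.ξ.val x := S.φ_sq x u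

theorem val_φ_ξ : S.φ.val x (S.ξ.val x) = 0 := S.φ_ξ x

theorem val_η_φ : S.η.val x (S.φ.val x u) = 0 := S.η_φ x u

theorem val_η_ξ : S.η.val x (S.ξ.val x) = 1 := S.η_ξ x

/-- The metric of an almost contact metric structure, as a field of bilinear forms. -/
abbrev met : BilinField (𝓡 m) N := S.g.inner

theorem val_met_swap : S.met.val x u v = S.met.val x v u := S.g.symm x u v

theorem val_met_φ_φ : S.met.val x (S.φ.val x u) (S.φ.val x v) =
    S.met.val x u v - S.η.val x u * S.η.val x v := S.compat x u v

/-- Compatibility of the metric with `u = ξ`, where `φ ξ = 0`. -/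
theorem val_met_ξ : S.met.val x (S.ξ.val x) v = S.η.val x v := by
  have h := S.val_met_φ_φ x (S.ξ.val x) v
  rw [S.val_φ_ξ, map_zero, S.val_η_ξ, one_mul] at h
  exact (sub_eq_zero.1 h.symm)

theorem val_met_ξ_right : S.met.val x v (S.ξ.val x) = S.η.val x v := by
  rw [S.val_met_swap, S.val_met_ξ]

theorem val_met_φ_right : S.met.val x u (S.φ.val x v) = -S.met.val x v (S.φ.val x u) := by
  have h := S.val_met_φ_φ x u (S.φ.val x v)
  rw [S.val_φ_φ, S.val_η_φ, map_add, map_neg, map_smul, S.val_met_ξ_right, S.val_η_φ, smul_zero,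
    add_zero, mul_zero, sub_zero, S.val_met_swap x _ v] at h
  exact h.symm

end AlmostContactMetric

/-! ### When the structure on the total space is Hermitian -/

section TotalSpace

variable {k m : ℕ}
  {P : Type*} [TopologicalSpace P] [ChartedSpace (EuclideanSpace ℝ (Fin k)) P]
  {N : Type*} [TopologicalSpace N] [ChartedSpace (EuclideanSpace ℝ (Fin m)) N]
  [MulAction Circle P] [IsManifold (𝓡 m) ∞ N] [IsManifold (𝓡 k) ∞ P]

/-- The 2-form `Ω` on the base is the curvature form of the connection form `θ`. -/
def IsCurvature (proj : P → N) (θ : Covector (𝓡 k) P) (Ω : DForm (𝓡 m) N 2) : Prop :=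
  ∀ p : P, θ.toForm.d p = (Ω (proj p)).compContinuousLinearMap (mfderiv (𝓡 k) (𝓡 m) proj p)

namespace IsCircleBundleWithConnection

variable {proj : P → N} {θ : Covector (𝓡 k) P} {S : AlmostContactMetric m N}
  {Ω : DForm (𝓡 m) N 2}

theorem curl_coord_θ (h : IsCircleBundleWithConnection (m := m) proj θ)
    (hΩ : IsCurvature proj θ Ω) (p : P) (u v : EuclideanSpace ℝ (Fin k)) :
    curl (θ.coord p) (center k p) u v =
      Ω.val₂ (proj p) (dproj k m proj p u) (dproj k m proj p v) := by
  rw [Covector.curl_coord (h.connection.smooth.differentiableAt p), hΩ p]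
  exact compContinuousLinearMap_two (V := EuclideanSpace ℝ (Fin k)) _ _ u v

theorem nijTensor_totalJ (h : IsCircleBundleWithConnection (m := m) proj θ)
    (hΩ : IsCurvature proj θ Ω) (hS : S.IsNormal) (p : P) (u v : EuclideanSpace ℝ (Fin k)) :
    dproj k m proj p (nijTensor ((totalJ S proj θ).coord p) (center k p) u v) =
      (Ω.val₂ (proj p) (dproj k m proj p ((totalJ S proj θ).val p u)) (dproj k m proj p v)
        + Ω.val₂ (proj p) (dproj k m proj p u) (dproj k m proj p ((totalJ S proj θ).val p v)))
        • S.ξ.val (proj p) ∧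
    θ.val p (nijTensor ((totalJ S proj θ).coord p) (center k p) u v) =
      Ω.val₂ (proj p) (dproj k m proj p u) (dproj k m proj p v)
        - Ω.val₂ (proj p) (dproj k m proj p ((totalJ S proj θ).val p u))
          (dproj k m proj p ((totalJ S proj θ).val p v)) := by
  have hN : IsNormalAt (S.φ.coord (proj p)) (S.ξ.coord (proj p)) (S.η.coord (proj p))
      (projCoord k m proj p (center k p)) := by
    rw [projCoord_self]; exact hS.isNormalAt (proj p)
  have key := nijTensor_lift hN ((h.bundle.contDiffAt_projCoord p).of_le (by norm_cast))
    (h.differentiableAt_coord_θ p) (h.differentiableAt_coord_totalJ hS p)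
    (h.eventually_totalJ_coord S p) (W := Ω.val₂ (proj p)) (fun u v ↦ by
      rw [h.curl_coord_θ hΩ, h.bundle.fderiv_projCoord]) u v
  rw [h.bundle.fderiv_projCoord, projCoord_self, VField.coord_self, θ.coord_self,
    EndField.coord_self] at key
  exact key

theorem totalJ_totalJ (h : IsCircleBundleWithConnection (m := m) proj θ)
    (S : AlmostContactMetric m N) (p : P) (u : EuclideanSpace ℝ (Fin k)) :
    (totalJ S proj θ).val p ((totalJ S proj θ).val p u) = -u := by
  apply h.eq_of_dproj_eq
  · rw [h.dproj_totalJ, h.dproj_totalJ, h.θ_totalJ, map_add, map_smul, S.val_φ_φ, S.val_φ_ξ,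
      smul_zero, map_neg]
    module
  · rw [h.θ_totalJ, h.dproj_totalJ, map_add, map_smul, S.val_η_φ, S.val_η_ξ, zero_add,
      smul_eq_mul, mul_one, map_neg]

theorem totalMetric_totalJ (h : IsCircleBundleWithConnection (m := m) proj θ)
    (S : AlmostContactMetric m N) (p : P) (u v : EuclideanSpace ℝ (Fin k)) :
    (totalMetric S proj θ).val p ((totalJ S proj θ).val p u) ((totalJ S proj θ).val p v) =
      (totalMetric S proj θ).val p u v := by
  rw [totalMetric_apply, totalMetric_apply, h.dproj_totalJ, h.dproj_totalJ, h.θ_totalJ,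
    h.θ_totalJ]
  change S.met.val (proj p) _ _ + _ = S.met.val (proj p) _ _ + _
  simp only [map_add, map_smul, add_apply, smul_apply, smul_eq_mul, S.val_met_φ_φ,
    S.val_met_ξ, S.val_met_ξ_right, S.val_η_φ, S.val_η_ξ]
  ring

/-- The algebraic conditions on `(J, h)` always hold, so only integrability matters. By
`nijTensor_totalJ` it is an algebraic condition on `Ω`, which is tested on horizontal and vertical
vectors. -/
theorem isHermitian_iff (h : IsCircleBundleWithConnection (m := m) proj θ)
    (hΩ : IsCurvature proj θ Ω) (hS : S.IsNormal) :
    IsHermitian (totalJ S proj θ) (totalMetric S proj θ) ↔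
      (∀ x u v, Ω.val₂ x (S.φ.val x u) (S.φ.val x v) = Ω.val₂ x u v) ∧
      ∀ x u, Ω.val₂ x (S.ξ.val x) u = 0 := by
  have hnij (p : P) {X Y : VField (𝓡 k) P} (hX : VField.DiffAt X p) (hY : VField.DiffAt Y p) :=
    nijenhuis_eq_nijTensor (h.differentiableAt_coord_totalJ hS p) hX hY
  constructor
  · intro hH
    have h0 (p : P) (u v : EuclideanSpace ℝ (Fin k)) :
        nijTensor ((totalJ S proj θ).coord p) (center k p) u v = 0 := by
      have h1 := hH.integrable _ _ p (diffAt_coordField p u) (diffAt_coordField p v)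
      rwa [hnij p (diffAt_coordField p u) (diffAt_coordField p v), coordField_self,
        coordField_self] at h1
    have h2 (p : P) (u v : EuclideanSpace ℝ (Fin k)) :
      Ω.val₂ (proj p) (dproj k m proj p u) (dproj k m proj p v)
        - Ω.val₂ (proj p) (dproj k m proj p ((totalJ S proj θ).val p u))
          (dproj k m proj p ((totalJ S proj θ).val p v)) = 0 := by
      rw [← (h.nijTensor_totalJ hΩ hS p u v).2, h0, map_zero]
    have h3 (p : P) (u v : EuclideanSpace ℝ (Fin k)) :
      Ω.val₂ (proj p) (dproj k m proj p ((totalJ S proj θ).val p u)) (dproj k m proj p v)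
        + Ω.val₂ (proj p) (dproj k m proj p u)
          (dproj k m proj p ((totalJ S proj θ).val p v)) = 0 := by
      have h4 := congrArg (S.η.val (proj p)) (h.nijTensor_totalJ hΩ hS p u v).1
      rw [h0, map_smul, S.val_η_ξ, map_zero, map_zero, smul_eq_mul, mul_one] at h4
      exact h4.symm
    constructor
    · intro x a b
      obtain ⟨p, rfl⟩ := h.bundle.surjective x
      -- On horizontal lifts `π_* J` acts as `φ`, so the `θ`-component of the Nijenhuis tensor gives
      -- the invariance of `Ω`.
      obtain ⟨u, hu, hu'⟩ := h.exists_lift p a 0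
      obtain ⟨v, hv, hv'⟩ := h.exists_lift p b 0
      have h5 := h2 p u v
      rw [h.dproj_totalJ, h.dproj_totalJ, hu, hv, hu', hv', zero_smul, add_zero, add_zero] at h5
      linarith
    · intro x b
      obtain ⟨p, rfl⟩ := h.bundle.surjective x
      -- `J` sends this vertical vector to the horizontal lift of `ξ`, which isolates `Ω(ξ, b)` in
      -- the base component.
      obtain ⟨u, hu, hu'⟩ := h.exists_lift p 0 1
      obtain ⟨v, hv, hv'⟩ := h.exists_lift p b 0
      have h5 := h3 p u v
      have h6 (w : EuclideanSpace ℝ (Fin m)) : Ω.val₂ (proj p) 0 w = 0 := by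
        rw [← zero_smul ℝ (0 : EuclideanSpace ℝ (Fin m)), DForm.val₂_smul_left, zero_mul]
      rw [h.dproj_totalJ, h.dproj_totalJ, hu, hv, hu', hv', map_zero, zero_add, one_smul, h6,
        add_zero] at h5
      exact h5
  · rintro ⟨hφ, hξ⟩
    have hξ' (x : N) (u) : Ω.val₂ x u (S.ξ.val x) = 0 := by
      rw [DForm.val₂_swap, hξ, neg_zero]
    have hφ' (x : N) (u v) : Ω.val₂ x (S.φ.val x u) v = -Ω.val₂ x u (S.φ.val x v) := by
      have := hφ x (S.φ.val x u) v
      rw [S.val_φ_φ, DForm.val₂_add_left, DForm.val₂_smul_left, hξ, DForm.val₂_neg_left] at this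
      linarith
    have h0 (p : P) (u v : EuclideanSpace ℝ (Fin k)) :
        nijTensor ((totalJ S proj θ).coord p) (center k p) u v = 0 := by
      have key := h.nijTensor_totalJ hΩ hS p u v
      simp only [h.dproj_totalJ, DForm.val₂_add_left, DForm.val₂_add_right, DForm.val₂_smul_left,
        DForm.val₂_smul_right, hξ, hξ', hφ, hφ', mul_zero, add_zero, neg_add_cancel, zero_smul,
        sub_self] at key
      exact h.eq_of_dproj_eq (key.1.trans (map_zero _).symm) (key.2.trans (map_zero _).symm)
    exact ⟨h.totalJ_totalJ S, h.totalMetric_totalJ S,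
      fun X Y p hX hY ↦ (hnij p hX hY).trans (h0 p _ _)⟩

end IsCircleBundleWithConnection

end TotalSpace

/-! ### Values of pullbacks and of 3-forms -/

section Values

variable {m : ℕ} {N : Type*} [TopologicalSpace N] [ChartedSpace (EuclideanSpace ℝ (Fin m)) N]

/-- The value of a 3-form on three vectors of the model space. -/
def DForm.val₃ (α : DForm (𝓡 m) N 3) (x : N) (u v w : EuclideanSpace ℝ (Fin m)) : ℝ :=
  α x ![u, v, w]

theorem DForm.inChart_val₂ (α : DForm (𝓡 m) N 2) (x : N) (y u v : EuclideanSpace ℝ (Fin m)) :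
    α.inChart x y ![u, v] =
      α.val₂ ((extChartAt (𝓡 m) x).symm y) (frame x y u) (frame x y v) :=
  compContinuousLinearMap_two (V := EuclideanSpace ℝ (Fin m)) (W := EuclideanSpace ℝ (Fin m))
    _ _ u v

theorem DForm.inChart_val₃ (α : DForm (𝓡 m) N 3) (x : N) (y u v w : EuclideanSpace ℝ (Fin m)) :
    α.inChart x y ![u, v, w] = α.val₃ ((extChartAt (𝓡 m) x).symm y) (frame x y u)
      (frame x y v) (frame x y w) :=
  compContinuousLinearMap_three (V := EuclideanSpace ℝ (Fin m)) (W := EuclideanSpace ℝ (Fin m))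
    _ _ u v w

variable {k : ℕ} {P : Type*} [TopologicalSpace P] [ChartedSpace (EuclideanSpace ℝ (Fin k)) P]

theorem DForm.pullback_val₂ (f : P → N) (α : DForm (𝓡 m) N 2) (p : P)
    (u v : EuclideanSpace ℝ (Fin k)) : (DForm.pullback f α).val₂ p u v =
      α.val₂ (f p) (dproj k m f p u) (dproj k m f p v) :=
  compContinuousLinearMap_two (V := EuclideanSpace ℝ (Fin k)) (W := EuclideanSpace ℝ (Fin m))
    _ _ u v

theorem EndField.act_val₃ (A : EndField (𝓡 m) N) (α : DForm (𝓡 m) N 3) (x : N)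
    (u v w : EuclideanSpace ℝ (Fin m)) :
    (A.act α).val₃ x u v w = α.val₃ x (A.val x u) (A.val x v) (A.val x w) :=
  compContinuousLinearMap_three (V := EuclideanSpace ℝ (Fin m)) (W := EuclideanSpace ℝ (Fin m))
    _ _ u v w

/-- The pullback of a field of covectors. -/
def Covector.pullback (f : P → N) (α : Covector (𝓡 m) N) : Covector (𝓡 k) P :=
  fun p ↦ α (f p) ∘L mfderiv (𝓡 k) (𝓡 m) f p

theorem Covector.toForm_pullback (f : P → N) (α : Covector (𝓡 m) N) :
    (Covector.pullback (k := k) f α).toForm = DForm.pullback f α.toForm := rfl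

theorem Covector.pullback_val (f : P → N) (α : Covector (𝓡 m) N) (p : P)
    (u : EuclideanSpace ℝ (Fin k)) :
    (Covector.pullback f α).val p u = α.val (f p) (dproj k m f p u) := rfl

theorem cons_cons_eta {V : Type*} (v : Fin 2 → V) : v = ![v 0, v 1] := by
  funext i; fin_cases i <;> rfl

theorem fundamentalForm_val₂ {h : BilinField (𝓡 k) P} {A : EndField (𝓡 k) P}
    (hA : ∀ p (u v : EuclideanSpace ℝ (Fin k)), h.val p u (A.val p v) = -h.val p v (A.val p u))
    (p : P) (u v : EuclideanSpace ℝ (Fin k)) :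
    (fundamentalForm h A).val₂ p u v = h.val p u (A.val p v) :=
  altForm_apply_of_skew (V := EuclideanSpace ℝ (Fin k)) _ (hA p) u v

end Values

namespace AlmostContactMetric

variable {m : ℕ} {N : Type*} [TopologicalSpace N]
  [ChartedSpace (EuclideanSpace ℝ (Fin m)) N] [IsManifold (𝓡 m) ∞ N]
  (S : AlmostContactMetric m N)

theorem fundForm_val₂ (x : N) (u v : EuclideanSpace ℝ (Fin m)) :
    S.fundForm.val₂ x u v = S.met.val x u (S.φ.val x v) :=
  fundamentalForm_val₂ S.val_met_φ_right x u v

theorem differentiableAt_fundForm (x : N) :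
    DifferentiableAt ℝ (S.fundForm.inChart x) (extChartAt (𝓡 m) x x) := by
  refine differentiableAt_alternating_of_apply fun v ↦ ?_
  have hg : DifferentiableAt ℝ (S.met.coord x) (extChartAt (𝓡 m) x x) :=
    (metric_diffAt S.g x).differentiableAt_coord
  have h1 := (hg.clm_apply (differentiableAt_const (v 0))).clm_apply
    ((S.differentiableAt_coord_φ x).clm_apply (differentiableAt_const (v 1)))
  refine h1.congr_of_eventuallyEq ?_
  filter_upwards [target_mem_nhds x] with y hy
  rw [cons_cons_eta v, DForm.inChart_val₂, S.fundForm_val₂, ← frame_end_coord S.φ hy rfl]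
  rfl

end AlmostContactMetric

/-! ### The fundamental form of the total space and its differential -/

section TotalSpace

variable {k m : ℕ}
  {P : Type*} [TopologicalSpace P] [ChartedSpace (EuclideanSpace ℝ (Fin k)) P]
  {N : Type*} [TopologicalSpace N] [ChartedSpace (EuclideanSpace ℝ (Fin m)) N]
  [MulAction Circle P] [IsManifold (𝓡 m) ∞ N] [IsManifold (𝓡 k) ∞ P]

namespace IsCircleBundleWithConnection

variable {proj : P → N} {θ : Covector (𝓡 k) P} {S : AlmostContactMetric m N}
  {Ω : DForm (𝓡 m) N 2}

theorem totalMetric_swap (S : AlmostContactMetric m N) (p : P)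
    (u v : EuclideanSpace ℝ (Fin k)) :
    (totalMetric S proj θ).val p u v = (totalMetric S proj θ).val p v u := by
  rw [totalMetric_apply, totalMetric_apply]
  change S.met.val (proj p) _ _ + _ = S.met.val (proj p) _ _ + _
  rw [S.val_met_swap, mul_comm]

theorem totalMetric_totalJ_right (h : IsCircleBundleWithConnection (m := m) proj θ)
    (S : AlmostContactMetric m N) (p : P) (u v : EuclideanSpace ℝ (Fin k)) :
    (totalMetric S proj θ).val p u ((totalJ S proj θ).val p v) =
      -(totalMetric S proj θ).val p v ((totalJ S proj θ).val p u) := by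
  rw [← h.totalMetric_totalJ S p u, h.totalJ_totalJ, map_neg, totalMetric_swap]

/-- The fundamental form of the total space is `π^*ω + π^*η ∧ θ`. -/
theorem fundamentalForm_total_val₂ (h : IsCircleBundleWithConnection (m := m) proj θ)
    (S : AlmostContactMetric m N) (p : P) (u v : EuclideanSpace ℝ (Fin k)) :
    (fundamentalForm (totalMetric S proj θ) (totalJ S proj θ)).val₂ p u v =
      (DForm.pullback proj S.fundForm).val₂ p u v
        + ((Covector.pullback proj S.η).val p u * θ.val p v
          - (Covector.pullback proj S.η).val p v * θ.val p u) := by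
  rw [fundamentalForm_val₂ (h.totalMetric_totalJ_right S), DForm.pullback_val₂, S.fundForm_val₂,
    totalMetric_apply, h.dproj_totalJ, h.θ_totalJ, Covector.pullback_val, Covector.pullback_val]
  change S.met.val (proj p) _ _ + _ = S.met.val (proj p) _ _ + _
  rw [map_add, map_smul, S.val_met_ξ_right, smul_eq_mul]
  ring

theorem differentiableAt_pullback_η (h : IsCircleBundleWithConnection (m := m) proj θ) (p : P) :
    DifferentiableAt ℝ ((Covector.pullback proj S.η).toForm.inChart p) (center k p) :=
  DForm.differentiableAt_inChart_pullback h.bundle.smooth_proj S.η.toForm p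
    (S.smooth_η.differentiableAt (proj p))

theorem curl_pullback_η (h : IsCircleBundleWithConnection (m := m) proj θ) (p : P)
    (u v : EuclideanSpace ℝ (Fin k)) :
    curl (Covector.coord (Covector.pullback proj S.η) p) (center k p) u v =
      (DForm.pullback proj S.dη).val₂ p u v := by
  rw [Covector.curl_coord (h.differentiableAt_pullback_η p), Covector.toForm_pullback,
    DForm.d_pullback h.bundle.smooth_proj S.η.toForm p (S.smooth_η.differentiableAt (proj p))]
  rfl

/-- `dF = π^*dη ∧ θ - π^*η ∧ π^*Ω`. -/
theorem d_fundamentalForm_total (h : IsCircleBundleWithConnection (m := m) proj θ)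
    (hΩ : IsCurvature proj θ Ω) (hS : S.IsQuasiSasakian) (p : P)
    (u v w : EuclideanSpace ℝ (Fin k)) :
    (fundamentalForm (totalMetric S proj θ) (totalJ S proj θ)).d.val₃ p u v w =
      ((DForm.pullback proj S.dη).val₂ p u v * θ.val p w
        - (DForm.pullback proj S.dη).val₂ p u w * θ.val p v
        + (DForm.pullback proj S.dη).val₂ p v w * θ.val p u)
      - ((DForm.pullback proj Ω).val₂ p u v * (Covector.pullback proj S.η).val p w
        - (DForm.pullback proj Ω).val₂ p u w * (Covector.pullback proj S.η).val p v
        + (DForm.pullback proj Ω).val₂ p v w * (Covector.pullback proj S.η).val p u) := by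
  have hω := DForm.differentiableAt_inChart_pullback h.bundle.smooth_proj S.fundForm p
    (S.differentiableAt_fundForm (proj p))
  -- The only place where closedness of `ω` enters: `dF` reduces to `d(π^*η ∧ θ)`.
  have hdω : extDeriv ((DForm.pullback proj S.fundForm).inChart p) (center k p) = 0 := by
    rw [← DForm.d_eq_extDeriv, DForm.d_pullback h.bundle.smooth_proj _ _
      (S.differentiableAt_fundForm (proj p))]
    unfold DForm.pullback
    rw [hS.closed]
    rfl
  have key := extDeriv_add_wedge
    (F := (fundamentalForm (totalMetric S proj θ) (totalJ S proj θ)).inChart p)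
    (a := Covector.coord (Covector.pullback proj S.η) p) (b := θ.coord p) hω
    (Covector.differentiableAt_coord (h.differentiableAt_pullback_η p))
    (h.differentiableAt_coord_θ p) (Filter.Eventually.of_forall fun y u v ↦ by
      rw [DForm.inChart_val₂, DForm.inChart_val₂, h.fundamentalForm_total_val₂]
      rfl) u v w
  rw [hdω, ← DForm.d_eq_extDeriv] at key
  refine key.trans ?_
  simp only [h.curl_pullback_η, h.curl_coord_θ hΩ, Covector.coord_self]
  simp only [DForm.pullback_val₂]
  change (0 : ℝ) + _ - _ = _
  rw [zero_add]
  rfl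

end IsCircleBundleWithConnection

end TotalSpace

/-! ### The torsion form `J dF` and the SKT condition -/

section TotalSpace

variable {k m : ℕ}
  {P : Type*} [TopologicalSpace P] [ChartedSpace (EuclideanSpace ℝ (Fin k)) P]
  {N : Type*} [TopologicalSpace N] [ChartedSpace (EuclideanSpace ℝ (Fin m)) N]
  [MulAction Circle P] [IsManifold (𝓡 m) ∞ N] [IsManifold (𝓡 k) ∞ P]

/-- A 2-form on an almost contact manifold is basic of type `(1,1)` if it is annihilated by `ξ`
and preserved by `φ`. -/
structure AlmostContactMetric.IsBasicOneOne (S : AlmostContactMetric m N) (Ω : DForm (𝓡 m) N 2) :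
    Prop where
  φ_φ : ∀ x u v, Ω.val₂ x (S.φ.val x u) (S.φ.val x v) = Ω.val₂ x u v
  ξ_left : ∀ x u, Ω.val₂ x (S.ξ.val x) u = 0

theorem AlmostContactMetric.IsNormal.isBasicOneOne_dη {S : AlmostContactMetric m N}
    (hS : S.IsNormal) : S.IsBasicOneOne S.dη :=
  ⟨fun x u v ↦ hS.dη_φ_φ x u v, fun x u ↦ hS.dη_ξ_left x u⟩

namespace IsCircleBundleWithConnection

variable {proj : P → N} {θ : Covector (𝓡 k) P} {S : AlmostContactMetric m N}
  {Ω : DForm (𝓡 m) N 2}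

/-- `π_* J` and `φ π_*` differ by a multiple of `ξ`, which a form annihilated by `ξ` does not see.
-/
theorem val₂_totalJ (h : IsCircleBundleWithConnection (m := m) proj θ)
    (hΩ : S.IsBasicOneOne Ω) (p : P) (u v : EuclideanSpace ℝ (Fin k)) :
    (DForm.pullback proj Ω).val₂ p ((totalJ S proj θ).val p u) ((totalJ S proj θ).val p v) =
      (DForm.pullback proj Ω).val₂ p u v := by
  have hξ (x : N) (u) : Ω.val₂ x u (S.ξ.val x) = 0 := by
    rw [DForm.val₂_swap, hΩ.ξ_left, neg_zero]
  simp only [DForm.pullback_val₂, h.dproj_totalJ, DForm.val₂_add_left, DForm.val₂_add_right,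
    DForm.val₂_smul_left, DForm.val₂_smul_right, hΩ.ξ_left, hξ, hΩ.φ_φ, mul_zero, add_zero]

/-- `J dF = -π^*(dη ∧ η) - π^*Ω ∧ θ`. -/
theorem act_d_fundamentalForm_total (h : IsCircleBundleWithConnection (m := m) proj θ)
    (hΩ : IsCurvature proj θ Ω) (hS : S.IsQuasiSasakian) (hb : S.IsBasicOneOne Ω) (p : P)
    (u v w : EuclideanSpace ℝ (Fin k)) :
    ((totalJ S proj θ).act
        (fundamentalForm (totalMetric S proj θ) (totalJ S proj θ)).d).val₃ p u v w =
      -((DForm.pullback proj S.dη).val₂ p u v * (Covector.pullback proj S.η).val p w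
        - (DForm.pullback proj S.dη).val₂ p u w * (Covector.pullback proj S.η).val p v
        + (DForm.pullback proj S.dη).val₂ p v w * (Covector.pullback proj S.η).val p u)
      - ((DForm.pullback proj Ω).val₂ p u v * θ.val p w
        - (DForm.pullback proj Ω).val₂ p u w * θ.val p v
        + (DForm.pullback proj Ω).val₂ p v w * θ.val p u) := by
  -- `J` rotates the pair: `π^*η ∘ J = θ`, while `θ ∘ J = -π^*η`. The two halves of `dF` therefore
  -- trade their 1-form factors.
  have hη (u : EuclideanSpace ℝ (Fin k)) :
      (Covector.pullback proj S.η).val p ((totalJ S proj θ).val p u) = θ.val p u := by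
    rw [Covector.pullback_val, h.dproj_totalJ, map_add, map_smul, S.val_η_φ, S.val_η_ξ, zero_add,
      smul_eq_mul, mul_one]
  simp only [EndField.act_val₃, h.d_fundamentalForm_total hΩ hS, h.val₂_totalJ hb,
    h.val₂_totalJ hS.normal.isBasicOneOne_dη, hη, h.θ_totalJ, Covector.pullback_val]
  ring

/-- `d(J dF) = -π^*(dη ∧ dη + Ω ∧ Ω)`. -/
theorem d_act_d_fundamentalForm_total (h : IsCircleBundleWithConnection (m := m) proj θ)
    (hΩ : IsCurvature proj θ Ω) (hS : S.IsQuasiSasakian) (hb : S.IsBasicOneOne Ω)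
    (hΩs : Ω.IsSmooth) (hΩd : ∀ x : N, Ω.d x = 0) (p : P)
    (v : Fin (2 + 2) → EuclideanSpace ℝ (Fin k)) :
    ((totalJ S proj θ).act
        (fundamentalForm (totalMetric S proj θ) (totalJ S proj θ)).d).d p v =
      -wedge (S.dη (proj p)) (S.dη (proj p)) (fun i ↦ dproj k m proj p (v i))
        - wedge (Ω (proj p)) (Ω (proj p)) (fun i ↦ dproj k m proj p (v i)) := by
  have hdη := S.smooth_η.differentiableAt_d (proj p)
  have hΩ' := hΩs.differentiableAt (proj p)
  have dA : extDeriv ((DForm.pullback proj S.dη).inChart p) (center k p) = 0 := by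
    rw [← DForm.d_eq_extDeriv, DForm.d_pullback h.bundle.smooth_proj S.dη p hdη]
    unfold DForm.pullback AlmostContactMetric.dη
    rw [DForm.d_d S.smooth_η]
    rfl
  have dB : extDeriv ((DForm.pullback proj Ω).inChart p) (center k p) = 0 := by
    rw [← DForm.d_eq_extDeriv, DForm.d_pullback h.bundle.smooth_proj Ω p hΩ']
    unfold DForm.pullback
    rw [hΩd]
    rfl
  -- Here `A = π^*dη` is the differential of `a = π^*η`, and `B = π^*Ω` is the differential of `b =
  -- θ`.
  have key := extDeriv_wedge_add_wedge
    (γ := ((totalJ S proj θ).act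
        (fundamentalForm (totalMetric S proj θ) (totalJ S proj θ)).d).inChart p)
    (A := (DForm.pullback proj S.dη).inChart p) (B := (DForm.pullback proj Ω).inChart p)
    (a := Covector.coord (Covector.pullback proj S.η) p) (b := θ.coord p)
    (DForm.differentiableAt_inChart_pullback h.bundle.smooth_proj S.dη p hdη)
    (DForm.differentiableAt_inChart_pullback h.bundle.smooth_proj Ω p hΩ')
    (Covector.differentiableAt_coord (h.differentiableAt_pullback_η p))
    (h.differentiableAt_coord_θ p) (Filter.Eventually.of_forall fun y u v w ↦ by
      rw [DForm.inChart_val₃, h.act_d_fundamentalForm_total hΩ hS hb]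
      simp only [DForm.inChart_val₂]
      rfl) dA dB (fun u v ↦ by
        rw [h.curl_pullback_η, DForm.inChart_self]
        rfl)
      (fun u v ↦ by
        rw [h.curl_coord_θ hΩ, DForm.inChart_self, ← DForm.pullback_val₂]
        rfl) v
  rw [← DForm.d_eq_extDeriv, DForm.inChart_self, DForm.inChart_self] at key
  exact key

theorem isSKT_iff (h : IsCircleBundleWithConnection (m := m) proj θ)
    (hΩ : IsCurvature proj θ Ω) (hS : S.IsQuasiSasakian)
    (hΩs : Ω.IsSmooth) (hΩd : ∀ x : N, Ω.d x = 0) :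
    IsSKT (totalJ S proj θ) (totalMetric S proj θ) ↔ S.IsBasicOneOne Ω ∧
      ∀ (x : N) (v : Fin (2 + 2) → EuclideanSpace ℝ (Fin m)),
        wedge (V := EuclideanSpace ℝ (Fin m)) (S.dη x) (S.dη x) v =
          -wedge (V := EuclideanSpace ℝ (Fin m)) (Ω x) (Ω x) v := by
  constructor
  · intro hK
    have hb : S.IsBasicOneOne Ω :=
      ⟨((h.isHermitian_iff hΩ hS.normal).1 hK.hermitian).1,
        ((h.isHermitian_iff hΩ hS.normal).1 hK.hermitian).2⟩
    refine ⟨hb, fun x v ↦ ?_⟩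
    obtain ⟨p, rfl⟩ := h.bundle.surjective x
    -- Every 4-tuple on the base lifts, so a 4-form on `N` vanishes as soon as its pullback does.
    choose w hw using fun i ↦ h.bundle.dproj_surjective p (v i)
    have h1 := h.d_act_d_fundamentalForm_total hΩ hS hb hΩs hΩd p w
    rw [hK.closed p] at h1
    have h2 : (fun i ↦ dproj k m proj p (w i)) = v := funext hw
    rw [h2] at h1
    have h3 (a b : ℝ) (hab : 0 = -a - b) : a = -b := by linarith
    exact h3 _ _ h1
  · rintro ⟨hb, hw⟩
    refine ⟨(h.isHermitian_iff hΩ hS.normal).2 ⟨hb.φ_φ, hb.ξ_left⟩, fun p ↦ ?_⟩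
    ext v
    refine (h.d_act_d_fundamentalForm_total hΩ hS hb hΩs hΩd p v).trans ?_
    have h1 (a b : ℝ) (hab : a = -b) : -a - b = 0 := by linarith
    exact h1 _ _ (hw (proj p) fun i ↦ dproj k m proj p (v i))

end IsCircleBundleWithConnection

end TotalSpace

/-! ### The torsion of a Bismut connection -/

section Bismut

variable {k : ℕ} {P : Type*} [TopologicalSpace P] [ChartedSpace (EuclideanSpace ℝ (Fin k)) P]
  [IsManifold (𝓡 k) ∞ P]

/-- The value of a covariant derivative, as a vector of the model space. -/
def covDerivVal (nabla : CovariantDerivative (𝓡 k) (EuclideanSpace ℝ (Fin k))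
    (TangentSpace (𝓡 k) : P → Type _)) (Y : VField (𝓡 k) P) (p : P)
    (u : EuclideanSpace ℝ (Fin k)) : EuclideanSpace ℝ (Fin k) := nabla Y p u

/-- The value of the torsion, as a vector of the model space. -/
def torsionVal (nabla : CovariantDerivative (𝓡 k) (EuclideanSpace ℝ (Fin k))
    (TangentSpace (𝓡 k) : P → Type _)) (p : P) (u v : EuclideanSpace ℝ (Fin k)) :
    EuclideanSpace ℝ (Fin k) := nabla.torsion p u v

/-- The value of the Lie bracket, as a vector of the model space. -/
def bracketVal (X Y : VField (𝓡 k) P) (p : P) : EuclideanSpace ℝ (Fin k) :=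
  VectorField.mlieBracket (𝓡 k) X Y p

variable {nabla : CovariantDerivative (𝓡 k) (EuclideanSpace ℝ (Fin k))
  (TangentSpace (𝓡 k) : P → Type _)} {J : EndField (𝓡 k) P} {h : BilinField (𝓡 k) P}

theorem torsionVal_apply {X Y : VField (𝓡 k) P} {p : P} (hX : VField.DiffAt X p)
    (hY : VField.DiffAt Y p) : torsionVal nabla p (X.val p) (Y.val p) =
      covDerivVal nabla Y p (X.val p) - covDerivVal nabla X p (Y.val p) - bracketVal X Y p :=
  nabla.torsion_apply hX hY

theorem torsionVal_swap (p : P) (u v : EuclideanSpace ℝ (Fin k)) :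
    torsionVal nabla p u v = -torsionVal nabla p v u :=
  nabla.torsion_antisymm u v

theorem coordField_val (p : P) (u : EuclideanSpace ℝ (Fin k)) :
    VField.val (coordField p u) p = u := coordField_self p u

theorem bracketVal_coordField (p : P) (u v : EuclideanSpace ℝ (Fin k)) :
    bracketVal (coordField p u) (coordField p v) p = 0 := by
  have h1 (w : EuclideanSpace ℝ (Fin k)) :
      fderiv ℝ (VField.coord (coordField p w) p) (extChartAt (𝓡 k) p p) = 0 := by
    have h2 : VField.coord (coordField p w) p =ᶠ[𝓝 (extChartAt (𝓡 k) p p)] fun _ ↦ w := by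
      filter_upwards [target_mem_nhds p] with y hy using coord_coordField w hy
    rw [h2.fderiv_eq, fderiv_fun_const]
    rfl
  unfold bracketVal
  rw [mlieBracket_eq_coord, h1, h1]
  exact sub_zero _

/-- The torsion of a connection preserving an integrable complex structure has no `(0,2)` part. -/
theorem torsionVal_of_preservesEnd (hJ : PreservesEnd J nabla) {p : P}
    (hJJ : ∀ u, J.val p (J.val p u) = -u)
    (hd : DifferentiableAt ℝ (J.coord p) (extChartAt (𝓡 k) p p))
    (hN : ∀ X Y : VField (𝓡 k) P, VField.DiffAt X p → VField.DiffAt Y p →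
      nijenhuis J X Y p = 0) (u v : EuclideanSpace ℝ (Fin k)) :
    torsionVal nabla p (J.val p u) (J.val p v) - J.val p (torsionVal nabla p (J.val p u) v)
      - J.val p (torsionVal nabla p u (J.val p v)) = torsionVal nabla p u v := by
  have hu := diffAt_coordField p u
  have hv := diffAt_coordField p v
  let JX (w : EuclideanSpace ℝ (Fin k)) : VField (𝓡 k) P := fun q ↦ J q (coordField p w q)
  have hJX' (w) : VField.DiffAt (JX w) p := diffAt_end_apply hd (diffAt_coordField p w)
  have hJX (w) : (JX w).val p = J.val p w :=
    congrArg (J.val p) (coordField_val p w)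
  have hc (w s : EuclideanSpace ℝ (Fin k)) : covDerivVal nabla (JX w) p s =
      J.val p (covDerivVal nabla (coordField p w) p s) := hJ _ p s (diffAt_coordField p w)
  have t1 := torsionVal_apply (nabla := nabla) hu hv
  have t2 := torsionVal_apply (nabla := nabla) (hJX' u) hv
  have t3 := torsionVal_apply (nabla := nabla) hu (hJX' v)
  have t4 := torsionVal_apply (nabla := nabla) (hJX' u) (hJX' v)
  simp only [hJX, hc, coordField_val] at t1 t2 t3 t4
  have hN' : J.val p (J.val p (bracketVal (coordField p u) (coordField p v) p))
    + bracketVal (JX u) (JX v) p - J.val p (bracketVal (JX u) (coordField p v) p)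
    - J.val p (bracketVal (coordField p u) (JX v) p) = 0 := hN _ _ hu hv
  rw [t1, t2, t3, t4]
  simp only [map_sub, hJJ] at hN' ⊢
  -- Since `∇` commutes with `J`, all covariant derivatives cancel, and the brackets left over form
  -- the Nijenhuis torsion.
  linear_combination (norm := module) -hN'

/-- The exterior derivative of the fundamental form in terms of the torsion of a connection
preserving the metric and the complex structure. -/
theorem d_fundamentalForm_eq_torsion (hm : PreservesMetric h nabla) (hJ : PreservesEnd J nabla)
    (hJh : ∀ p (u v : EuclideanSpace ℝ (Fin k)), h.val p u (J.val p v) = -h.val p v (J.val p u))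
    {p : P} (hd : DifferentiableAt ℝ (J.coord p) (extChartAt (𝓡 k) p p))
    (hF : DifferentiableAt ℝ ((fundamentalForm h J).inChart p) (extChartAt (𝓡 k) p p))
    (u v w : EuclideanSpace ℝ (Fin k)) :
    (fundamentalForm h J).d.val₃ p u v w = h.val p (torsionVal nabla p u v) (J.val p w)
      + h.val p (torsionVal nabla p v w) (J.val p u)
      + h.val p (torsionVal nabla p w u) (J.val p v) := by
  have key (u v w : EuclideanSpace ℝ (Fin k)) :
      fderiv ℝ (fun y ↦ (fundamentalForm h J).inChart p y ![v, w]) (extChartAt (𝓡 k) p p) u =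
        h.val p (covDerivVal nabla (coordField p v) p u) (J.val p w)
          - h.val p (covDerivVal nabla (coordField p w) p u) (J.val p v) := by
    have hv := diffAt_coordField p v
    have hw := diffAt_coordField p w
    have hJw := diffAt_end_apply hd hw
    have h1 := hm _ _ p u hv hJw
    have h2 : (fun y ↦ h ((extChartAt (𝓡 k) p).symm y)
        (coordField p v ((extChartAt (𝓡 k) p).symm y))
        (J _ (coordField p w ((extChartAt (𝓡 k) p).symm y)))) =ᶠ[𝓝 (extChartAt (𝓡 k) p p)]
        fun y ↦ (fundamentalForm h J).inChart p y ![v, w] := by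
      filter_upwards [target_mem_nhds p] with y hy
      rw [DForm.inChart_val₂, fundamentalForm_val₂ hJh, coordField_symm v hy,
        coordField_symm w hy]
      rfl
    have h3 : MDifferentiableAt (𝓡 k) 𝓘(ℝ, ℝ)
        (fun q ↦ h q (coordField p v q) (J q (coordField p w q))) p := by
      rw [mdifferentiableAt_iff_comp_symm]
      exact (differentiableAt_alternating_apply hF ![v, w]).congr_of_eventuallyEq h2
    rw [mvfderiv_eq_fderiv h3, h2.fderiv_eq] at h1
    refine h1.trans ?_
    have h4 : nabla (fun q ↦ J q (coordField p w q)) p u =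
      J.val p (covDerivVal nabla (coordField p w) p u) := hJ _ p u hw
    rw [h4]
    change h.val p (covDerivVal nabla (coordField p v) p u)
        (J.val p (VField.val (coordField p w) p)) +
      h.val p (VField.val (coordField p v) p)
        (J.val p (covDerivVal nabla (coordField p w) p u)) = _
    rw [coordField_val, coordField_val, hJh p v]
    ring
  -- Coordinate fields commute at the centre, so antisymmetrizing `∇` on them gives the torsion
  -- alone.
  have ht (u v : EuclideanSpace ℝ (Fin k)) : torsionVal nabla p u v =
      covDerivVal nabla (coordField p v) p u - covDerivVal nabla (coordField p u) p v := by
    have h1 := torsionVal_apply (nabla := nabla) (diffAt_coordField p u) (diffAt_coordField p v)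
    rwa [bracketVal_coordField, sub_zero, coordField_val, coordField_val] at h1
  have h0 : (fundamentalForm h J).d.val₃ p u v w =
      extDeriv ((fundamentalForm h J).inChart p) (extChartAt (𝓡 k) p p) ![u, v, w] := by
    rw [← DForm.d_eq_extDeriv]
    rfl
  rw [h0, extDeriv_two_apply hF, key, key, key, ht, ht, ht]
  simp only [map_sub, sub_apply]
  ring

/-- The torsion form of a Bismut connection is `-J dF`. -/
theorem IsBismut.torsion_eq (hB : IsBismut J h nabla) (hH : IsHermitian J h)
    (hs : ∀ p (u v : EuclideanSpace ℝ (Fin k)), h.val p u v = h.val p v u)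
    {p : P} (hd : DifferentiableAt ℝ (J.coord p) (extChartAt (𝓡 k) p p))
    (hF : DifferentiableAt ℝ ((fundamentalForm h J).inChart p) (extChartAt (𝓡 k) p p))
    (u v w : EuclideanSpace ℝ (Fin k)) :
    h.val p (torsionVal nabla p u v) w = -(J.act (fundamentalForm h J).d).val₃ p u v w := by
  have hJJ (p) (u : EuclideanSpace ℝ (Fin k)) : J.val p (J.val p u) = -u := hH.sq p u
  have hc (p) (u v : EuclideanSpace ℝ (Fin k)) :
    h.val p (J.val p u) (J.val p v) = h.val p u v := hH.compat p u v
  have hJh (p) (u v : EuclideanSpace ℝ (Fin k)) :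
      h.val p u (J.val p v) = -h.val p v (J.val p u) := by
    rw [← hc p u, hJJ, map_neg, hs]
  have hsk (u v w : EuclideanSpace ℝ (Fin k)) : h.val p (torsionVal nabla p u v) w =
    -h.val p (torsionVal nabla p u w) v := hB.skew p u v w
  have hsw (u v w : EuclideanSpace ℝ (Fin k)) : h.val p (torsionVal nabla p u v) w =
      -h.val p (torsionVal nabla p v u) w := by
    rw [torsionVal_swap, map_neg, neg_apply]
  have hcyc (u v w : EuclideanSpace ℝ (Fin k)) : h.val p (torsionVal nabla p u v) w =
      h.val p (torsionVal nabla p v w) u := by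
    rw [hsw, hsk, neg_neg]
  rw [EndField.act_val₃, d_fundamentalForm_eq_torsion hB.metric hB.complex hJh hd hF]
  have h1 := congrArg (fun a ↦ h.val p a w) (torsionVal_of_preservesEnd hB.complex (hJJ p) hd
    (fun X Y hX hY ↦ hH.integrable X Y p hX hY) u v)
  have h2 (a : EuclideanSpace ℝ (Fin k)) : h.val p (J.val p a) w = -h.val p a (J.val p w) := by
    rw [hs, hJh, neg_inj]
  simp only [map_sub, sub_apply, h2] at h1
  simp only [hJJ, map_neg]
  -- For the 3-form `c = h(T(·,·),·)`, integrability reads `c(u,v,w) = c(Ju,Jv,w) + c(Ju,v,Jw) +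
  -- c(u,Jv,Jw)`. By cyclicity and `J² = -1` the right-hand side is `-dF(Ju,Jv,Jw)`.
  rw [← h1, hcyc u (J.val p v) (J.val p w), ← hcyc (J.val p w) (J.val p u) v]
  ring

theorem koszul_val (hm : PreservesMetric h nabla)
    (hs : ∀ (p : P) (u v : TangentSpace (𝓡 k) p), h p u v = h p v u)
    {X Y Z : VField (𝓡 k) P} {x : P} (hX : VField.DiffAt X x) (hY : VField.DiffAt Y x)
    (hZ : VField.DiffAt Z x) :
    2 * h.val x (covDerivVal nabla Y x (X.val x)) (Z.val x) =
      mvfderiv (𝓡 k) (fun p ↦ h p (Y p) (Z p)) x (X.val x)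
      + mvfderiv (𝓡 k) (fun p ↦ h p (X p) (Z p)) x (Y.val x)
      - mvfderiv (𝓡 k) (fun p ↦ h p (X p) (Y p)) x (Z.val x)
      + h.val x (bracketVal X Y x) (Z.val x) - h.val x (bracketVal X Z x) (Y.val x)
      - h.val x (bracketVal Y Z x) (X.val x)
      + h.val x (torsionVal nabla x (X.val x) (Y.val x)) (Z.val x)
      - h.val x (torsionVal nabla x (X.val x) (Z.val x)) (Y.val x)
      - h.val x (torsionVal nabla x (Y.val x) (Z.val x)) (X.val x) :=
  koszul hm hs hX hY hZ

end Bismut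

/-! ### The connection with torsion `dη ∧ η` -/

namespace AlmostContactMetric

variable {m : ℕ} {N : Type*} [TopologicalSpace N]
  [ChartedSpace (EuclideanSpace ℝ (Fin m)) N] [IsManifold (𝓡 m) ∞ N]
  (S : AlmostContactMetric m N)

/-- The 3-form `dη ∧ η`. -/
def torsionForm (x : N) (u v w : EuclideanSpace ℝ (Fin m)) : ℝ :=
  S.dη.val₂ x u v * S.η.val x w - S.dη.val₂ x u w * S.η.val x v + S.dη.val₂ x v w * S.η.val x u

theorem wedge_dη_η (x : N) (u v w : TangentSpace (𝓡 m) x) :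
    wedge (S.dη x) (S.η.toForm x) ![u, v, w] = S.torsionForm x u v w :=
  wedge_two_one_apply (S.dη x) (S.η x) u v w

theorem exists_connection_torsionForm :
    ∃ nablac : CovariantDerivative (𝓡 m) (EuclideanSpace ℝ (Fin m))
        (TangentSpace (𝓡 m) : N → Type _),
      S.IsCanonicalConnection nablac ∧ S.IsMetricWithTorsion nablac := by
  obtain ⟨nablag, nabla, hg, hn, hm, ht⟩ := exists_connection_with_torsion S.g
    (c := S.torsionForm)
    (fun x v w ↦ ⟨fun a b ↦ by
        simp only [torsionForm, DForm.val₂_add_left, map_add]; ring,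
      fun a b ↦ by simp only [torsionForm, DForm.val₂_smul_left, map_smul, smul_eq_mul]; ring⟩)
    (fun x v w ↦ ⟨fun a b ↦ by
        simp only [torsionForm, DForm.val₂_add_left, DForm.val₂_add_right, map_add]; ring,
      fun a b ↦ by
        simp only [torsionForm, DForm.val₂_smul_left, DForm.val₂_smul_right, map_smul,
          smul_eq_mul]
        ring⟩)
    (fun x v w ↦ ⟨fun a b ↦ by
        simp only [torsionForm, DForm.val₂_add_right, map_add]; ring,
      fun a b ↦ by simp only [torsionForm, DForm.val₂_smul_right, map_smul, smul_eq_mul]; ring⟩)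
    (fun x u v w ↦ by rw [torsionForm, torsionForm, S.dη.val₂_swap x u v]; ring)
    (fun x u v w ↦ by rw [torsionForm, torsionForm, S.dη.val₂_swap x v w]; ring)
  refine ⟨nabla, ⟨nablag, hg, fun Y x u w _ ↦ ?_⟩, hm, fun x u v w ↦ ?_⟩
  · rw [hn Y x u w, S.wedge_dη_η]
  · rw [ht, S.wedge_dη_η]

end AlmostContactMetric

/-! ### The Bismut connection on horizontal lifts -/

section TotalSpace

variable {k m : ℕ}
  {P : Type*} [TopologicalSpace P] [ChartedSpace (EuclideanSpace ℝ (Fin k)) P]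
  {N : Type*} [TopologicalSpace N] [ChartedSpace (EuclideanSpace ℝ (Fin m)) N]
  [MulAction Circle P] [IsManifold (𝓡 m) ∞ N] [IsManifold (𝓡 k) ∞ P]

theorem mvfderiv_of_eventuallyEq_comp {proj : P → N} {p : P}
    (hproj : MDifferentiableAt (𝓡 k) (𝓡 m) proj p) {Φ : P → ℝ} {G : N → ℝ}
    (hG : MDifferentiableAt (𝓡 m) 𝓘(ℝ, ℝ) G (proj p)) (hΦ : Φ =ᶠ[𝓝 p] fun q ↦ G (proj q))
    (u : EuclideanSpace ℝ (Fin k)) :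
    mvfderiv (𝓡 k) Φ p u = mvfderiv (𝓡 m) G (proj p) (dproj k m proj p u) := by
  refine Eq.trans ?_ (mvfderiv_comp_apply p hG hproj u)
  have h1 := hΦ.mfderiv_eq (I := 𝓡 k) (I' := 𝓘(ℝ, ℝ))
  exact congrArg (fun L : EuclideanSpace ℝ (Fin k) →L[ℝ] ℝ ↦ L u) h1

namespace IsCircleBundleWithConnection

variable {proj : P → N} {θ : Covector (𝓡 k) P} {S : AlmostContactMetric m N}
  {Ω : DForm (𝓡 m) N 2}

theorem differentiableAt_fundamentalForm_total
    (h : IsCircleBundleWithConnection (m := m) proj θ) (S : AlmostContactMetric m N) (p : P) :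
    DifferentiableAt ℝ ((fundamentalForm (totalMetric S proj θ) (totalJ S proj θ)).inChart p)
      (center k p) :=
  differentiableAt_add_wedge (DForm.differentiableAt_inChart_pullback h.bundle.smooth_proj
      S.fundForm p (S.differentiableAt_fundForm (proj p)))
    (Covector.differentiableAt_coord (h.differentiableAt_pullback_η (S := S) p))
    (h.differentiableAt_coord_θ p) (Filter.Eventually.of_forall fun y u v ↦ by
      rw [DForm.inChart_val₂, DForm.inChart_val₂, h.fundamentalForm_total_val₂]
      rfl)

/-- The Bismut torsion is `-J dF = π^*(dη ∧ η) + π^*Ω ∧ θ`, and the second term vanishes on `ker θ`.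
-/
theorem torsion_bismut_horizontal (h : IsCircleBundleWithConnection (m := m) proj θ)
    (hΩ : IsCurvature proj θ Ω) (hS : S.IsQuasiSasakian)
    (hH : IsHermitian (totalJ S proj θ) (totalMetric S proj θ))
    {nabla : CovariantDerivative (𝓡 k) (EuclideanSpace ℝ (Fin k))
      (TangentSpace (𝓡 k) : P → Type _)}
    (hB : IsBismut (totalJ S proj θ) (totalMetric S proj θ) nabla) (p : P)
    {u v w : EuclideanSpace ℝ (Fin k)} (hu : θ.val p u = 0) (hv : θ.val p v = 0)
    (hw : θ.val p w = 0) :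
    (totalMetric S proj θ).val p (torsionVal nabla p u v) w =
      S.torsionForm (proj p) (dproj k m proj p u) (dproj k m proj p v) (dproj k m proj p w) := by
  have hb := (h.isHermitian_iff hΩ hS.normal).1 hH
  rw [hB.torsion_eq hH (fun p ↦ totalMetric_swap S p) (h.differentiableAt_coord_totalJ hS.normal p)
    (h.differentiableAt_fundamentalForm_total S p),
    h.act_d_fundamentalForm_total hΩ hS ⟨hb.1, hb.2⟩, hu, hv, hw]
  simp only [DForm.pullback_val₂, Covector.pullback_val, AlmostContactMetric.torsionForm]
  ring

/-- The Lie brackets of related vector fields are related. -/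
theorem dproj_bracket (h : IsCircleBundleWithConnection (m := m) proj θ) {p : P}
    {X Y : VField (𝓡 k) P} {X' Y' : VField (𝓡 m) N} (hX : VField.DiffAt X p)
    (hY : VField.DiffAt Y p) (hX' : VField.DiffAt X' (proj p)) (hY' : VField.DiffAt Y' (proj p))
    (hXX' : ∀ᶠ q in 𝓝 p, dproj k m proj q (X.val q) = X'.val (proj q))
    (hYY' : ∀ᶠ q in 𝓝 p, dproj k m proj q (Y.val q) = Y'.val (proj q)) :
    dproj k m proj p (bracketVal X Y p) = bracketVal X' Y' (proj p) := by
  have hf := h.bundle.contDiffAt_projCoord p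
  have hf1 : DifferentiableAt ℝ (projCoord k m proj p) (center k p) :=
    hf.differentiableAt (by simp)
  have hf2 : DifferentiableAt ℝ (fderiv ℝ (projCoord k m proj p)) (center k p) :=
    (hf.fderiv_right (m := 1) (by norm_cast)).differentiableAt (by simp)
  have hsymm (a b : EuclideanSpace ℝ (Fin k)) :
      fderiv ℝ (fderiv ℝ (projCoord k m proj p)) (center k p) a b =
        fderiv ℝ (fderiv ℝ (projCoord k m proj p)) (center k p) b a :=
    (hf.isSymmSndFDerivAt (by simpa using two_le_infty)).eq a b
  have hsy : Filter.Tendsto (extChartAt (𝓡 k) p).symm (𝓝 (center k p)) (𝓝 p) := by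
    have := continuousAt_extChartAt_symm (I := 𝓡 k) p
    unfold ContinuousAt at this
    rwa [chart_symm_self] at this
  -- The derivative of the relation `Dπ(Z) = Z' ∘ π` in coordinates. In the difference for two
  -- related pairs of fields, the second derivatives of `π` cancel by symmetry.
  have key (Z : VField (𝓡 k) P) (Z' : VField (𝓡 m) N) (hZ : VField.DiffAt Z p)
      (hZ' : VField.DiffAt Z' (proj p))
      (hZZ' : ∀ᶠ q in 𝓝 p, dproj k m proj q (Z.val q) = Z'.val (proj q))
      (u : EuclideanSpace ℝ (Fin k)) :
      fderiv ℝ (fderiv ℝ (projCoord k m proj p)) (center k p) u (Z.val p)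
        + dproj k m proj p (fderiv ℝ (Z.coord p) (center k p) u) =
      fderiv ℝ (Z'.coord (proj p)) (center m (proj p)) (dproj k m proj p u) := by
    have h1 : (fun y ↦ fderiv ℝ (projCoord k m proj p) y (Z.coord p y)) =ᶠ[𝓝 (center k p)]
        fun y ↦ Z'.coord (proj p) (projCoord k m proj p y) := by
      filter_upwards [h.bundle.eventually_fderiv_projCoord p, hsy.eventually hZZ']
        with y ⟨hy, hy', hq, hf⟩ hr
      apply frame_injective hy'
      rw [hf, frame_vfield_coord Z' hy' hq, frame_vfield_coord Z hy rfl, hr]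
    rw [diffAt_iff_coord] at hZ hZ'
    have h2 := (hf2.hasFDerivAt.clm_apply hZ.hasFDerivAt).fderiv
    rw [h1.fderiv_eq] at h2
    have hZ'' : DifferentiableAt ℝ (Z'.coord (proj p))
        (projCoord k m proj p (center k p)) := by
      rw [projCoord_self]; exact hZ'
    have h3 := (hZ''.hasFDerivAt.comp (center k p) hf1.hasFDerivAt).fderiv
    have h4 := congrArg (fun L : EuclideanSpace ℝ (Fin k) →L[ℝ] EuclideanSpace ℝ (Fin m) ↦ L u)
      (h3.symm.trans h2)
    rw [projCoord_self, h.bundle.fderiv_projCoord, VField.coord_self] at h4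
    rw [add_comm]
    exact h4.symm
  have hbr : bracketVal X Y p = fderiv ℝ (Y.coord p) (center k p) (X.val p)
    - fderiv ℝ (X.coord p) (center k p) (Y.val p) := mlieBracket_eq_coord X Y p
  have hbr' : bracketVal X' Y' (proj p) =
    fderiv ℝ (Y'.coord (proj p)) (center m (proj p)) (X'.val (proj p))
      - fderiv ℝ (X'.coord (proj p)) (center m (proj p)) (Y'.val (proj p)) :=
    mlieBracket_eq_coord X' Y' (proj p)
  rw [hbr, hbr', ← hXX'.self_of_nhds, ← hYY'.self_of_nhds, ← key X X' hX hX' hXX',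
    ← key Y Y' hY hY' hYY', map_sub, hsymm (X.val p)]
  abel

/-- Horizontal lifts of coordinate fields. -/
theorem exists_horizontal_lift (h : IsCircleBundleWithConnection (m := m) proj θ) (p : P)
    {u : EuclideanSpace ℝ (Fin k)} (hu : θ.val p u = 0) :
    ∃ X : VField (𝓡 k) P, VField.DiffAt X p ∧ X.val p = u ∧ ∀ᶠ q in 𝓝 p,
      dproj k m proj q (X.val q) =
        VField.val (coordField (proj p) (dproj k m proj p u)) (proj q) ∧
      θ.val q (X.val q) = 0 := by
  -- Inverting the splitting on the constant `(π_* u, 0)` gives a field whose projection has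
  -- constant components and on which `θ` vanishes.
  let V (y : EuclideanSpace ℝ (Fin k)) : EuclideanSpace ℝ (Fin k) :=
    (splitCoord (m := m) proj θ p y).inverse (dproj k m proj p u, 0)
  have hV : DifferentiableAt ℝ V (center k p) :=
    (h.differentiableAt_inverse_splitCoord p).clm_apply (differentiableAt_const _)
  refine ⟨fieldOfCoord p V, diffAt_fieldOfCoord hV, ?_, ?_⟩
  · have h1 : V (center k p) = u := by
      have h2 : splitCoord (m := m) proj θ p (center k p) u = (dproj k m proj p u, 0) := by
        unfold splitCoord
        rw [h.bundle.fderiv_projCoord, θ.coord_self]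
        exact Prod.ext rfl hu
      change (splitCoord (m := m) proj θ p _).inverse _ = u
      rw [← h2, (h.splitCoord_isInvertible p).inverse_apply_self]
    exact (fieldOfCoord_self p V).trans h1
  · have h1 := (h.bundle.eventually_fderiv_projCoord p).and
      (h.eventually_splitCoord_isInvertible p)
    filter_upwards [(continuousAt_extChartAt (I := 𝓡 k) p).eventually h1,
      chart_source_eventually (E := EuclideanSpace ℝ (Fin k)) p]
      with q ⟨⟨hy, hy', hq, hf⟩, hi⟩ hs
    have h2 : (extChartAt (𝓡 k) p).symm (extChartAt (𝓡 k) p q) = q :=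
      (extChartAt (𝓡 k) p).left_inv hs
    have h3 := hi.self_apply_inverse (dproj k m proj p u, (0 : ℝ))
    have h4 : fderiv ℝ (projCoord k m proj p) (extChartAt (𝓡 k) p q) (V (extChartAt (𝓡 k) p q)) =
      dproj k m proj p u := congrArg Prod.fst h3
    have h5 : θ.coord p (extChartAt (𝓡 k) p q) (V (extChartAt (𝓡 k) p q)) = 0 :=
      congrArg Prod.snd h3
    have h6 := hf (V (extChartAt (𝓡 k) p q))
    rw [h4] at h6
    rw [h2] at hq h6
    rw [covector_coord_apply θ h2] at h5
    refine ⟨h6.symm.trans ?_, h5⟩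
    rw [← hq]
    exact (coordField_symm _ hy').symm

/-- On horizontal lifts, the Bismut connection of the total space projects to the metric
connection with torsion `dη ∧ η`. -/
theorem bismut_horizontal (h : IsCircleBundleWithConnection (m := m) proj θ)
    (hΩ : IsCurvature proj θ Ω) (hS : S.IsQuasiSasakian)
    (hH : IsHermitian (totalJ S proj θ) (totalMetric S proj θ))
    {nabla : CovariantDerivative (𝓡 k) (EuclideanSpace ℝ (Fin k))
      (TangentSpace (𝓡 k) : P → Type _)}
    (hB : IsBismut (totalJ S proj θ) (totalMetric S proj θ) nabla)
    {nablac : CovariantDerivative (𝓡 m) (EuclideanSpace ℝ (Fin m))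
      (TangentSpace (𝓡 m) : N → Type _)} (hc : S.IsMetricWithTorsion nablac)
    {Y : VField (𝓡 k) P} {U : VField (𝓡 m) N} {p : P} (hY : VField.DiffAt Y p)
    (hU : VField.DiffAt U (proj p)) (hθY : ∀ q, θ.val q (Y.val q) = 0)
    (hYU : ∀ q, dproj k m proj q (Y.val q) = U.val (proj q))
    {u w : EuclideanSpace ℝ (Fin k)} (hu : θ.val p u = 0) (hw : θ.val p w = 0) :
    (totalMetric S proj θ).val p (covDerivVal nabla Y p u) w =
      S.met.val (proj p) (covDerivVal nablac U (proj p) (dproj k m proj p u))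
        (dproj k m proj p w) := by
  -- The vectors `u` and `w` are extended to horizontal fields over coordinate fields of `N`, so
  -- that every metric function and every bracket in the Koszul formula descends.
  obtain ⟨X, hX, hXu, hXp⟩ := h.exists_horizontal_lift p hu
  obtain ⟨Z, hZ, hZw, hZp⟩ := h.exists_horizontal_lift p hw
  have hX' := diffAt_coordField (proj p) (dproj k m proj p u)
  have hZ' := diffAt_coordField (proj p) (dproj k m proj p w)
  have k1 := koszul_val hB.metric (fun q ↦ totalMetric_swap S q) hX hY hZ
  have k2 := koszul_val hc.1 S.g.symm hX' hU hZ'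
  have hfun {A B : VField (𝓡 k) P} {A' B' : VField (𝓡 m) N} (hA' : VField.DiffAt A' (proj p))
      (hB' : VField.DiffAt B' (proj p))
      (hA : ∀ᶠ q in 𝓝 p, dproj k m proj q (A.val q) = A'.val (proj q) ∧ θ.val q (A.val q) = 0)
      (hB : ∀ᶠ q in 𝓝 p, dproj k m proj q (B.val q) = B'.val (proj q) ∧ θ.val q (B.val q) = 0)
      (s : EuclideanSpace ℝ (Fin k)) :
      mvfderiv (𝓡 k) (fun q ↦ totalMetric S proj θ q (A q) (B q)) p s =
        mvfderiv (𝓡 m) (fun x ↦ S.g.inner x (A' x) (B' x)) (proj p) (dproj k m proj p s) := by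
    refine mvfderiv_of_eventuallyEq_comp (h.bundle.mdifferentiableAt p)
      (metric_diffAt S.g (proj p) A' B' hA' hB') ?_ s
    filter_upwards [hA, hB] with q hqA hqB
    have h1 := totalMetric_apply S proj θ q (A.val q) (B.val q)
    rw [hqA.1, hqB.1, hqA.2, zero_mul, add_zero] at h1
    exact h1
  have hYp : ∀ᶠ q in 𝓝 p, dproj k m proj q (Y.val q) = U.val (proj q) ∧ θ.val q (Y.val q) = 0 :=
    Filter.Eventually.of_forall fun q ↦ ⟨hYU q, hθY q⟩
  -- One horizontal argument suffices. The brackets of horizontal fields may have vertical parts,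
  -- but these do not contribute.
  have hval (a b : EuclideanSpace ℝ (Fin k)) (hb : θ.val p b = 0) :
      (totalMetric S proj θ).val p a b =
        S.met.val (proj p) (dproj k m proj p a) (dproj k m proj p b) := by
    rw [totalMetric_apply, hb, mul_zero, add_zero]
  have ht (a b c : EuclideanSpace ℝ (Fin m)) :
      S.met.val (proj p) (torsionVal nablac (proj p) a b) c = S.torsionForm (proj p) a b c :=
    (hc.2 (proj p) a b c).trans (S.wedge_dη_η (proj p) a b c)
  rw [hfun hU hZ' hYp hZp, hfun hX' hZ' hXp hZp, hfun hX' hU hXp hYp, hXu, hZw,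
    h.torsion_bismut_horizontal hΩ hS hH hB p hu (hθY p) hw,
    h.torsion_bismut_horizontal hΩ hS hH hB p hu hw (hθY p),
    h.torsion_bismut_horizontal hΩ hS hH hB p (hθY p) hw hu,
    hval _ _ hw, hval _ _ hw, hval _ _ (hθY p), hval _ _ hu,
    h.dproj_bracket hX hY hX' hU (hXp.mono fun q hq ↦ hq.1) (hYp.mono fun q hq ↦ hq.1),
    h.dproj_bracket hX hZ hX' hZ' (hXp.mono fun q hq ↦ hq.1) (hZp.mono fun q hq ↦ hq.1),
    h.dproj_bracket hY hZ hU hZ' (hYp.mono fun q hq ↦ hq.1) (hZp.mono fun q hq ↦ hq.1),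
    hYU p] at k1
  rw [coordField_val, coordField_val, ht, ht, ht] at k2
  rw [hval _ _ hw]
  refine mul_left_cancel₀ (two_ne_zero (α := ℝ)) (k1.trans ?_)
  refine Eq.trans ?_ k2.symm
  rfl

end IsCircleBundleWithConnection

end TotalSpace

end SKTCircleBundle

end

/-! ### The main theorem -/

open SKTCircleBundle in
theorem mainTheorem2 (n : ℕ)
    {N : Type*} [TopologicalSpace N] [T2Space N] [SecondCountableTopology N]
    [ChartedSpace (EuclideanSpace ℝ (Fin (2 * n + 1))) N] [IsManifold (𝓡 (2 * n + 1)) ∞ N]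
    {P : Type*} [TopologicalSpace P] [T2Space P] [SecondCountableTopology P]
    [ChartedSpace (EuclideanSpace ℝ (Fin (2 * n + 2))) P] [IsManifold (𝓡 (2 * n + 2)) ∞ P]
    [MulAction Circle P]
    (S : AlmostContactMetric (2 * n + 1) N) (hS : S.IsQuasiSasakian)
    (Ω : DForm (𝓡 (2 * n + 1)) N 2) (hΩ : Ω.IsSmooth) (hΩd : ∀ x : N, Ω.d x = 0)
    (proj : P → N)
    (hproj : IsPrincipalCircleBundle (k := 2 * n + 2) (m := 2 * n + 1) proj)
    (θ : Covector (𝓡 (2 * n + 2)) P) (hθ : IsConnectionForm θ)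
    (hcurv : ∀ p : P, θ.toForm.d p = (Ω (proj p)).compContinuousLinearMap
      (mfderiv (𝓡 (2 * n + 2)) (𝓡 (2 * n + 1)) proj p)) :
    (IsSKT (totalJ S proj θ) (totalMetric S proj θ) ↔
      (∀ (x : N) (u v : TangentSpace (𝓡 (2 * n + 1)) x),
        Ω x ![S.φ x u, S.φ x v] = Ω x ![u, v]) ∧
      (∀ (x : N) (u : TangentSpace (𝓡 (2 * n + 1)) x), Ω x ![S.ξ x, u] = 0) ∧
      (∀ (x : N) (v : Fin (2 + 2) → TangentSpace (𝓡 (2 * n + 1)) x),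
        wedge (S.dη x) (S.dη x) v = -wedge (Ω x) (Ω x) v)) ∧
    (∃ nablac : CovariantDerivative (𝓡 (2 * n + 1)) (EuclideanSpace ℝ (Fin (2 * n + 1)))
        (TangentSpace (𝓡 (2 * n + 1)) : N → Type _),
      S.IsCanonicalConnection nablac ∧ S.IsMetricWithTorsion nablac ∧
      (∀ nabla : CovariantDerivative (𝓡 (2 * n + 1)) (EuclideanSpace ℝ (Fin (2 * n + 1)))
          (TangentSpace (𝓡 (2 * n + 1)) : N → Type _), S.IsMetricWithTorsion nabla →
        ∀ (Y : VField (𝓡 (2 * n + 1)) N) (x : N), VField.DiffAt Y x →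
          nabla Y x = nablac Y x) ∧
      (IsHermitian (totalJ S proj θ) (totalMetric S proj θ) →
        ∀ nablaB : CovariantDerivative (𝓡 (2 * n + 2)) (EuclideanSpace ℝ (Fin (2 * n + 2)))
          (TangentSpace (𝓡 (2 * n + 2)) : P → Type _),
        IsBismut (totalJ S proj θ) (totalMetric S proj θ) nablaB →
        ∀ (Y : VField (𝓡 (2 * n + 2)) P) (U : VField (𝓡 (2 * n + 1)) N),
          VField.IsSmooth Y → VField.IsSmooth U →
          (∀ p : P, θ p (Y p) = 0) →
          (∀ p : P, mfderiv (𝓡 (2 * n + 2)) (𝓡 (2 * n + 1)) proj p (Y p) = U (proj p)) →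
          ∀ (p : P) (X Z : TangentSpace (𝓡 (2 * n + 2)) p), θ p X = 0 → θ p Z = 0 →
            totalMetric S proj θ p (nablaB Y p X) Z =
              S.g.inner (proj p)
                (nablac U (proj p) (mfderiv (𝓡 (2 * n + 2)) (𝓡 (2 * n + 1)) proj p X))
                (mfderiv (𝓡 (2 * n + 2)) (𝓡 (2 * n + 1)) proj p Z))) := by
  have h : IsCircleBundleWithConnection (m := 2 * n + 1) proj θ := ⟨hproj, hθ, rfl⟩
  refine ⟨(h.isSKT_iff hcurv hS hΩ hΩd).trans
    ⟨fun hk ↦ ⟨hk.1.φ_φ, hk.1.ξ_left, hk.2⟩, fun hk ↦ ⟨⟨hk.1, hk.2.1⟩, hk.2.2⟩⟩, ?_⟩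
  obtain ⟨nablac, hcan, hmt⟩ := S.exists_connection_torsionForm
  refine ⟨nablac, hcan, hmt, fun nabla hn Y x hY ↦ ?_, ?_⟩
  -- Both connections are metric with the same torsion 3-form, so the Koszul formula makes them
  -- agree on fields differentiable at the point.
  · exact eq_of_torsion_eq hn.1 hmt.1 (fun x u v w ↦ (hn.2 x u v w).trans (hmt.2 x u v w).symm) hY
  · intro hH nablaB hB Y U hY hU hθY hYU p X Z hX hZ
    exact h.bismut_horizontal hcurv hS hH hB hmt (hY.mdifferentiableAt (by simp))
      (hU.mdifferentiableAt (by simp)) hθY hYU hX hZ
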